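/- Let $\Bbbk$ be a field and let $C$ be a cocommutative cosemisimple $\Bbbk$-coalgebra (a direct sum of simple subcoalgebras). Assume that $\Bbbk$ is perfect or, more generally, that all tensor powers $C^{\otimes n}$, $n\ge 0$, are cosemisimple. For a cocommutative coalgebra $D$ let $Coalg\,D$ be the category of morphisms of cocommutative coalgebras $\phi:E\to D$ (the slice category over $D$), and let $Vec^D$ be the category of $D$-comodules with the symmetric monoidal structure given by the cotensor product $V\otimes^D W=\{t\in V\otimes W : (\rho_V\otimes id)(t)=(id\otimes\tau\rho_W)(t)\}$ with unit $D$. Let $U^D:Coalg\,D\to Vec^D$ send $\phi:E\to D$ to $E$ with the coaction $(id\otimes\phi)\Delta_E$. For a coalgebra morphism $f:E\to D$ let $L_f:Coalg\,D\to Coalg\,E$ be pullback along $f$ in the category of cocommutative coalgebras, and let $K_f=f^*:Vec^D\to Vec^E$, $V\mapsto V\otimes^D E$, with the $E$-coaction induced by $\Delta_E$. Let $\mathcal B$ be the full subcategory of the category of cocommutative coalgebras on the objects $C^{\otimes n}$, $n\ge 0$ ($C^{\otimes 0}=\Bbbk$). Then the category of cocommutative coalgebras has pullbacks (so that $L_f$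 is defined), and the assignment $D\mapsto U^D$, $f\mapsto (L_f,K_f)$ underlies a linear hyperdoctrine $\Phi:\mathcal B^{op}\to LNL$. That is: 1. $\mathcal B$ has finite products, and each of its objects is isomorphic to a finite power of the object $C$. 2. For each $D$ in $\mathcal B$, $U^D$ is the left adjoint of an LNL adjunction $U^D\dashv R^D$: the category $Coalg\,D$ has finite products, $Vec^D$ is monoidal closed, $U^D$ is strong symmetric monoidal, $R^D$ is lax symmetric monoidal, and the unit and the counit are monoidal transformations. 3. For each $f:E\to D$ in $\mathcal B$, $(L_f,K_f)$ is a morphism of LNL adjunctions: $L_f$ preserves finite products; $K_f$ is strong symmetric monoidal and closed (the canonical maps $K_f[V,W]\to[K_fV,K_fW]$ are isomorphisms); there are natural isomorphisms $K_fU^D\cong U^{E}L_f$ (monoidal) and $L_fR^D\cong R^{E}K_f$ which identify $L_f\eta^D$ with $\eta^{E}L_f$, where $\eta$ denotes the units of the adjunctions. 4. $\Phi$ is functorial up to coherent isomorphism: $f\mapsto L_f$ and $f\mapsto K_f$ are pseudofunctors, the coherence isomorphisms of the latter are monoidal, and those of both are compatible with the isomorphisms $K_fU^D\cong U^{E}L_f$.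 5. For each $I$ in $\mathcal B$ and the projection $\pi_I:I\times C\to I$, the functor $K_{\pi_I}:Vec^I\to Vec^{I\times C}$ has a left adjoint $\exists_I$ and a right adjoint $\forall_I$, and $\forall$ satisfies the Beck–Chevalley condition: for each $f:J\to I$ in $\mathcal B$ the canonical transformation $K_f\forall_I\Rightarrow\forall_J K_{f\times id_C}$ is an isomorphism. The same holds for the projections $C\times I\to I$. -/

import Mathlib

universe u v w

noncomputable section

open CategoryTheory CategoryTheory.Limits MonoidalCategory TensorProduct Coalgebra

namespace LNLHyp

section Coactions

variable {k : Type u} [Field k] {D : Type u} [AddCommGroup D] [Module k D]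
variable {V W X : Type u} [AddCommGroup V] [Module k V] [AddCommGroup W] [Module k W]
  [AddCommGroup X] [Module k X]

/-- A map `V → V ⊗ D` applied to the left factor of `V ⊗ W`:
`x ⊗ y ↦ ∑ x₀ ⊗ y ⊗ x₁`. -/
def actL (v : V →ₗ[k] V ⊗[k] D) (W : Type u) [AddCommGroup W] [Module k W] :
    V ⊗[k] W →ₗ[k] (V ⊗[k] W) ⊗[k] D :=
  (TensorProduct.rightComm k V D W).toLinearMap ∘ₗ v.rTensor W

/-- A map `W → W ⊗ D` applied to the right factor of `V ⊗ W`: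
`x ⊗ y ↦ ∑ x ⊗ y₀ ⊗ y₁`. -/
def actR (V : Type u) [AddCommGroup V] [Module k V] (w : W →ₗ[k] W ⊗[k] D) :
    V ⊗[k] W →ₗ[k] (V ⊗[k] W) ⊗[k] D :=
  (TensorProduct.assoc k V W D).symm.toLinearMap ∘ₗ w.lTensor V

theorem actL_tmul (v : V →ₗ[k] V ⊗[k] D) (x : V) (y : W) :
    actL v W (x ⊗ₜ y) = ((TensorProduct.mk k V W).flip y).rTensor D (v x) := by
  simp only [actL, LinearMap.comp_apply, LinearMap.rTensor_tmul, LinearEquiv.coe_coe]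
  induction v x using TensorProduct.induction_on with
  | zero => simp
  | tmul a b => simp
  | add a b ha hb => simp only [TensorProduct.add_tmul, map_add, ha, hb]

theorem actR_tmul (w : W →ₗ[k] W ⊗[k] D) (x : V) (y : W) :
    actR V w (x ⊗ₜ y) = ((TensorProduct.mk k V W) x).rTensor D (w y) := by
  simp only [actR, LinearMap.comp_apply, LinearMap.lTensor_tmul, LinearEquiv.coe_coe]
  induction w y using TensorProduct.induction_on with
  | zero => simp
  | tmul a b => simp
  | add a b ha hb => simp only [TensorProduct.tmul_add, map_add, ha, hb]

theorem rTensor_injective_of_injective {M N : Type u} [AddCommGroup M] [Module k M]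
    [AddCommGroup N] [Module k N] (P : Type u) [AddCommGroup P] [Module k P]
    (g : M →ₗ[k] N) (h : Function.Injective g) : Function.Injective (g.rTensor P) :=
  Module.Flat.rTensor_preserves_injective_linearMap g h

theorem lTensor_injective_of_injective {M N : Type u} [AddCommGroup M] [Module k M]
    [AddCommGroup N] [Module k N] (P : Type u) [AddCommGroup P] [Module k P]
    (g : M →ₗ[k] N) (h : Function.Injective g) : Function.Injective (g.lTensor P) :=
  Module.Flat.lTensor_preserves_injective_linearMap g h

theorem mem_range_lTensor {M N : Type u} [AddCommGroup M] [Module k M]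
    [AddCommGroup N] [Module k N] (P : Type u) [AddCommGroup P] [Module k P]
    (g h : M →ₗ[k] N) (t : P ⊗[k] M) (ht : g.lTensor P t = h.lTensor P t) :
    t ∈ LinearMap.range ((LinearMap.eqLocus g h).subtype.lTensor P) := by
  have := Module.Flat.eqLocus_lTensor_eq k P g h
  exact this.le ht

theorem mem_range_rTensor {M N : Type u} [AddCommGroup M] [Module k M]
    [AddCommGroup N] [Module k N] (P : Type u) [AddCommGroup P] [Module k P]
    (g h : M →ₗ[k] N) (t : M ⊗[k] P) (ht : g.rTensor P t = h.rTensor P t) :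
    t ∈ LinearMap.range ((LinearMap.eqLocus g h).subtype.rTensor P) := by
  have h1 : g.lTensor P (TensorProduct.comm k M P t) = h.lTensor P (TensorProduct.comm k M P t) := by
    simp only [LinearMap.lTensor_comm, ht]
  obtain ⟨s, hs⟩ := mem_range_lTensor P g h _ h1
  refine ⟨TensorProduct.comm k _ _ s, ?_⟩
  rw [LinearMap.rTensor_comm, hs]
  simp

theorem rTensor_lTensor {M N P Q : Type u} [AddCommGroup M] [Module k M]
    [AddCommGroup N] [Module k N] [AddCommGroup P] [Module k P] [AddCommGroup Q] [Module k Q]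
    (g : M →ₗ[k] N) (h : P →ₗ[k] Q) (t : M ⊗[k] P) :
    g.rTensor Q (h.lTensor M t) = h.lTensor N (g.rTensor P t) := by
  rw [← LinearMap.comp_apply, ← LinearMap.comp_apply, LinearMap.lTensor_comp_rTensor,
    LinearMap.rTensor_comp_lTensor]

/-- The unique factorization of `p` through `eq(g, h) ⊗ P`. -/
def liftEq {M N : Type u} [AddCommGroup M] [Module k M]
    [AddCommGroup N] [Module k N] {P Q : Type u} [AddCommGroup P] [Module k P]
    [AddCommGroup Q] [Module k Q] (g h : M →ₗ[k] N) (p : Q →ₗ[k] M ⊗[k] P)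
    (hp : g.rTensor P ∘ₗ p = h.rTensor P ∘ₗ p) : Q →ₗ[k] (LinearMap.eqLocus g h) ⊗[k] P :=
  (LinearEquiv.ofInjective ((LinearMap.eqLocus g h).subtype.rTensor P)
    (rTensor_injective_of_injective P _ (Submodule.subtype_injective _))).symm.toLinearMap ∘ₗ
  p.codRestrict _ (fun q => mem_range_rTensor P g h (p q) (LinearMap.congr_fun hp q))

theorem liftEq_spec {M N : Type u} [AddCommGroup M] [Module k M]
    [AddCommGroup N] [Module k N] {P Q : Type u} [AddCommGroup P] [Module k P]
    [AddCommGroup Q] [Module k Q] (g h : M →ₗ[k] N) (p : Q →ₗ[k] M ⊗[k] P)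
    (hp : g.rTensor P ∘ₗ p = h.rTensor P ∘ₗ p) (q : Q) :
    (LinearMap.eqLocus g h).subtype.rTensor P (liftEq g h p hp q) = p q := by
  have := LinearEquiv.apply_symm_apply (LinearEquiv.ofInjective
    ((LinearMap.eqLocus g h).subtype.rTensor P)
    (rTensor_injective_of_injective P _ (Submodule.subtype_injective _)))
    (p.codRestrict _ (fun q => mem_range_rTensor P g h (p q) (LinearMap.congr_fun hp q)) q)
  exact congrArg Subtype.val this

theorem act_commute {C : Type u} [AddCommGroup C] [Module k C]
    (v : V →ₗ[k] V ⊗[k] C) (w : W →ₗ[k] W ⊗[k] D) (t : V ⊗[k] W) :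
    (actL v W).rTensor D (actR V w t) =
      TensorProduct.rightComm k (V ⊗[k] W) D C ((actR V w).rTensor C (actL v W t)) := by
  induction t using TensorProduct.induction_on with
  | zero => simp
  | add a b ha hb => simp only [map_add, ha, hb]
  | tmul x y =>
    have hL : ∀ b : W ⊗[k] D, (actL v W).rTensor D (((TensorProduct.mk k V W) x).rTensor D b) =
        (TensorProduct.assoc k (V ⊗[k] W) C D).symm
          (TensorProduct.tensorTensorTensorComm k V C W D (v x ⊗ₜ b)) := by
      intro b
      induction b using TensorProduct.induction_on with
      | zero => simp
      | add a b ha hb => simp only [map_add, TensorProduct.tmul_add, ha, hb]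
      | tmul y' d =>
        simp only [LinearMap.rTensor_tmul, TensorProduct.mk_apply, actL_tmul]
        induction v x using TensorProduct.induction_on with
        | zero => simp
        | add a b ha hb => simp only [map_add, TensorProduct.add_tmul, ha, hb]
        | tmul a b => simp
    have hR : ∀ a : V ⊗[k] C, TensorProduct.rightComm k (V ⊗[k] W) D C
        ((actR V w).rTensor C (((TensorProduct.mk k V W).flip y).rTensor C a)) =
        (TensorProduct.assoc k (V ⊗[k] W) C D).symm
          (TensorProduct.tensorTensorTensorComm k V C W D (a ⊗ₜ w y)) := by
      intro a
      induction a using TensorProduct.induction_on with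
      | zero => simp
      | add a b ha hb => simp only [map_add, TensorProduct.add_tmul, ha, hb]
      | tmul x' c =>
        simp only [LinearMap.rTensor_tmul, TensorProduct.mk_apply, LinearMap.flip_apply, actR_tmul]
        induction w y using TensorProduct.induction_on with
        | zero => simp
        | add a b ha hb =>
          simp only [map_add, TensorProduct.add_tmul, TensorProduct.tmul_add, ha, hb]
        | tmul a b => simp
    rw [actL_tmul, actR_tmul, hL, hR]

theorem act_assoc₁ (v : V →ₗ[k] V ⊗[k] D) (t : (V ⊗[k] W) ⊗[k] X) :
    actL v (W ⊗[k] X) (TensorProduct.assoc k V W X t) =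
      (TensorProduct.assoc k V W X).toLinearMap.rTensor D (actL (actL v W) X t) := by
  refine LinearMap.congr_fun (f := actL v (W ⊗[k] X) ∘ₗ (TensorProduct.assoc k V W X).toLinearMap)
    (g := (TensorProduct.assoc k V W X).toLinearMap.rTensor D ∘ₗ actL (actL v W) X) ?_ t
  apply TensorProduct.ext_threefold
  intro x y z
  simp only [LinearMap.comp_apply, LinearEquiv.coe_coe, TensorProduct.assoc_tmul, actL_tmul]
  induction v x using TensorProduct.induction_on with
  | zero => simp
  | add a b ha hb => simp only [map_add, ha, hb]
  | tmul x y => simp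

theorem act_assoc₂ (w : W →ₗ[k] W ⊗[k] D) (t : (V ⊗[k] W) ⊗[k] X) :
    actR V (actL w X) (TensorProduct.assoc k V W X t) =
      (TensorProduct.assoc k V W X).toLinearMap.rTensor D (actL (actR V w) X t) := by
  refine LinearMap.congr_fun (f := actR V (actL w X) ∘ₗ (TensorProduct.assoc k V W X).toLinearMap)
    (g := (TensorProduct.assoc k V W X).toLinearMap.rTensor D ∘ₗ actL (actR V w) X) ?_ t
  apply TensorProduct.ext_threefold
  intro x y z
  simp only [LinearMap.comp_apply, LinearEquiv.coe_coe, TensorProduct.assoc_tmul, actL_tmul,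
    actR_tmul]
  induction w y using TensorProduct.induction_on with
  | zero => simp
  | add a b ha hb => simp only [map_add, ha, hb]
  | tmul x y => simp

theorem act_assoc₃ (w : X →ₗ[k] X ⊗[k] D) (t : (V ⊗[k] W) ⊗[k] X) :
    actR V (actR W w) (TensorProduct.assoc k V W X t) =
      (TensorProduct.assoc k V W X).toLinearMap.rTensor D (actR (V ⊗[k] W) w t) := by
  refine LinearMap.congr_fun (f := actR V (actR W w) ∘ₗ (TensorProduct.assoc k V W X).toLinearMap)
    (g := (TensorProduct.assoc k V W X).toLinearMap.rTensor D ∘ₗ actR (V ⊗[k] W) w) ?_ t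
  apply TensorProduct.ext_threefold
  intro x y z
  simp only [LinearMap.comp_apply, LinearEquiv.coe_coe, TensorProduct.assoc_tmul, actR_tmul]
  induction w z using TensorProduct.induction_on with
  | zero => simp
  | add a b ha hb => simp only [map_add, ha, hb]
  | tmul x y => simp

theorem actL_comm (w : W →ₗ[k] W ⊗[k] D) (t : V ⊗[k] W) :
    actL w V (TensorProduct.comm k V W t) =
      (TensorProduct.comm k V W).toLinearMap.rTensor D (actR V w t) := by
  induction t using TensorProduct.induction_on with
  | zero => simp
  | add a b ha hb => simp only [map_add, ha, hb]
  | tmul x y =>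
    rw [TensorProduct.comm_tmul, actL_tmul, actR_tmul]
    induction w y using TensorProduct.induction_on with
    | zero => simp
    | add a b ha hb => simp only [map_add, ha, hb]
    | tmul x y => simp

theorem actR_comm (v : V →ₗ[k] V ⊗[k] D) (t : V ⊗[k] W) :
    actR W v (TensorProduct.comm k V W t) =
      (TensorProduct.comm k V W).toLinearMap.rTensor D (actL v W t) := by
  induction t using TensorProduct.induction_on with
  | zero => simp
  | add a b ha hb => simp only [map_add, ha, hb]
  | tmul x y =>
    rw [TensorProduct.comm_tmul, actL_tmul, actR_tmul]
    induction v x using TensorProduct.induction_on with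
    | zero => simp
    | add a b ha hb => simp only [map_add, ha, hb]
    | tmul x y => simp

end Coactions

section Comodules

variable (k : Type u) [Field k] (D : Type u) [AddCommGroup D] [Module k D] [Coalgebra k D]

/-- A (right) comodule over the coalgebra `D`. -/
structure Comodule where
  carrier : Type u
  [addCommGroup : AddCommGroup carrier]
  [module : Module k carrier]
  coact : carrier →ₗ[k] carrier ⊗[k] D
  coassoc : (TensorProduct.assoc k carrier D D).toLinearMap ∘ₗ coact.rTensor D ∘ₗ coact =
    (comul : D →ₗ[k] D ⊗[k] D).lTensor carrier ∘ₗ coact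
  counit_coact : (TensorProduct.rid k carrier).toLinearMap ∘ₗ
    (counit : D →ₗ[k] k).lTensor carrier ∘ₗ coact = LinearMap.id

attribute [instance] Comodule.addCommGroup Comodule.module

variable {k D}

namespace Comodule

/-- Morphisms of comodules. -/
@[ext]
structure Hom (V W : Comodule k D) where
  lin : V.carrier →ₗ[k] W.carrier
  comm : lin.rTensor D ∘ₗ V.coact = W.coact ∘ₗ lin

instance : Category (Comodule k D) where
  Hom := Hom
  id V := ⟨LinearMap.id, by simp⟩
  comp f g := ⟨g.lin ∘ₗ f.lin, by
    rw [LinearMap.rTensor_comp, LinearMap.comp_assoc, f.comm, ← LinearMap.comp_assoc, g.comm,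
      LinearMap.comp_assoc]⟩

@[ext]
theorem hom_ext {V W : Comodule k D} (f g : V ⟶ W) (h : f.lin = g.lin) : f = g := Hom.ext h

@[simp] theorem id_lin (V : Comodule k D) : Hom.lin (𝟙 V) = LinearMap.id := rfl

@[simp] theorem comp_lin {V W X : Comodule k D} (f : V ⟶ W) (g : W ⟶ X) :
    (f ≫ g).lin = g.lin ∘ₗ f.lin := rfl

/-- Build an isomorphism from a linear equivalence commuting with the coactions. -/
def isoMk {V W : Comodule k D} (e : V.carrier ≃ₗ[k] W.carrier)
    (h : e.toLinearMap.rTensor D ∘ₗ V.coact = W.coact ∘ₗ e.toLinearMap) : V ≅ W where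
  hom := ⟨e.toLinearMap, h⟩
  inv := ⟨e.symm.toLinearMap, by
    apply LinearMap.ext
    intro x
    obtain ⟨y, rfl⟩ := e.surjective x
    have h1 := LinearMap.congr_fun h y
    simp only [LinearMap.comp_apply, LinearEquiv.coe_coe] at h1 ⊢
    rw [← h1, ← LinearMap.comp_apply, ← LinearMap.rTensor_comp]
    simp⟩
  hom_inv_id := by ext x; simp
  inv_hom_id := by ext x; simp

theorem coassoc_apply (V : Comodule k D) (x : V.carrier) :
    TensorProduct.assoc k V.carrier D D (V.coact.rTensor D (V.coact x)) =
    (comul : D →ₗ[k] D ⊗[k] D).lTensor V.carrier (V.coact x) :=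
  LinearMap.congr_fun V.coassoc x

/-- `D` as a comodule over itself. -/
def regular (k : Type u) [Field k] (D : Type u) [AddCommGroup D] [Module k D] [Coalgebra k D] :
    Comodule k D where
  carrier := D
  coact := comul
  coassoc := Coalgebra.coassoc
  counit_coact := by
    rw [Coalgebra.lTensor_counit_comp_comul]
    ext; simp

/-- Corestriction of a `D`-comodule along a coalgebra map `f : D → C`:
same space, coaction `(id ⊗ f) ∘ ρ`. -/
def corestrict {C : Type u} [AddCommGroup C] [Module k C] [Coalgebra k C] (f : D →ₗc[k] C)
    (V : Comodule k D) : Comodule k C where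
  carrier := V.carrier
  coact := (f : D →ₗ[k] C).lTensor V.carrier ∘ₗ V.coact
  coassoc := by
    have h1 : ∀ t : V.carrier ⊗[k] D, TensorProduct.assoc k V.carrier C C
        (((f : D →ₗ[k] C).lTensor V.carrier ∘ₗ V.coact).rTensor C
          ((f : D →ₗ[k] C).lTensor V.carrier t)) =
        (TensorProduct.map (f : D →ₗ[k] C) (f : D →ₗ[k] C)).lTensor V.carrier
          (TensorProduct.assoc k V.carrier D D (V.coact.rTensor D t)) := by
      intro t
      induction t using TensorProduct.induction_on with
      | zero => simp
      | add a b ha hb => simp only [map_add, ha, hb]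
      | tmul a b =>
        simp only [LinearMap.lTensor_tmul, LinearMap.rTensor_tmul, LinearMap.comp_apply]
        induction V.coact a using TensorProduct.induction_on with
        | zero => simp
        | add a b ha hb => simp only [map_add, TensorProduct.add_tmul, ha, hb]
        | tmul a b => simp
    apply LinearMap.ext
    intro x
    simp only [LinearMap.comp_apply, LinearEquiv.coe_coe]
    have := h1 (V.coact x)
    rw [LinearMap.rTensor_comp, LinearMap.comp_apply] at this ⊢
    rw [this, V.coassoc_apply, ← LinearMap.comp_apply, ← LinearMap.lTensor_comp,
      CoalgHomClass.map_comp_comul, LinearMap.lTensor_comp, LinearMap.comp_apply]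
  counit_coact := by
    have h := V.counit_coact
    rw [← CoalgHomClass.counit_comp f, LinearMap.lTensor_comp] at h
    exact h

/-- The comodule `V ⊗ W` for a vector space `V` and a comodule `W`, coacting on `W`. -/
def tensorR (V : Type u) [AddCommGroup V] [Module k V] (W : Comodule k D) : Comodule k D where
  carrier := V ⊗[k] W.carrier
  coact := actR V W.coact
  coassoc := by
    apply TensorProduct.ext'
    intro x y
    have h1 : ∀ t : W.carrier ⊗[k] D, TensorProduct.assoc k (V ⊗[k] W.carrier) D D
        ((actR V W.coact).rTensor D (((TensorProduct.mk k V W.carrier) x).rTensor D t)) =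
        ((TensorProduct.mk k V W.carrier) x).rTensor (D ⊗[k] D)
          (TensorProduct.assoc k W.carrier D D (W.coact.rTensor D t)) := by
      intro t
      induction t using TensorProduct.induction_on with
      | zero => simp
      | add a b ha hb => simp only [map_add, ha, hb]
      | tmul a b =>
        simp only [LinearMap.rTensor_tmul, TensorProduct.mk_apply, actR_tmul]
        induction W.coact a using TensorProduct.induction_on with
        | zero => simp
        | add a b ha hb => simp only [map_add, TensorProduct.add_tmul, ha, hb]
        | tmul a b => simp
    simp only [LinearMap.comp_apply, LinearEquiv.coe_coe, actR_tmul, h1, W.coassoc_apply]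
    rw [rTensor_lTensor]
  counit_coact := by
    apply TensorProduct.ext'
    intro x y
    have h1 : ∀ t : W.carrier ⊗[k] D, TensorProduct.rid k (V ⊗[k] W.carrier)
        ((counit : D →ₗ[k] k).lTensor _ (((TensorProduct.mk k V W.carrier) x).rTensor D t)) =
        x ⊗ₜ TensorProduct.rid k _ ((counit : D →ₗ[k] k).lTensor _ t) := by
      intro t
      induction t using TensorProduct.induction_on with
      | zero => simp
      | add a b ha hb => simp only [map_add, TensorProduct.tmul_add, ha, hb]
      | tmul a b => simp
    have h2 := LinearMap.congr_fun W.counit_coact y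
    simp only [LinearMap.comp_apply, LinearEquiv.coe_coe, LinearMap.id_apply] at h2 ⊢
    rw [actR_tmul, h1, h2]

/-- The subcomodule of `M` on an equalizer `eq(g, h)` that is stable under the coaction. -/
def eqSub (M : Comodule k D) {N : Type u} [AddCommGroup N] [Module k N]
    (g h : M.carrier →ₗ[k] N)
    (hp : g.rTensor D ∘ₗ (M.coact ∘ₗ (LinearMap.eqLocus g h).subtype) =
      h.rTensor D ∘ₗ (M.coact ∘ₗ (LinearMap.eqLocus g h).subtype)) : Comodule k D where
  carrier := LinearMap.eqLocus g h
  coact := liftEq g h (M.coact ∘ₗ (LinearMap.eqLocus g h).subtype) hp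
  coassoc := by
    apply LinearMap.ext
    intro x
    set ι := (LinearMap.eqLocus g h).subtype with hι
    set ρ := liftEq g h (M.coact ∘ₗ ι) hp with hρ
    have hs : ∀ y, ι.rTensor D (ρ y) = M.coact (ι y) := fun y => liftEq_spec g h _ hp y
    have hi : Function.Injective (ι.rTensor (D ⊗[k] D)) :=
      rTensor_injective_of_injective _ _ (Submodule.subtype_injective _)
    apply hi
    have h1 : ∀ t, ι.rTensor (D ⊗[k] D) (TensorProduct.assoc k _ D D (ρ.rTensor D t)) =
        TensorProduct.assoc k _ D D (M.coact.rTensor D (ι.rTensor D t)) := by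
      intro t
      induction t using TensorProduct.induction_on with
      | zero => simp
      | add a b ha hb => simp only [map_add, ha, hb]
      | tmul a b =>
        simp only [LinearMap.rTensor_tmul, ← hs]
        induction ρ a using TensorProduct.induction_on with
        | zero => simp
        | add a b ha hb => simp only [map_add, TensorProduct.add_tmul, ha, hb]
        | tmul a b => simp
    simp only [LinearMap.comp_apply, LinearEquiv.coe_coe]
    rw [h1, hs, M.coassoc_apply, ← hs, rTensor_lTensor]
  counit_coact := by
    apply LinearMap.ext
    intro x
    set ι := (LinearMap.eqLocus g h).subtype with hι
    set ρ := liftEq g h (M.coact ∘ₗ ι) hp with hρ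
    have hs : ∀ y, ι.rTensor D (ρ y) = M.coact (ι y) := fun y => liftEq_spec g h _ hp y
    have hi : Function.Injective ι := Submodule.subtype_injective _
    apply hi
    have h1 : ∀ t, ι (TensorProduct.rid k _ ((counit : D →ₗ[k] k).lTensor _ t)) =
        TensorProduct.rid k _ ((counit : D →ₗ[k] k).lTensor _ (ι.rTensor D t)) := by
      intro t
      induction t using TensorProduct.induction_on with
      | zero => simp
      | add a b ha hb => simp only [map_add, ha, hb]
      | tmul a b => simp
    simp only [LinearMap.comp_apply, LinearEquiv.coe_coe]
    rw [h1, hs]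
    exact LinearMap.congr_fun M.counit_coact (ι x)

theorem coact_cocomm [IsCocomm k D] (M : Comodule k D) (x : M.carrier) :
    TensorProduct.rightComm k M.carrier D D (M.coact.rTensor D (M.coact x)) =
      M.coact.rTensor D (M.coact x) := by
  apply (TensorProduct.assoc k M.carrier D D).injective
  have h1 : ∀ t : (M.carrier ⊗[k] D) ⊗[k] D, TensorProduct.assoc k M.carrier D D
      (TensorProduct.rightComm k M.carrier D D t) =
      (TensorProduct.comm k D D).toLinearMap.lTensor M.carrier
        (TensorProduct.assoc k M.carrier D D t) := by
    intro t
    refine LinearMap.congr_fun (f := ((TensorProduct.assoc k M.carrier D D).toLinearMap ∘ₗ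
      (TensorProduct.rightComm k M.carrier D D).toLinearMap)) (g :=
      (TensorProduct.comm k D D).toLinearMap.lTensor M.carrier ∘ₗ
        (TensorProduct.assoc k M.carrier D D).toLinearMap) ?_ t
    apply TensorProduct.ext_threefold
    intro a b c
    simp
  rw [h1, M.coassoc_apply, ← LinearMap.comp_apply, ← LinearMap.lTensor_comp,
    Coalgebra.comm_comp_comul]

theorem hom_comm_apply {V W : Comodule k D} (a : V ⟶ W) (x : V.carrier) :
    a.lin.rTensor D (V.coact x) = W.coact (a.lin x) := LinearMap.congr_fun a.comm x

section Cotensor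

variable {C : Type u} [AddCommGroup C] [Module k C] [Coalgebra k C]

theorem cot_stable [IsCocomm k D] (f : D →ₗc[k] C) (V : Comodule k C) (W : Comodule k D) :
    let g := actL V.coact W.carrier
    let h := (f : D →ₗ[k] C).lTensor (V.carrier ⊗[k] W.carrier) ∘ₗ actR V.carrier W.coact
    g.rTensor D ∘ₗ (actR V.carrier W.coact ∘ₗ (LinearMap.eqLocus g h).subtype) =
      h.rTensor D ∘ₗ (actR V.carrier W.coact ∘ₗ (LinearMap.eqLocus g h).subtype) := by
  intro g h
  apply LinearMap.ext
  rintro ⟨t, ht⟩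
  have ht' : g t = h t := ht
  simp only [LinearMap.comp_apply, Submodule.subtype_apply]
  have h1 := coact_cocomm (tensorR V.carrier W) t
  change TensorProduct.rightComm k (V.carrier ⊗[k] W.carrier) D D
    ((actR V.carrier W.coact).rTensor D (actR V.carrier W.coact t)) =
    (actR V.carrier W.coact).rTensor D (actR V.carrier W.coact t) at h1
  have h2 : ∀ s : (V.carrier ⊗[k] W.carrier) ⊗[k] D,
      TensorProduct.rightComm k _ D C ((actR V.carrier W.coact).rTensor C
        ((f : D →ₗ[k] C).lTensor (V.carrier ⊗[k] W.carrier) s)) =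
      ((f : D →ₗ[k] C).lTensor (V.carrier ⊗[k] W.carrier)).rTensor D
        (TensorProduct.rightComm k _ D D ((actR V.carrier W.coact).rTensor D s)) := by
    intro s
    induction s using TensorProduct.induction_on with
    | zero => simp
    | add a b ha hb => simp only [map_add, ha, hb]
    | tmul a b =>
      simp only [LinearMap.rTensor_tmul, LinearMap.lTensor_tmul]
      induction actR V.carrier W.coact a using TensorProduct.induction_on with
      | zero => simp
      | add a b ha hb => simp only [map_add, TensorProduct.add_tmul, ha, hb]
      | tmul a b => simp
  rw [act_commute, show actL V.coact W.carrier t = h t from ht', LinearMap.rTensor_comp,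
    LinearMap.comp_apply, LinearMap.comp_apply, h2, h1]

/-- For `f : D → C`, a `C`-comodule `V` and a `D`-comodule `W`: the cotensor product
`V ⊗^C W` (with `W` regarded as a `C`-comodule along `f`), i.e. the equalizer in `V ⊗ W` of
`x ⊗ y ↦ ∑ x₀ ⊗ y ⊗ x₁` and `x ⊗ y ↦ ∑ x ⊗ y₀ ⊗ f y₁`, with the
`D`-coaction `x ⊗ y ↦ ∑ x ⊗ y₀ ⊗ y₁`. -/
def cot [IsCocomm k D] (f : D →ₗc[k] C) (V : Comodule k C) (W : Comodule k D) :
    Comodule k D :=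
  eqSub (tensorR V.carrier W) (actL V.coact W.carrier)
    ((f : D →ₗ[k] C).lTensor (V.carrier ⊗[k] W.carrier) ∘ₗ actR V.carrier W.coact)
    (cot_stable f V W)

/-- The inclusion `V ⊗^C W → V ⊗ W`. -/
def cotIncl [IsCocomm k D] (f : D →ₗc[k] C) (V : Comodule k C) (W : Comodule k D) :
    (cot f V W).carrier →ₗ[k] V.carrier ⊗[k] W.carrier :=
  Submodule.subtype _

variable [IsCocomm k D] (f : D →ₗc[k] C)

theorem cotIncl_injective (V : Comodule k C) (W : Comodule k D) :
    Function.Injective (cotIncl f V W) := Submodule.subtype_injective _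

theorem cotIncl_coact (V : Comodule k C) (W : Comodule k D) (t : (cot f V W).carrier) :
    (cotIncl f V W).rTensor D ((cot f V W).coact t) =
      actR V.carrier W.coact (cotIncl f V W t) :=
  liftEq_spec _ _ _ (cot_stable f V W) t

theorem cotIncl_eq (V : Comodule k C) (W : Comodule k D) (t : (cot f V W).carrier) :
    actL V.coact W.carrier (cotIncl f V W t) =
      (f : D →ₗ[k] C).lTensor _ (actR V.carrier W.coact (cotIncl f V W t)) :=
  t.2

/-- Build a map into a cotensor product. -/
def cotLift {V : Comodule k C} {W : Comodule k D} {P : Type u} [AddCommGroup P] [Module k P]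
    (p : P →ₗ[k] V.carrier ⊗[k] W.carrier)
    (h : ∀ x, actL V.coact W.carrier (p x) =
      (f : D →ₗ[k] C).lTensor _ (actR V.carrier W.coact (p x))) :
    P →ₗ[k] (cot f V W).carrier :=
  LinearMap.codRestrict _ p h

theorem cotIncl_cotLift {V : Comodule k C} {W : Comodule k D} {P : Type u} [AddCommGroup P]
    [Module k P] (p : P →ₗ[k] V.carrier ⊗[k] W.carrier)
    (h : ∀ x, actL V.coact W.carrier (p x) =
      (f : D →ₗ[k] C).lTensor _ (actR V.carrier W.coact (p x))) (x : P) :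
    cotIncl f V W (cotLift f p h x) = p x := rfl

theorem actL_map {V V' : Comodule k C} {W W' : Type u} [AddCommGroup W] [Module k W]
    [AddCommGroup W'] [Module k W'] (a : V ⟶ V') (b : W →ₗ[k] W') (t : V.carrier ⊗[k] W) :
    actL V'.coact W' (TensorProduct.map a.lin b t) =
      (TensorProduct.map a.lin b).rTensor C (actL V.coact W t) := by
  induction t using TensorProduct.induction_on with
  | zero => simp
  | add a b ha hb => simp only [map_add, ha, hb]
  | tmul x y =>
    rw [TensorProduct.map_tmul, actL_tmul, actL_tmul, ← hom_comm_apply]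
    induction V.coact x using TensorProduct.induction_on with
    | zero => simp
    | add a b ha hb => simp only [map_add, ha, hb]
    | tmul x y => simp

theorem actR_map {V V' : Type u} [AddCommGroup V] [Module k V]
    [AddCommGroup V'] [Module k V'] {W W' : Comodule k C} (a : V →ₗ[k] V') (b : W ⟶ W')
    (t : V ⊗[k] W.carrier) :
    actR V' W'.coact (TensorProduct.map a b.lin t) =
      (TensorProduct.map a b.lin).rTensor C (actR V W.coact t) := by
  induction t using TensorProduct.induction_on with
  | zero => simp
  | add a b ha hb => simp only [map_add, ha, hb]
  | tmul x y =>
    rw [TensorProduct.map_tmul, actR_tmul, actR_tmul, ← hom_comm_apply]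
    induction W.coact y using TensorProduct.induction_on with
    | zero => simp
    | add a b ha hb => simp only [map_add, ha, hb]
    | tmul x y => simp

/-- Functoriality of the cotensor product: the restriction of `a ⊗ b`. -/
def cotMap {V V' : Comodule k C} {W W' : Comodule k D} (a : V ⟶ V') (b : W ⟶ W') :
    cot f V W ⟶ cot f V' W' where
  lin := cotLift f (TensorProduct.map a.lin b.lin ∘ₗ cotIncl f V W) (by
    intro x
    rw [LinearMap.comp_apply, actL_map, actR_map, cotIncl_eq, rTensor_lTensor])
  comm := by
    apply LinearMap.ext
    intro x
    apply rTensor_injective_of_injective D _ (cotIncl_injective f V' W')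
    simp only [LinearMap.comp_apply]
    rw [cotIncl_coact, cotIncl_cotLift, LinearMap.comp_apply, actR_map, ← cotIncl_coact,
      ← LinearMap.rTensor_comp_apply, ← LinearMap.rTensor_comp_apply]
    rfl

theorem cotIncl_cotMap {V V' : Comodule k C} {W W' : Comodule k D} (a : V ⟶ V') (b : W ⟶ W')
    (x : (cot f V W).carrier) :
    cotIncl f V' W' ((cotMap f a b).lin x) = TensorProduct.map a.lin b.lin (cotIncl f V W x) :=
  rfl

/-- Change of coalgebra `f^* : Vec^C ⥤ Vec^D` along `f : D → C`: `f^* V = V ⊗^C D`, with coaction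
induced by the comultiplication of `D`. -/
def pullback : Comodule k C ⥤ Comodule k D where
  obj V := cot f V (regular k D)
  map a := cotMap f a (𝟙 _)
  map_id V := by
    ext x
    apply cotIncl_injective
    rw [cotIncl_cotMap]
    simp
  map_comp a b := by
    ext x
    apply cotIncl_injective
    rw [comp_lin, LinearMap.comp_apply, cotIncl_cotMap, cotIncl_cotMap, cotIncl_cotMap,
      TensorProduct.map_map]
    simp

end Cotensor

section Monoidal

theorem actL_lTensor {V : Comodule k D} {W W' : Type u} [AddCommGroup W] [Module k W]
    [AddCommGroup W'] [Module k W'] (b : W →ₗ[k] W') (t : V.carrier ⊗[k] W) :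
    actL V.coact W' (b.lTensor V.carrier t) =
      (b.lTensor V.carrier).rTensor D (actL V.coact W t) :=
  actL_map (𝟙 V) b t

theorem lTensor_id_coe (M : Type u) [AddCommGroup M] [Module k M] (t : M ⊗[k] D) :
    ((CoalgHom.id k D : D →ₗc[k] D) : D →ₗ[k] D).lTensor M t = t :=
  LinearMap.congr_fun (LinearMap.lTensor_id M D) t

theorem counit_coact_apply (V : Comodule k D) (x : V.carrier) :
    TensorProduct.rid k V.carrier ((counit : D →ₗ[k] k).lTensor V.carrier (V.coact x)) = x :=
  LinearMap.congr_fun V.counit_coact x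

variable [IsCocomm k D]

/-- The cotensor product `V ⊗^D W` of two `D`-comodules. -/
def tens (V W : Comodule k D) : Comodule k D := cot (CoalgHom.id k D) V W

/-- The inclusion `V ⊗^D W → V ⊗ W`. -/
def incl (V W : Comodule k D) : (tens V W).carrier →ₗ[k] V.carrier ⊗[k] W.carrier :=
  cotIncl (CoalgHom.id k D) V W

theorem incl_injective (V W : Comodule k D) : Function.Injective (incl V W) :=
  cotIncl_injective _ V W

theorem incl_coact (V W : Comodule k D) (t : (tens V W).carrier) :
    (incl V W).rTensor D ((tens V W).coact t) = actR V.carrier W.coact (incl V W t) :=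
  cotIncl_coact _ V W t

theorem incl_eq (V W : Comodule k D) (t : (tens V W).carrier) :
    actL V.coact W.carrier (incl V W t) = actR V.carrier W.coact (incl V W t) :=
  (cotIncl_eq (CoalgHom.id k D) V W t).trans (lTensor_id_coe _ _)

/-- A morphism into a cotensor product, given by its underlying map to `V ⊗ W`. -/
def homMk {P V W : Comodule k D} (p : P.carrier →ₗ[k] V.carrier ⊗[k] W.carrier)
    (h : ∀ x, actL V.coact W.carrier (p x) = actR V.carrier W.coact (p x))
    (h' : ∀ x, p.rTensor D (P.coact x) = actR V.carrier W.coact (p x)) : P ⟶ tens V W where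
  lin := cotLift (CoalgHom.id k D) p (fun x => (h x).trans (lTensor_id_coe _ _).symm)
  comm := by
    apply LinearMap.ext
    intro x
    apply rTensor_injective_of_injective D _ (incl_injective V W)
    refine (LinearMap.rTensor_comp_apply D _ _ _).symm.trans ?_
    refine (h' x).trans ?_
    exact (incl_coact V W (cotLift (CoalgHom.id k D) p _ x)).symm

theorem incl_homMk {P V W : Comodule k D} (p : P.carrier →ₗ[k] V.carrier ⊗[k] W.carrier)
    (h : ∀ x, actL V.coact W.carrier (p x) = actR V.carrier W.coact (p x))
    (h' : ∀ x, p.rTensor D (P.coact x) = actR V.carrier W.coact (p x)) (x : P.carrier) :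
    incl V W ((homMk p h h').lin x) = p x := rfl

theorem exists_incl {V W : Comodule k D} (M : Type u) [AddCommGroup M] [Module k M]
    (t : M ⊗[k] (V.carrier ⊗[k] W.carrier))
    (h : actR M (actL V.coact W.carrier) t = actR M (actR V.carrier W.coact) t) :
    t ∈ LinearMap.range ((incl V W).lTensor M) := by
  refine mem_range_lTensor M _ _ t ?_
  have h1 := (TensorProduct.assoc k M (V.carrier ⊗[k] W.carrier) D).symm.injective h
  refine h1.trans ?_
  congr 2
  exact LinearMap.ext fun x => (lTensor_id_coe _ _).symm

/-- The map `(V ⊗^D W) ⊗^D X → V ⊗ (W ⊗ X)`. -/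
def inclL (V W X : Comodule k D) :
    (tens (tens V W) X).carrier →ₗ[k] V.carrier ⊗[k] (W.carrier ⊗[k] X.carrier) :=
  (TensorProduct.assoc k V.carrier W.carrier X.carrier).toLinearMap ∘ₗ
    (incl V W).rTensor X.carrier ∘ₗ incl (tens V W) X

/-- The map `V ⊗^D (W ⊗^D X) → V ⊗ (W ⊗ X)`. -/
def inclR (V W X : Comodule k D) :
    (tens V (tens W X)).carrier →ₗ[k] V.carrier ⊗[k] (W.carrier ⊗[k] X.carrier) :=
  (incl W X).lTensor V.carrier ∘ₗ incl V (tens W X)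

theorem inclR_injective (V W X : Comodule k D) : Function.Injective (inclR V W X) :=
  (lTensor_injective_of_injective _ _ (incl_injective W X)).comp (incl_injective V (tens W X))

theorem inclL_injective (V W X : Comodule k D) : Function.Injective (inclL V W X) :=
  (TensorProduct.assoc k V.carrier W.carrier X.carrier).injective.comp
    ((rTensor_injective_of_injective _ _ (incl_injective V W)).comp
      (incl_injective (tens V W) X))

/-- The inclusion into the tensor product with coaction on the right factor, as a morphism. -/
def inclHom (V W : Comodule k D) : tens V W ⟶ tensorR V.carrier W :=
  ⟨incl V W, LinearMap.ext fun t => incl_coact V W t⟩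

theorem inclL_coact (V W X : Comodule k D) (t : (tens (tens V W) X).carrier) :
    (inclL V W X).rTensor D ((tens (tens V W) X).coact t) =
      actR V.carrier (actR W.carrier X.coact) (inclL V W X t) := by
  rw [inclL, LinearMap.rTensor_comp, LinearMap.rTensor_comp]
  simp only [LinearMap.comp_apply, LinearEquiv.coe_coe]
  rw [incl_coact, act_assoc₃]
  congr 1
  exact (actR_map (incl V W) (𝟙 X) _).symm

theorem inclL_eq₂ (V W X : Comodule k D) (t : (tens (tens V W) X).carrier) :
    actR V.carrier (actL W.coact X.carrier) (inclL V W X t) =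
      actR V.carrier (actR W.carrier X.coact) (inclL V W X t) := by
  simp only [inclL, LinearMap.comp_apply, LinearEquiv.coe_coe]
  rw [act_assoc₂, act_assoc₃]
  congr 1
  refine (actL_map (inclHom V W) (LinearMap.id) _).trans ?_
  refine Eq.trans ?_ (actR_map (incl V W) (𝟙 X) _).symm
  rw [incl_eq]
  rfl

theorem inclL_eq₁ (V W X : Comodule k D) (t : (tens (tens V W) X).carrier) :
    actL V.coact (W.carrier ⊗[k] X.carrier) (inclL V W X t) =
      actR V.carrier (actR W.carrier X.coact) (inclL V W X t) := by
  rw [← inclL_eq₂]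
  simp only [inclL, LinearMap.comp_apply, LinearEquiv.coe_coe]
  rw [act_assoc₁, act_assoc₂]
  congr 1
  generalize incl (tens V W) X t = s
  induction s using TensorProduct.induction_on with
  | zero => simp
  | add a b ha hb => simp only [map_add, ha, hb]
  | tmul x y => simp only [LinearMap.rTensor_tmul, actL_tmul, incl_eq]

theorem inclL_mem (V W X : Comodule k D) (t : (tens (tens V W) X).carrier) :
    inclL V W X t ∈ LinearMap.range ((incl W X).lTensor V.carrier) :=
  exists_incl V.carrier _ (inclL_eq₂ V W X t)

/-- The map `(V ⊗^D W) ⊗^D X → V ⊗ (W ⊗^D X)` induced by the associativity of `⊗`. -/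
def assocAux (V W X : Comodule k D) :
    (tens (tens V W) X).carrier →ₗ[k] V.carrier ⊗[k] (tens W X).carrier :=
  (LinearEquiv.ofInjective ((incl W X).lTensor V.carrier)
    (lTensor_injective_of_injective _ _ (incl_injective W X))).symm.toLinearMap ∘ₗ
    (inclL V W X).codRestrict _ (inclL_mem V W X)

theorem assocAux_spec (V W X : Comodule k D) (t : (tens (tens V W) X).carrier) :
    (incl W X).lTensor V.carrier (assocAux V W X t) = inclL V W X t := by
  have := LinearEquiv.apply_symm_apply (LinearEquiv.ofInjective ((incl W X).lTensor V.carrier)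
    (lTensor_injective_of_injective _ _ (incl_injective W X)))
    ((inclL V W X).codRestrict _ (inclL_mem V W X) t)
  exact congrArg Subtype.val this

/-- The associativity map `(V ⊗^D W) ⊗^D X → V ⊗^D (W ⊗^D X)`, induced by that of `⊗`. -/
def assocHom (V W X : Comodule k D) : tens (tens V W) X ⟶ tens V (tens W X) :=
  homMk (assocAux V W X)
    (by
      intro t
      apply rTensor_injective_of_injective D _
        (lTensor_injective_of_injective V.carrier _ (incl_injective W X))
      rw [← actL_lTensor, assocAux_spec, inclL_eq₁, ← assocAux_spec]
      exact actR_map LinearMap.id (inclHom W X) _)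
    (by
      intro t
      apply rTensor_injective_of_injective D _
        (lTensor_injective_of_injective V.carrier _ (incl_injective W X))
      rw [← LinearMap.rTensor_comp_apply]
      have h1 : (incl W X).lTensor V.carrier ∘ₗ assocAux V W X = inclL V W X :=
        LinearMap.ext (assocAux_spec V W X)
      rw [h1, inclL_coact, ← assocAux_spec]
      exact actR_map LinearMap.id (inclHom W X) _)

theorem inclR_assocHom (V W X : Comodule k D) (t : (tens (tens V W) X).carrier) :
    inclR V W X ((assocHom V W X).lin t) = inclL V W X t :=
  assocAux_spec V W X t

/-- The symmetry `V ⊗^D W → W ⊗^D V`, the restriction of `x ⊗ y ↦ y ⊗ x`. -/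
def braidHom (V W : Comodule k D) : tens V W ⟶ tens W V :=
  homMk ((TensorProduct.comm k V.carrier W.carrier).toLinearMap ∘ₗ incl V W)
    (by
      intro t
      rw [LinearMap.comp_apply, LinearEquiv.coe_coe, actL_comm, actR_comm, incl_eq])
    (by
      intro t
      rw [LinearMap.comp_apply, LinearEquiv.coe_coe, actR_comm, incl_eq, ← incl_coact,
        LinearMap.rTensor_comp_apply])

theorem incl_braidHom (V W : Comodule k D) (t : (tens V W).carrier) :
    incl W V ((braidHom V W).lin t) = TensorProduct.comm k _ _ (incl V W t) := rfl

/-- The morphism `a ⊗^D b`. -/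
def tensMap {V V' W W' : Comodule k D} (a : V ⟶ V') (b : W ⟶ W') : tens V W ⟶ tens V' W' :=
  cotMap (CoalgHom.id k D) a b

theorem incl_tensMap {V V' W W' : Comodule k D} (a : V ⟶ V') (b : W ⟶ W')
    (t : (tens V W).carrier) :
    incl V' W' ((tensMap a b).lin t) = TensorProduct.map a.lin b.lin (incl V W t) := rfl

theorem tensMap_id (V W : Comodule k D) : tensMap (𝟙 V) (𝟙 W) = 𝟙 (tens V W) := by
  ext x
  apply incl_injective
  rw [incl_tensMap]
  simp

theorem tensMap_comp {V V' V'' W W' W'' : Comodule k D} (a : V ⟶ V') (b : W ⟶ W')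
    (a' : V' ⟶ V'') (b' : W' ⟶ W'') :
    tensMap (a ≫ a') (b ≫ b') = tensMap a b ≫ tensMap a' b' := by
  ext x
  apply incl_injective
  rw [comp_lin, LinearMap.comp_apply, incl_tensMap, incl_tensMap, incl_tensMap,
    TensorProduct.map_map]
  rfl

theorem braid_braid (V W : Comodule k D) : braidHom V W ≫ braidHom W V = 𝟙 (tens V W) := by
  ext x
  apply incl_injective
  rw [comp_lin, LinearMap.comp_apply, incl_braidHom, incl_braidHom]
  simp

/-- The inverse of `assocHom`. -/
def assocInv (V W X : Comodule k D) : tens V (tens W X) ⟶ tens (tens V W) X :=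
  tensMap (𝟙 V) (braidHom W X) ≫ braidHom V (tens X W) ≫ assocHom X W V ≫
    tensMap (𝟙 X) (braidHom W V) ≫ braidHom X (tens V W)

theorem inclL_assocInv (V W X : Comodule k D) (t : (tens V (tens W X)).carrier) :
    inclL V W X ((assocInv V W X).lin t) = inclR V W X t := by
  have h1 : ∀ s : (tens X (tens W V)).carrier, inclL V W X
      ((tensMap (𝟙 X) (braidHom W V) ≫ braidHom X (tens V W)).lin s) =
      TensorProduct.assoc k _ _ _ ((TensorProduct.comm k W.carrier V.carrier).toLinearMap.rTensor
        X.carrier (TensorProduct.comm k _ _ (inclR X W V s))) := by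
    intro s
    simp only [inclL, inclR, comp_lin, LinearMap.comp_apply, LinearEquiv.coe_coe]
    rw [incl_braidHom, incl_tensMap]
    congr 1
    generalize incl X (tens W V) s = r
    induction r using TensorProduct.induction_on with
    | zero => simp
    | add a b ha hb => simp only [map_add, ha, hb]
    | tmul x y => simp [incl_braidHom]
  have h2 : inclL X W V ((tensMap (𝟙 V) (braidHom W X) ≫ braidHom V (tens X W)).lin t) =
      TensorProduct.assoc k _ _ _ ((TensorProduct.comm k W.carrier X.carrier).toLinearMap.rTensor
        V.carrier (TensorProduct.comm k _ _ (inclR V W X t))) := by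
    simp only [inclL, inclR, comp_lin, LinearMap.comp_apply, LinearEquiv.coe_coe]
    rw [incl_braidHom, incl_tensMap]
    congr 1
    generalize incl V (tens W X) t = r
    induction r using TensorProduct.induction_on with
    | zero => simp
    | add a b ha hb => simp only [map_add, ha, hb]
    | tmul x y => simp [incl_braidHom]
  have h3 := h1 ((assocHom X W V).lin
    ((tensMap (𝟙 V) (braidHom W X) ≫ braidHom V (tens X W)).lin t))
  rw [inclR_assocHom, h2] at h3
  refine h3.trans ?_
  generalize inclR V W X t = r
  induction r using TensorProduct.induction_on with
  | zero => simp
  | add a b ha hb => simp only [map_add, ha, hb]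
  | tmul x y =>
    induction y using TensorProduct.induction_on with
    | zero => simp
    | add a b ha hb => simp only [map_add, TensorProduct.tmul_add, ha, hb]
    | tmul y z => simp

/-- The associativity isomorphism. -/
def assocIso (V W X : Comodule k D) : tens (tens V W) X ≅ tens V (tens W X) where
  hom := assocHom V W X
  inv := assocInv V W X
  hom_inv_id := by
    ext t
    apply inclL_injective
    rw [comp_lin, LinearMap.comp_apply, inclL_assocInv, inclR_assocHom]
    rfl
  inv_hom_id := by
    ext t
    apply inclR_injective
    rw [comp_lin, LinearMap.comp_apply, inclR_assocHom, inclL_assocInv]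
    rfl

/-- `V ⊗^D D → V`, `x ⊗ d ↦ ε(d) x`, on underlying spaces. -/
def runitLin (V : Comodule k D) : (tens V (regular k D)).carrier →ₗ[k] V.carrier :=
  (TensorProduct.rid k V.carrier).toLinearMap ∘ₗ
    (counit : D →ₗ[k] k).lTensor V.carrier ∘ₗ incl V (regular k D)

/-- The coaction `V → V ⊗^D D`, the inverse of the right unit isomorphism. -/
def runitInv (V : Comodule k D) : V ⟶ tens V (regular k D) :=
  homMk V.coact
    (by
      intro x
      refine Eq.trans ?_ ((TensorProduct.assoc k V.carrier D D).symm_apply_eq.mpr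
        (coassoc_apply V x).symm).symm
      refine Eq.trans ?_ (coact_cocomm V x)
      rfl)
    (by
      intro x
      exact ((TensorProduct.assoc k V.carrier D D).symm_apply_eq.mpr
        (coassoc_apply V x).symm).symm)

theorem incl_runitInv (V : Comodule k D) (x : V.carrier) :
    incl V (regular k D) ((runitInv V).lin x) = V.coact x := rfl

theorem coact_runitLin (V : Comodule k D) (t : (tens V (regular k D)).carrier) :
    V.coact (runitLin V t) = incl V (regular k D) t := by
  have h := incl_eq V (regular k D) t
  have h1 : ∀ s : V.carrier ⊗[k] D, V.coact (TensorProduct.rid k V.carrier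
      ((counit : D →ₗ[k] k).lTensor V.carrier s)) =
      ((TensorProduct.rid k V.carrier).toLinearMap ∘ₗ
        (counit : D →ₗ[k] k).lTensor V.carrier).rTensor D (actL V.coact D s) := by
    intro s
    induction s using TensorProduct.induction_on with
    | zero => simp
    | add a b ha hb => simp only [map_add, ha, hb]
    | tmul x d =>
      rw [actL_tmul]
      simp only [LinearMap.lTensor_tmul, TensorProduct.rid_tmul, map_smul]
      induction V.coact x using TensorProduct.induction_on with
      | zero => simp
      | add a b ha hb => simp only [map_add, smul_add, ha, hb]
      | tmul x y => simp [TensorProduct.smul_tmul']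
  have h2 : ∀ s : V.carrier ⊗[k] D, ((TensorProduct.rid k V.carrier).toLinearMap ∘ₗ
        (counit : D →ₗ[k] k).lTensor V.carrier).rTensor D
          (actR V.carrier (comul : D →ₗ[k] D ⊗[k] D) s) = s := by
    intro s
    induction s using TensorProduct.induction_on with
    | zero => simp
    | add a b ha hb => simp only [map_add, ha, hb]
    | tmul x d =>
      rw [actR_tmul]
      have h3 : ∀ r : D ⊗[k] D, ((TensorProduct.rid k V.carrier).toLinearMap ∘ₗ
          (counit : D →ₗ[k] k).lTensor V.carrier).rTensor D
          (((TensorProduct.mk k V.carrier D) x).rTensor D r) =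
          x ⊗ₜ TensorProduct.lid k D ((counit : D →ₗ[k] k).rTensor D r) := by
        intro r
        induction r using TensorProduct.induction_on with
        | zero => simp
        | add a b ha hb => simp only [map_add, TensorProduct.tmul_add, ha, hb]
        | tmul a b => simp [TensorProduct.smul_tmul]
      rw [h3]
      simp
  refine (h1 _).trans ?_
  refine (congrArg _ h).trans ?_
  exact h2 _

/-- The right unit isomorphism `V ⊗^D D ≅ V`. -/
def runitIso (V : Comodule k D) : tens V (regular k D) ≅ V :=
  (isoMk (LinearEquiv.ofLinearMap (runitInv V).lin (runitLin V)
    (by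
      apply LinearMap.ext
      intro t
      apply incl_injective
      exact coact_runitLin V t)
    (by
      apply LinearMap.ext
      intro x
      exact counit_coact_apply V x)) (runitInv V).comm).symm

theorem runitIso_hom_lin (V : Comodule k D) : (runitIso V).hom.lin = runitLin V := rfl

/-- The symmetry isomorphism. -/
def braidIso (V W : Comodule k D) : tens V W ≅ tens W V :=
  ⟨braidHom V W, braidHom W V, braid_braid V W, braid_braid W V⟩

/-- The left unit isomorphism `D ⊗^D V ≅ V`. -/
def lunitIso (V : Comodule k D) : tens (regular k D) V ≅ V :=
  braidIso _ _ ≪≫ runitIso V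

instance : MonoidalCategoryStruct (Comodule k D) where
  tensorObj := tens
  tensorUnit := regular k D
  whiskerLeft V _ _ b := tensMap (𝟙 V) b
  whiskerRight a W := tensMap a (𝟙 W)
  tensorHom := tensMap
  associator := assocIso
  leftUnitor := lunitIso
  rightUnitor := runitIso

/-- The underlying vector space. -/
def forgetMod : Comodule k D ⥤ ModuleCat.{u} k where
  obj V := ModuleCat.of k V.carrier
  map f := ModuleCat.ofHom f.lin

instance : (forgetMod (k := k) (D := D)).Faithful where
  map_injective h := hom_ext _ _ (ModuleCat.hom_ext_iff.mp h)

/-- The inclusion `V ⊗^D W → V ⊗ W` in the category of vector spaces. -/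
def ι (V W : Comodule k D) :
    forgetMod.obj (V ⊗ W) ⟶ forgetMod.obj V ⊗ forgetMod.obj W :=
  ModuleCat.ofHom (incl V W)

instance (V W : Comodule k D) : Mono (ι V W) :=
  (ModuleCat.mono_iff_injective _).mpr (incl_injective V W)

instance whiskerLeft_mono (M : ModuleCat.{u} k) {N P : ModuleCat.{u} k} (g : N ⟶ P) [Mono g] :
    Mono (M ◁ g) :=
  (ModuleCat.mono_iff_injective _).mpr
    (lTensor_injective_of_injective M g.hom ((ModuleCat.mono_iff_injective g).mp inferInstance))

instance whiskerRight_mono (M : ModuleCat.{u} k) {N P : ModuleCat.{u} k} (g : N ⟶ P) [Mono g] :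
    Mono (g ▷ M) :=
  (ModuleCat.mono_iff_injective _).mpr
    (rTensor_injective_of_injective M g.hom ((ModuleCat.mono_iff_injective g).mp inferInstance))

theorem map_tensorHom_ι {V V' W W' : Comodule k D} (a : V ⟶ V') (b : W ⟶ W') :
    forgetMod.map (a ⊗ₘ b) ≫ ι V' W' = ι V W ≫ (forgetMod.map a ⊗ₘ forgetMod.map b) := rfl

theorem map_whiskerLeft_ι (V : Comodule k D) {W W' : Comodule k D} (b : W ⟶ W') :
    forgetMod.map (V ◁ b) ≫ ι V W' = ι V W ≫ forgetMod.obj V ◁ forgetMod.map b := rfl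

theorem map_whiskerRight_ι {V V' : Comodule k D} (a : V ⟶ V') (W : Comodule k D) :
    forgetMod.map (a ▷ W) ≫ ι V' W = ι V W ≫ forgetMod.map a ▷ forgetMod.obj W := rfl

theorem map_associator_ι (V W X : Comodule k D) :
    forgetMod.map (α_ V W X).hom ≫ ι V (W ⊗ X) ≫ forgetMod.obj V ◁ ι W X =
      ι (V ⊗ W) X ≫ ι V W ▷ forgetMod.obj X ≫ (α_ _ _ _).hom :=
  ModuleCat.hom_ext (LinearMap.ext fun t => inclR_assocHom V W X t)

theorem map_associator_inv_ι (V W X : Comodule k D) :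
    forgetMod.map (α_ V W X).inv ≫ ι (V ⊗ W) X ≫ ι V W ▷ forgetMod.obj X =
      ι V (W ⊗ X) ≫ forgetMod.obj V ◁ ι W X ≫ (α_ _ _ _).inv := by
  rw [← cancel_epi (forgetMod.map (α_ V W X).hom), reassoc_of% map_associator_ι,
    ← Functor.map_comp_assoc]
  simp

/-- The counit `D → k` in the category of vector spaces. -/
def counitHom : forgetMod.obj (𝟙_ (Comodule k D)) ⟶ 𝟙_ (ModuleCat.{u} k) :=
  ModuleCat.ofHom (counit : D →ₗ[k] k)

theorem map_rightUnitor (V : Comodule k D) :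
    forgetMod.map (ρ_ V).hom = ι V (𝟙_ _) ≫ forgetMod.obj V ◁ counitHom ≫ (ρ_ _).hom := rfl

theorem map_leftUnitor (V : Comodule k D) :
    forgetMod.map (λ_ V).hom = ι (𝟙_ _) V ≫ counitHom ▷ forgetMod.obj V ≫ (λ_ _).hom := by
  apply ModuleCat.hom_ext
  apply LinearMap.ext
  intro t
  have h : ∀ s : D ⊗[k] V.carrier, TensorProduct.rid k V.carrier
      ((counit : D →ₗ[k] k).lTensor V.carrier (TensorProduct.comm k D V.carrier s)) =
      TensorProduct.lid k V.carrier ((counit : D →ₗ[k] k).rTensor V.carrier s) := by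
    intro s
    induction s using TensorProduct.induction_on with
    | zero => simp
    | add a b ha hb => simp only [map_add, ha, hb]
    | tmul x y => simp
  exact h (incl (regular k D) V t)

/-- `(Vec^D, ⊗^D, D)` is a monoidal category. -/
instance : MonoidalCategory (Comodule k D) where
  tensorHom_def a b := by
    change tensMap a b = tensMap a (𝟙 _) ≫ tensMap (𝟙 _) b
    rw [← tensMap_comp]
    simp
  id_tensorHom_id := tensMap_id
  tensorHom_comp_tensorHom a b c d := (tensMap_comp a b c d).symm
  whiskerLeft_id V W := tensMap_id V W
  id_whiskerRight V W := tensMap_id V W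
  associator_naturality {V W X V' W' X'} a b c := by
    apply forgetMod.map_injective
    rw [← cancel_mono (ι V' (W' ⊗ X')), ← cancel_mono (forgetMod.obj V' ◁ ι W' X')]
    simp only [Functor.map_comp, Category.assoc]
    have h1 : (forgetMod.map (a ⊗ₘ b) ⊗ₘ forgetMod.map c) ≫ ι V' W' ▷ forgetMod.obj X' =
        ι V W ▷ forgetMod.obj X ≫ ((forgetMod.map a ⊗ₘ forgetMod.map b) ⊗ₘ forgetMod.map c) := by
      simp only [← MonoidalCategory.tensorHom_id, MonoidalCategory.tensorHom_comp_tensorHom,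
        map_tensorHom_ι, Category.comp_id, Category.id_comp]
    have h2 : (forgetMod.map a ⊗ₘ forgetMod.map (b ⊗ₘ c)) ≫ forgetMod.obj V' ◁ ι W' X' =
        forgetMod.obj V ◁ ι W X ≫ (forgetMod.map a ⊗ₘ (forgetMod.map b ⊗ₘ forgetMod.map c)) := by
      simp only [← MonoidalCategory.id_tensorHom, MonoidalCategory.tensorHom_comp_tensorHom,
        map_tensorHom_ι, Category.comp_id, Category.id_comp]
    rw [map_associator_ι, reassoc_of% map_tensorHom_ι, reassoc_of% map_tensorHom_ι, reassoc_of% h1, h2,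
      MonoidalCategory.associator_naturality, reassoc_of% map_associator_ι]
  leftUnitor_naturality {V W} f := by
    apply forgetMod.map_injective
    simp only [Functor.map_comp, map_leftUnitor, reassoc_of% map_whiskerLeft_ι, Category.assoc]
    rw [whisker_exchange_assoc, leftUnitor_naturality]
  rightUnitor_naturality {V W} f := by
    apply forgetMod.map_injective
    simp only [Functor.map_comp, map_rightUnitor, reassoc_of% map_whiskerRight_ι, Category.assoc]
    rw [← whisker_exchange_assoc, rightUnitor_naturality]
  pentagon V W X Y := by
    apply forgetMod.map_injective
    rw [← cancel_mono (ι V (W ⊗ (X ⊗ Y))), ← cancel_mono (forgetMod.obj V ◁ ι W (X ⊗ Y)),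
      ← cancel_mono (forgetMod.obj V ◁ forgetMod.obj W ◁ ι X Y)]
    simp only [Functor.map_comp, Category.assoc]
    have h1 : forgetMod.obj V ◁ forgetMod.map (α_ W X Y).hom ≫ forgetMod.obj V ◁ ι W (X ⊗ Y) ≫
        forgetMod.obj V ◁ forgetMod.obj W ◁ ι X Y =
        forgetMod.obj V ◁ ι (W ⊗ X) Y ≫ forgetMod.obj V ◁ ι W X ▷ forgetMod.obj Y ≫
          forgetMod.obj V ◁ (α_ _ _ _).hom := by
      simp only [← MonoidalCategory.whiskerLeft_comp, map_associator_ι]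
    have h2 : forgetMod.map (α_ V W X).hom ▷ forgetMod.obj Y ≫ ι V (W ⊗ X) ▷ forgetMod.obj Y ≫
        (forgetMod.obj V ◁ ι W X) ▷ forgetMod.obj Y =
        ι (V ⊗ W) X ▷ forgetMod.obj Y ≫ ι V W ▷ forgetMod.obj X ▷ forgetMod.obj Y ≫
          (α_ _ _ _).hom ▷ forgetMod.obj Y := by
      simp only [← MonoidalCategory.comp_whiskerRight, map_associator_ι]
    rw [reassoc_of% map_whiskerLeft_ι, h1, reassoc_of% map_associator_ι, reassoc_of% map_whiskerRight_ι,
      ← MonoidalCategory.associator_naturality_middle_assoc, reassoc_of% h2,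
      reassoc_of% map_associator_ι, ← MonoidalCategory.associator_naturality_right,
      ← MonoidalCategory.whisker_exchange_assoc, reassoc_of% map_associator_ι,
      ← MonoidalCategory.associator_naturality_left_assoc, MonoidalCategory.pentagon]
  triangle V W := by
    apply forgetMod.map_injective
    rw [← cancel_mono (ι V W)]
    simp only [Functor.map_comp, Category.assoc]
    rw [map_whiskerLeft_ι, map_whiskerRight_ι, map_leftUnitor, map_rightUnitor]
    simp only [MonoidalCategory.whiskerLeft_comp, MonoidalCategory.comp_whiskerRight]
    rw [reassoc_of% map_associator_ι]
    simp

theorem map_braidHom_ι (V W : Comodule k D) :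
    forgetMod.map (braidIso V W).hom ≫ ι W V = ι V W ≫ (β_ _ _).hom := rfl

/-- `(Vec^D, ⊗^D, D)` is a symmetric monoidal category. -/
instance : SymmetricCategory (Comodule k D) where
  braiding := braidIso
  braiding_naturality_right V {W W'} f := by
    apply forgetMod.map_injective
    rw [← cancel_mono (ι W' V)]
    simp only [Functor.map_comp, Category.assoc]
    rw [map_braidHom_ι, reassoc_of% map_whiskerLeft_ι, map_whiskerRight_ι, reassoc_of% map_braidHom_ι,
      BraidedCategory.braiding_naturality_right]
  braiding_naturality_left {V V'} f W := by
    apply forgetMod.map_injective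
    rw [← cancel_mono (ι W V')]
    simp only [Functor.map_comp, Category.assoc]
    rw [map_braidHom_ι, reassoc_of% map_whiskerRight_ι, map_whiskerLeft_ι, reassoc_of% map_braidHom_ι,
      BraidedCategory.braiding_naturality_left]
  hexagon_forward V W X := by
    apply forgetMod.map_injective
    rw [← cancel_mono (ι W (X ⊗ V)), ← cancel_mono (forgetMod.obj W ◁ ι X V)]
    simp only [Functor.map_comp, Category.assoc]
    have h1 : forgetMod.obj W ◁ forgetMod.map (braidIso V X).hom ≫ forgetMod.obj W ◁ ι X V =
        forgetMod.obj W ◁ ι V X ≫ forgetMod.obj W ◁ (β_ _ _).hom := by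
      simp only [← MonoidalCategory.whiskerLeft_comp, map_braidHom_ι]
    have h2 : forgetMod.map (braidIso V W).hom ▷ forgetMod.obj X ≫ ι W V ▷ forgetMod.obj X =
        ι V W ▷ forgetMod.obj X ≫ (β_ _ _).hom ▷ forgetMod.obj X := by
      simp only [← MonoidalCategory.comp_whiskerRight, map_braidHom_ι]
    rw [map_associator_ι, reassoc_of% map_braidHom_ι,
      ← BraidedCategory.braiding_naturality_right_assoc, reassoc_of% map_associator_ι,
      reassoc_of% map_whiskerLeft_ι, h1, reassoc_of% map_associator_ι, reassoc_of% map_whiskerRight_ι,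
      reassoc_of% h2, BraidedCategory.hexagon_forward]
  hexagon_reverse V W X := by
    apply forgetMod.map_injective
    rw [← cancel_mono (ι (X ⊗ V) W), ← cancel_mono (ι X V ▷ forgetMod.obj W)]
    simp only [Functor.map_comp, Category.assoc]
    have h1 : forgetMod.map (braidIso V X).hom ▷ forgetMod.obj W ≫ ι X V ▷ forgetMod.obj W =
        ι V X ▷ forgetMod.obj W ≫ (β_ _ _).hom ▷ forgetMod.obj W := by
      simp only [← MonoidalCategory.comp_whiskerRight, map_braidHom_ι]
    have h2 : forgetMod.obj V ◁ forgetMod.map (braidIso W X).hom ≫ forgetMod.obj V ◁ ι X W =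
        forgetMod.obj V ◁ ι W X ≫ forgetMod.obj V ◁ (β_ _ _).hom := by
      simp only [← MonoidalCategory.whiskerLeft_comp, map_braidHom_ι]
    rw [map_associator_inv_ι, reassoc_of% map_braidHom_ι,
      ← BraidedCategory.braiding_naturality_left_assoc, reassoc_of% map_associator_inv_ι,
      reassoc_of% map_whiskerRight_ι, h1, reassoc_of% map_associator_inv_ι, reassoc_of% map_whiskerLeft_ι,
      reassoc_of% h2, BraidedCategory.hexagon_reverse]
  symmetry V W := braid_braid V W

end Monoidal

end Comodule

end Comodules

section CosemisimpleCoalgebras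

variable {k : Type u} [Field k] {C : Type u} [AddCommGroup C] [Module k C] [Coalgebra k C]

/-- `S` is a subcoalgebra: `Δ(S) ⊆ S ⊗ S`. -/
def IsSubcoalgebra (S : Submodule k C) : Prop :=
  ∀ x ∈ S, (comul x : C ⊗[k] C) ∈ LinearMap.range (TensorProduct.map S.subtype S.subtype)

/-- `S` is a simple subcoalgebra: nonzero, with no subcoalgebras other than `0` and itself. -/
def IsSimpleSubcoalgebra (S : Submodule k C) : Prop :=
  IsSubcoalgebra S ∧ S ≠ ⊥ ∧ ∀ T : Submodule k C, IsSubcoalgebra T → T ≤ S → T = ⊥ ∨ T = S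

variable (k C) in
/-- A coalgebra is cosemisimple if it is a direct sum of simple subcoalgebras. -/
def IsCosemisimple : Prop :=
  ∃ (ι : Type u) (_ : DecidableEq ι) (S : ι → Submodule k C),
    (∀ i, IsSimpleSubcoalgebra (S i)) ∧ DirectSum.IsInternal S

end CosemisimpleCoalgebras

section CoalgebraCategories

variable (k : Type u) [Field k]

/-- The category of cocommutative coalgebras over `k`. -/
abbrev CocommCoalg : Type (u + 1) :=
  ObjectProperty.FullSubcategory (fun D : CoalgCat.{u} k => IsCocomm k D)

instance (D : CocommCoalg k) : IsCocomm k D.obj := D.property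

variable {k}

/-- The coalgebra map underlying a morphism of `CocommCoalg k`. -/
abbrev coalgMap {D E : CocommCoalg k} (f : D ⟶ E) : D.obj →ₗc[k] E.obj := f.hom.toCoalgHom

/-- The category `Vec^D` of `D`-comodules. -/
abbrev VecC (D : CocommCoalg k) : Type (u + 1) := Comodule k D.obj

/-- The functor `U^D : Coalg D ⥤ Vec^D`, taking `φ : E → D` to `E` with the coaction
`(id ⊗ φ) ∘ Δ`. Here `Coalg D` is the slice category `Over D`. -/
def forgetU (D : CocommCoalg k) : Over D ⥤ VecC D where
  obj φ := (Comodule.regular k φ.left.obj).corestrict (coalgMap φ.hom)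
  map {φ ψ} g :=
    { lin := (coalgMap g.left : φ.left.obj →ₗ[k] ψ.left.obj)
      comm := by
        have h : coalgMap φ.hom = (coalgMap ψ.hom).comp (coalgMap g.left) := by
          rw [← Over.w g]; rfl
        have h2 := CoalgHomClass.map_comp_comul (coalgMap g.left)
        change LinearMap.rTensor _ (coalgMap g.left : φ.left.obj →ₗ[k] ψ.left.obj) ∘ₗ
          LinearMap.lTensor _ (coalgMap φ.hom : φ.left.obj →ₗ[k] D.obj) ∘ₗ comul =
          (LinearMap.lTensor _ (coalgMap ψ.hom : ψ.left.obj →ₗ[k] D.obj) ∘ₗ comul) ∘ₗ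
            (coalgMap g.left : φ.left.obj →ₗ[k] ψ.left.obj)
        rw [LinearMap.comp_assoc, ← h2, h, ← LinearMap.comp_assoc, ← LinearMap.comp_assoc,
          LinearMap.rTensor_comp_lTensor, LinearMap.lTensor, ← TensorProduct.map_comp]
        rfl }
  map_id _ := rfl
  map_comp _ _ := rfl

/-- The functor `K_f = f^* : Vec^D ⥤ Vec^E` for `f : E → D`. -/
def pullK {E D : CocommCoalg k} (f : E ⟶ D) : VecC D ⥤ VecC E :=
  Comodule.pullback (coalgMap f)

/-- The powers of a cocommutative coalgebra: `C^{⊗0} = k`, `C^{⊗1} = C` and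
`C^{⊗(n+2)} = C^{⊗(n+1)} ⊗ C`. -/
def tensorPow (C : CocommCoalg k) : ℕ → CocommCoalg k
  | 0 => ⟨CoalgCat.of k k, inferInstanceAs (IsCocomm k k)⟩
  | 1 => C
  | n + 2 => ⟨CoalgCat.of k ((tensorPow C (n + 1)).obj ⊗[k] C.obj),
      inferInstanceAs (IsCocomm k ((tensorPow C (n + 1)).obj ⊗[k] C.obj))⟩

/-- The full subcategory of `CocommCoalg k` on the powers of `C`. -/
abbrev Powers (C : CocommCoalg k) : Type (u + 1) :=
  ObjectProperty.FullSubcategory (fun D : CocommCoalg k => ∃ n, D = tensorPow C n)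

/-- `C` as an object of `Powers C`. -/
def Powers.gen (C : CocommCoalg k) : Powers C := ⟨C, 1, rfl⟩

end CoalgebraCategories

section LNL

variable {𝒞 : Type*} [Category* 𝒞] {ℳ : Type*} [Category* ℳ] [MonoidalCategory ℳ]
  [SymmetricCategory ℳ]

/-- The structure of a linear-non-linear adjunction on a functor `U : 𝒞 ⥤ ℳ` into a symmetric
monoidal category: `𝒞` is cartesian, `ℳ` is closed, and `U` is the left adjoint of a (symmetric)
monoidal adjunction `U ⊣ R`. -/
structure LNLAdjunction (U : 𝒞 ⥤ ℳ) where
  [cartesian : CartesianMonoidalCategory 𝒞]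
  [braided : BraidedCategory 𝒞]
  [closed : MonoidalClosed ℳ]
  [monoidalU : U.Braided]
  R : ℳ ⥤ 𝒞
  [monoidalR : R.LaxBraided]
  adj : U ⊣ R
  unit_monoidal : NatTrans.IsMonoidal adj.unit
  counit_monoidal : NatTrans.IsMonoidal adj.counit

variable {𝒞' : Type*} [Category* 𝒞'] {ℳ' : Type*} [Category* ℳ'] [MonoidalCategory ℳ']
  [SymmetricCategory ℳ']

/-- The canonical comparison `K[X, Y] ⟶ [KX, KY]` of a monoidal functor between closed monoidal
categories, the transpose of `KX ⊗ K[X, Y] ⟶ K(X ⊗ [X, Y]) ⟶ KY`. -/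
def closedComparison [MonoidalClosed ℳ] [MonoidalClosed ℳ'] (K : ℳ ⥤ ℳ') [K.LaxMonoidal]
    (X Y : ℳ) : K.obj ((ihom X).obj Y) ⟶ (ihom (K.obj X)).obj (K.obj Y) :=
  MonoidalClosed.curry (Functor.LaxMonoidal.μ K X ((ihom X).obj Y) ≫ K.map ((ihom.ev X).app Y))

/-- The structure of a morphism of linear-non-linear adjunctions on a pair of functors `(L, K)`.
The equalities `KU = U'L` and `LR = R'K` are, as usual, natural isomorphisms
(the first one monoidal). -/
structure LNLMorphism {U : 𝒞 ⥤ ℳ} {U' : 𝒞' ⥤ ℳ'} (A : LNLAdjunction U) (A' : LNLAdjunction U')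
    (L : 𝒞 ⥤ 𝒞') (K : ℳ ⥤ ℳ') where
  /-- `L` is cartesian. -/
  [preservesL : PreservesFiniteProducts L]
  /-- `K` is strong symmetric monoidal. -/
  [monoidalK : K.Braided]
  /-- `K` is closed. -/
  closedK : letI := A.closed; letI := A'.closed
    ∀ X Y : ℳ, IsIso (closedComparison K X Y)
  isoU : U ⋙ K ≅ L ⋙ U'
  isoU_monoidal :
    letI := A.cartesian; letI := A.braided; letI := A'.cartesian; letI := A'.braided
    letI := A.monoidalU; letI := A'.monoidalU
    letI := Functor.Braided.ofChosenFiniteProducts L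
    NatTrans.IsMonoidal isoU.hom
  isoR : A.R ⋙ L ≅ K ⋙ A'.R
  /-- `L η = η' L`, modulo the isomorphisms above. -/
  unit_comp : ∀ X : 𝒞, L.map (A.adj.unit.app X) ≫ isoR.hom.app (U.obj X) ≫
    A'.R.map (isoU.hom.app X) = A'.adj.unit.app (L.obj X)

end LNL

section Hyperdoctrines

variable {B : Type u} [Category.{v} B]

/-- Coherence isomorphisms making a contravariant assignment `f ↦ K f` of functors to morphisms
into a pseudofunctor (an indexed category). -/
structure PseudofunctorStructure {F : B → Type*} [∀ I, Category* (F I)]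
    (K : ∀ {J I : B}, (J ⟶ I) → (F I ⥤ F J)) where
  mapId (I : B) : K (𝟙 I) ≅ 𝟭 (F I)
  mapComp {H J I : B} (g : H ⟶ J) (f : J ⟶ I) : K (g ≫ f) ≅ K f ⋙ K g
  assoc {G H J I : B} (h : G ⟶ H) (g : H ⟶ J) (f : J ⟶ I) (X : F I) :
    (mapComp (h ≫ g) f).hom.app X ≫ (mapComp h g).hom.app ((K f).obj X) =
      eqToHom (by rw [Category.assoc]) ≫ (mapComp h (g ≫ f)).hom.app X ≫
        (K h).map ((mapComp g f).hom.app X)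
  id_left {J I : B} (f : J ⟶ I) (X : F I) :
    (mapComp (𝟙 J) f).hom.app X ≫ (mapId J).hom.app ((K f).obj X) =
      eqToHom (by rw [Category.id_comp]; rfl)
  id_right {J I : B} (f : J ⟶ I) (X : F I) :
    (mapComp f (𝟙 I)).hom.app X ≫ (K f).map ((mapId I).hom.app X) =
      eqToHom (by rw [Category.comp_id]; rfl)

variable (B) in
/-- The functors underlying a `B`-indexed family of linear-non-linear adjunctions:
`U I : Φ₁ I ⥤ Φ₂ I` for each object `I`, and `L f : Φ₁ I ⥤ Φ₁ J`, `K f : Φ₂ I ⥤ Φ₂ J` for each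
morphism `f : J ⟶ I`. -/
structure LNLDiagram where
  Φ₁ : B → Type w
  [cat₁ : ∀ I, Category.{v} (Φ₁ I)]
  Φ₂ : B → Type w
  [cat₂ : ∀ I, Category.{v} (Φ₂ I)]
  [monoidal : ∀ I, MonoidalCategory (Φ₂ I)]
  [symmetric : ∀ I, SymmetricCategory (Φ₂ I)]
  U : ∀ I, Φ₁ I ⥤ Φ₂ I
  L : ∀ {J I : B}, (J ⟶ I) → (Φ₁ I ⥤ Φ₁ J)
  K : ∀ {J I : B}, (J ⟶ I) → (Φ₂ I ⥤ Φ₂ J)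

attribute [instance] LNLDiagram.cat₁ LNLDiagram.cat₂ LNLDiagram.monoidal LNLDiagram.symmetric

/-- The structure of a (pseudo)functor `Bᵒᵖ ⥤ LNL` with underlying functors `Φ`: linear-non-linear
adjunctions on all `U I`, morphisms of these on all `(L f, K f)`, and coherent isomorphisms
`Φ(𝟙) ≅ 𝟙`, `Φ(g ≫ f) ≅ Φ(g) ∘ Φ(f)` compatible with the tensor products and with `U`. -/
structure LNLFunctor (Φ : LNLDiagram.{u, v, w} B) where
  lnl (I : B) : LNLAdjunction (Φ.U I)
  mor {J I : B} (f : J ⟶ I) : LNLMorphism (lnl I) (lnl J) (Φ.L f) (Φ.K f)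
  psL : PseudofunctorStructure Φ.L
  psK : PseudofunctorStructure Φ.K
  mapId_monoidal (I : B) :
    letI := (mor (𝟙 I)).monoidalK
    NatTrans.IsMonoidal (psK.mapId I).hom
  mapComp_monoidal {H J I : B} (g : H ⟶ J) (f : J ⟶ I) :
    letI := (mor (g ≫ f)).monoidalK; letI := (mor f).monoidalK; letI := (mor g).monoidalK
    NatTrans.IsMonoidal (psK.mapComp g f).hom
  mapId_U (I : B) (X : Φ.Φ₁ I) :
    (mor (𝟙 I)).isoU.hom.app X ≫ (Φ.U I).map ((psL.mapId I).hom.app X) =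
      (psK.mapId I).hom.app ((Φ.U I).obj X)
  mapComp_U {H J I : B} (g : H ⟶ J) (f : J ⟶ I) (X : Φ.Φ₁ I) :
    (mor (g ≫ f)).isoU.hom.app X ≫ (Φ.U H).map ((psL.mapComp g f).hom.app X) =
      (psK.mapComp g f).hom.app ((Φ.U I).obj X) ≫ (Φ.K g).map ((mor f).isoU.hom.app X) ≫
        (mor g).isoU.hom.app ((Φ.L f).obj X)

/-- For a commutative square `f' ≫ q = p ≫ f` in `B`, the canonical isomorphism
`p^* f^* ≅ f'^* q^*`. -/
def PseudofunctorStructure.squareIso {F : B → Type*} [∀ I, Category* (F I)]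
    {K : ∀ {J I : B}, (J ⟶ I) → (F I ⥤ F J)} (ps : PseudofunctorStructure K)
    {I J I' J' : B} (p : J' ⟶ J) (f : J ⟶ I) (f' : J' ⟶ I') (q : I' ⟶ I)
    (w : f' ≫ q = p ≫ f) : K f ⋙ K p ≅ K q ⋙ K f' :=
  (ps.mapComp p f).symm ≪≫ eqToIso (by rw [w]) ≪≫ ps.mapComp f' q

/-- Quantification along a family of projections `π I : P I ⟶ I` (with `P` acting on morphisms
compatibly with `π`): adjoints `∃_I ⊣ (π I)^* ⊣ ∀_I`, where `∀` satisfies the Beck-Chevalley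
condition, i.e. the canonical transformation `f^* ∀_I ⟶ ∀_J (P f)^*` is invertible. -/
structure Quantifiers {F : B → Type*} [∀ I, Category* (F I)]
    {K : ∀ {J I : B}, (J ⟶ I) → (F I ⥤ F J)} (ps : PseudofunctorStructure K)
    (P : B → B) (Pmap : ∀ {J I : B}, (J ⟶ I) → (P J ⟶ P I)) (π : ∀ I, P I ⟶ I)
    (w : ∀ {J I : B} (f : J ⟶ I), Pmap f ≫ π I = π J ≫ f) where
  ex (I : B) : F (P I) ⥤ F I
  exAdj (I : B) : ex I ⊣ K (π I)
  all (I : B) : F (P I) ⥤ F I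
  allAdj (I : B) : K (π I) ⊣ all I
  beckChevalley {J I : B} (f : J ⟶ I) :
    IsIso (mateEquiv (allAdj I) (allAdj J)
      (TwoSquare.mk (K f) (K (π I)) (K (π J)) (K (Pmap f))
        (ps.squareIso (π J) f (Pmap f) (π I) (w f)).hom)).natTrans

/-- The structure of a linear hyperdoctrine on `Φ` over the category `B` with generating
object `C`: `B` is cartesian, every object of `B` is a finite power of `C`, `Φ` is a functor
`Bᵒᵖ ⥤ LNL`, and there are quantifiers along the projections `I × C ⟶ I` and `C × I ⟶ I`. -/
structure LinearHyperdoctrine (Φ : LNLDiagram.{u, v, w} B) (C : B) extends LNLFunctor Φ where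
  [hasFiniteProducts : HasFiniteProducts B]
  generated (I : B) : ∃ n : ℕ, Nonempty (I ≅ ∏ᶜ fun _ : Fin n => C)
  quantFst : Quantifiers psK (fun I => I ⨯ C) (fun f => prod.map f (𝟙 C)) (fun _ => prod.fst)
    (fun f => prod.map_fst f (𝟙 C))
  quantSnd : Quantifiers psK (fun I => C ⨯ I) (fun f => prod.map (𝟙 C) f) (fun _ => prod.snd)
    (fun f => prod.map_snd (𝟙 C) f)

end Hyperdoctrines

/-- The assignment `D ↦ (U^D : Coalg D ⥤ Vec^D)`, `f ↦ (L_f, K_f)` on the powers of `C`, where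
`L_f` is pullback along `f` in the category of cocommutative coalgebras and `K_f = f^*`. -/
def coalgDiagram {k : Type u} [Field k] [HasPullbacks (CocommCoalg k)] (C : CocommCoalg k) :
    LNLDiagram.{u + 1, u, u + 1} (Powers C) where
  Φ₁ D := Over D.obj
  Φ₂ D := VecC D.obj
  U D := forgetU D.obj
  L f := Over.pullback f.hom
  K f := pullK f.hom

end LNLHyp

end

open LNLHyp CategoryTheory CategoryTheory.Limits

/-! Everything rests on the linear algebra of cotensor products over a field, where tensoring is
exact, and on two formal devices: the adjoint triangle theorem, which produces right adjoints, and
the calculus of mates, which makes them compatible.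

Coalgebras. Among cocommutative coalgebras `⊗` is the product and `k` is terminal. Two maps are
equalized by the subspace on which the coactions `(id ⊗ a) Δ` and `(id ⊗ b) Δ` agree. So the fibre
product of `X` and `E` over `D` is the cotensor product of `X` and `E`. This gives pullbacks, makes
`U^D` strong monoidal (`isIso_pairU`) and identifies `K_f U^D` with `U^E L_f` (`isIso_of_evalK_eq`).

Cosemisimplicity. A `D`-comodule is in particular a module over the free algebra on the functionals
of `D`, and for cocommutative `D` the stable subspaces of `D` are its subcoalgebras. If `D` is
cosemisimple, then `D`, the cofree comodules `M ⊗ D`, and hence all comodules are semisimple, so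
every injective morphism of comodules splits (`Comodule.exists_retraction`).

Right adjoints. A functor into `Vec^D` is a left adjoint as soon as its composite with the forgetful
functor to vector spaces is one, because the coaction `V → V ⊗ D` splits
(`isLeftAdjoint_of_comp_forgetMod`). For the tensor product with `V`, a retraction of the coaction
of `V` exhibits the composite as a retract of the ordinary tensor product
(`tensorLeft_isLeftAdjoint`); this is closedness. For `U^D` the composite is the underlying space of
a coalgebra over `D`, so cofree cocommutative coalgebras are needed (`forgetU_isLeftAdjoint`); they
come from the finite dual of a polynomial algebra, again by an adjoint triangle.

Base change. `K_f = f^*` is right adjoint to corestriction `f_!`, which is oplax monoidal, and the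
projection formula `f_!(X ⊗ f^* V) ≅ f_! X ⊗ V` holds (`projLin_injective`, `projLin_surjective`).
From it follow formally that `f^*` is strong monoidal (`isIso_μ_of_projHom`), that it is closed
(`isIso_closedComparison`), and, with closedness of `Vec^D`, that it has a right adjoint
(`pullK_isLeftAdjoint`). Thus `∃ = f_!` and `∀` exist. The evident isomorphism `f_! U^E ≅ U^D f_!`
has as its mates both `K_f U^D ≅ U^E L_f` and `L_f R^D ≅ R^E K_f`, which forces compatibility with
the units (`map_unit_conjugateEquiv`). Coherence of `f ↦ f^*` is inherited from that of `f ↦ f_!`.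

Beck–Chevalley. The condition for `∀` is equivalent, by taking mates on both sides of a square, to
invertibility of `f'_! p^* Y ⟶ q^* f_! Y`, and that follows for pullback squares from the projection
formula (`isIso_of_evalK_eq_evalK`).

Perfect fields. A simple cocommutative coalgebra is finite-dimensional, and the operators on it
generate a finite field extension. Over a perfect field the tensor product of two such extensions is
reduced and Artinian, so tensor powers stay cosemisimple (`IsCosemisimple.tensorProduct`). -/

noncomputable section

open CategoryTheory CategoryTheory.Limits MonoidalCategory TensorProduct Coalgebra

namespace LNLHyp

set_option linter.unusedSectionVars false

/-! ### Detecting elements of a tensor product by functionals on one factor. -/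

section Separation

variable {k : Type u} [Field k] {M N : Type u} [AddCommGroup M] [Module k M]
  [AddCommGroup N] [Module k N]

/-- Expand `t` along a basis of `M`: each coordinate lies in `N` and is killed by all `φ i`. An
arbitrary separating family is allowed because evaluations on a finite dual and products of
functionals occur later, not only the full dual. -/
theorem eq_zero_of_forall_lTensor {ι : Type*} (φ : ι → N →ₗ[k] k)
    (hφ : ∀ y, (∀ i, φ i y = 0) → y = 0) (t : M ⊗[k] N)
    (h : ∀ i, (φ i).lTensor M t = 0) : t = 0 := by
  classical
  let b := Module.Basis.ofVectorSpace k M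
  apply (TensorProduct.equivFinsuppOfBasisLeft b).injective
  rw [map_zero]
  ext j
  apply hφ
  intro i
  rw [TensorProduct.equivFinsuppOfBasisLeft_apply]
  have h1 : ∀ s : M ⊗[k] N, φ i (TensorProduct.lid k N ((b.coord j).rTensor N s)) =
      TensorProduct.lid k k ((b.coord j).rTensor k ((φ i).lTensor M s)) := by
    intro s
    induction s using TensorProduct.induction_on with
    | zero => simp
    | add a b ha hb => simp only [map_add, ha, hb]
    | tmul x y => simp
  rw [h1, h i]
  simp

theorem eq_of_forall_lTensor {t s : M ⊗[k] N}
    (h : ∀ φ : N →ₗ[k] k, φ.lTensor M t = φ.lTensor M s) : t = s := by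
  rw [← sub_eq_zero]
  refine eq_zero_of_forall_lTensor (fun φ : N →ₗ[k] k => φ) (fun y hy => ?_) _ (fun φ => ?_)
  · exact (Module.forall_dual_apply_eq_zero_iff k y).mp hy
  · rw [map_sub, h, sub_self]

end Separation

/-! ### Products of cocommutative coalgebras. -/

section Products

variable {k : Type u} [Field k]

section Unbundled

variable {E F D Z : Type u} [AddCommGroup E] [Module k E] [Coalgebra k E]
  [AddCommGroup F] [Module k F] [Coalgebra k F] [AddCommGroup D] [Module k D] [Coalgebra k D]
  [AddCommGroup Z] [Module k Z] [Coalgebra k Z]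

variable (k E F) in
/-- The projection `x ⊗ y ↦ ε(y) x` of the product of coalgebras. -/
def projFst : E ⊗[k] F →ₗc[k] E :=
  (Coalgebra.TensorProduct.rid k k E : E ⊗[k] k →ₗc[k] E).comp
    (Coalgebra.TensorProduct.map (CoalgHom.id k E) (counitCoalgHom k F))

variable (k E F) in
/-- The projection `x ⊗ y ↦ ε(x) y` of the product of coalgebras. -/
def projSnd : E ⊗[k] F →ₗc[k] F :=
  (Coalgebra.TensorProduct.lid k F : k ⊗[k] F →ₗc[k] F).comp
    (Coalgebra.TensorProduct.map (counitCoalgHom k E) (CoalgHom.id k F))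

@[simp] theorem projFst_tmul (x : E) (y : F) :
    projFst k E F (x ⊗ₜ y) = (counit y : k) • x := rfl

@[simp] theorem projSnd_tmul (x : E) (y : F) :
    projSnd k E F (x ⊗ₜ y) = (counit x : k) • y := rfl

/-- The map `Z → E ⊗ F` with components `a` and `b`. -/
def prodLift [IsCocomm k Z] (a : Z →ₗc[k] E) (b : Z →ₗc[k] F) : Z →ₗc[k] E ⊗[k] F :=
  (Coalgebra.TensorProduct.map a b).comp (comulCoalgHom k Z)

theorem prodLift_apply [IsCocomm k Z] (a : Z →ₗc[k] E) (b : Z →ₗc[k] F) (z : Z) :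
    prodLift a b z = TensorProduct.map (a : Z →ₗ[k] E) (b : Z →ₗ[k] F) (comul z) := rfl

theorem projFst_prodLift [IsCocomm k Z] (a : Z →ₗc[k] E) (b : Z →ₗc[k] F) :
    (projFst k E F).comp (prodLift a b) = a := by
  ext z
  have h : ∀ t : Z ⊗[k] Z, projFst k E F (TensorProduct.map (a : Z →ₗ[k] E) (b : Z →ₗ[k] F) t) =
      a (TensorProduct.rid k Z ((counit : Z →ₗ[k] k).lTensor Z t)) := by
    intro t
    induction t using TensorProduct.induction_on with
    | zero => simp
    | add a b ha hb => simp only [map_add, ha, hb]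
    | tmul x y => simp
  refine (h (comul z)).trans ?_
  simp

theorem projSnd_prodLift [IsCocomm k Z] (a : Z →ₗc[k] E) (b : Z →ₗc[k] F) :
    (projSnd k E F).comp (prodLift a b) = b := by
  ext z
  have h : ∀ t : Z ⊗[k] Z, projSnd k E F (TensorProduct.map (a : Z →ₗ[k] E) (b : Z →ₗ[k] F) t) =
      b (TensorProduct.lid k Z ((counit : Z →ₗ[k] k).rTensor Z t)) := by
    intro t
    induction t using TensorProduct.induction_on with
    | zero => simp
    | add a b ha hb => simp only [map_add, ha, hb]
    | tmul x y => simp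
  refine (h (comul z)).trans ?_
  simp

/-- The projection applies the counit to one copy of the `F`-leg, so only the comultiplication of
`E` survives. This and its analogue for `projSnd` turn the equalizer condition on `E ⊗ F` into the
cotensor condition. -/
theorem lTensor_projFst_comul (t : E ⊗[k] F) :
    ((projFst k E F : E ⊗[k] F →ₗc[k] E) : E ⊗[k] F →ₗ[k] E).lTensor (E ⊗[k] F) (comul t) =
      actL comul F t := by
  induction t using TensorProduct.induction_on with
  | zero => simp
  | add a b ha hb => simp only [map_add, ha, hb]
  | tmul x y =>
    have h : ∀ (s : E ⊗[k] E) (r : F ⊗[k] F),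
        ((projFst k E F : E ⊗[k] F →ₗc[k] E) : E ⊗[k] F →ₗ[k] E).lTensor (E ⊗[k] F)
          (TensorProduct.AlgebraTensorModule.tensorTensorTensorComm k k k k E E F F (s ⊗ₜ r)) =
        ((TensorProduct.mk k E F).flip (TensorProduct.rid k F
          ((counit : F →ₗ[k] k).lTensor F r))).rTensor E s := by
      intro s r
      induction s using TensorProduct.induction_on with
      | zero => simp
      | add a b ha hb => simp only [map_add, TensorProduct.add_tmul, ha, hb]
      | tmul x x' =>
        induction r using TensorProduct.induction_on with
        | zero => simp
        | add a b ha hb => simp only [map_add, TensorProduct.tmul_add, ha, hb,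
            LinearMap.rTensor_add, LinearMap.add_apply]
        | tmul y y' => simp [TensorProduct.smul_tmul']
    rw [TensorProduct.comul_tmul, h, actL_tmul]
    simp

theorem lTensor_projSnd_comul (t : E ⊗[k] F) :
    ((projSnd k E F : E ⊗[k] F →ₗc[k] F) : E ⊗[k] F →ₗ[k] F).lTensor (E ⊗[k] F) (comul t) =
      actR E comul t := by
  induction t using TensorProduct.induction_on with
  | zero => simp
  | add a b ha hb => simp only [map_add, ha, hb]
  | tmul x y =>
    have h : ∀ (s : E ⊗[k] E) (r : F ⊗[k] F),
        ((projSnd k E F : E ⊗[k] F →ₗc[k] F) : E ⊗[k] F →ₗ[k] F).lTensor (E ⊗[k] F)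
          (TensorProduct.AlgebraTensorModule.tensorTensorTensorComm k k k k E E F F (s ⊗ₜ r)) =
        ((TensorProduct.mk k E F) (TensorProduct.rid k E
          ((counit : E →ₗ[k] k).lTensor E s))).rTensor F r := by
      intro s r
      induction r using TensorProduct.induction_on with
      | zero => simp
      | add a b ha hb => simp only [map_add, TensorProduct.tmul_add, ha, hb]
      | tmul y y' =>
        induction s using TensorProduct.induction_on with
        | zero => simp
        | add a b ha hb => simp only [map_add, TensorProduct.add_tmul, ha, hb,
            LinearMap.rTensor_add, LinearMap.add_apply]
        | tmul x x' => simp [TensorProduct.smul_tmul']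
    rw [TensorProduct.comul_tmul, h, actR_tmul]
    simp

/-- A tensor is recovered from its coproduct by the two projections; this is uniqueness in the
universal property of the product. -/
theorem map_proj_comul (t : E ⊗[k] F) :
    TensorProduct.map ((projFst k E F : E ⊗[k] F →ₗc[k] E) : E ⊗[k] F →ₗ[k] E)
      ((projSnd k E F : E ⊗[k] F →ₗc[k] F) : E ⊗[k] F →ₗ[k] F) (comul t) = t := by
  rw [← LinearMap.rTensor_comp_lTensor, LinearMap.comp_apply, lTensor_projSnd_comul]
  induction t using TensorProduct.induction_on with
  | zero => simp
  | add a b ha hb => simp only [map_add, ha, hb]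
  | tmul x y =>
    rw [actR_tmul]
    have h : ∀ r : F ⊗[k] F, ((projFst k E F : E ⊗[k] F →ₗc[k] E) : E ⊗[k] F →ₗ[k] E).rTensor F
        (((TensorProduct.mk k E F) x).rTensor F r) =
        x ⊗ₜ TensorProduct.lid k F ((counit : F →ₗ[k] k).rTensor F r) := by
      intro r
      induction r using TensorProduct.induction_on with
      | zero => simp
      | add a b ha hb => simp only [map_add, TensorProduct.tmul_add, ha, hb]
      | tmul y y' => simp [TensorProduct.smul_tmul]
    rw [h]
    simp

theorem prodLift_unique [IsCocomm k Z] (h : Z →ₗc[k] E ⊗[k] F) :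
    prodLift ((projFst k E F).comp h) ((projSnd k E F).comp h) = h := by
  ext z
  rw [prodLift_apply, CoalgHom.comp_toLinearMap, CoalgHom.comp_toLinearMap, TensorProduct.map_comp,
    LinearMap.comp_apply]
  have := CoalgHomClass.map_comp_comul_apply h z
  rw [this]
  exact map_proj_comul _

end Unbundled

/-! ### Equalizers of maps of cocommutative coalgebras. -/

section Equalizers

variable {T D : Type u} [AddCommGroup T] [Module k T] [Coalgebra k T] [IsCocomm k T]
  [AddCommGroup D] [Module k D] [Coalgebra k D]

/-- The coaction `(id ⊗ a) ∘ Δ` on `T` of a coalgebra map `a : T → D`. -/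
def coactAlong (a : T →ₗc[k] D) : T →ₗ[k] T ⊗[k] D := (a : T →ₗ[k] D).lTensor T ∘ₗ comul

theorem coactAlong_apply (a : T →ₗc[k] D) (t : T) :
    coactAlong a t = (a : T →ₗ[k] D).lTensor T (comul t) := rfl

/-- Cocommutativity lets the coaction be applied before the comultiplication. The right-hand side
depends on `a` only through `coactAlong a t`, so the comultiplication sends the locus where two
coactions agree into its tensor product with `T`. -/
theorem rTensor_coactAlong_comul (a : T →ₗc[k] D) (t : T) :
    (coactAlong a).rTensor T (comul t) =
      TensorProduct.rightComm k T T D ((comul : T →ₗ[k] T ⊗[k] T).rTensor D (coactAlong a t)) := by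
  have h1 := Comodule.coact_cocomm (Comodule.regular k T) t
  have h2 : ∀ s : (T ⊗[k] T) ⊗[k] T, ((a : T →ₗ[k] D).lTensor T).rTensor T
      (TensorProduct.rightComm k T T T s) =
      TensorProduct.rightComm k T T D ((a : T →ₗ[k] D).lTensor (T ⊗[k] T) s) := by
    intro s
    induction s using TensorProduct.induction_on with
    | zero => simp
    | add a b ha hb => simp only [map_add, ha, hb]
    | tmul x y =>
      induction x using TensorProduct.induction_on with
      | zero => simp
      | add a b ha hb => simp only [map_add, TensorProduct.add_tmul, ha, hb]
      | tmul x x' => simp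
  rw [coactAlong_apply, rTensor_lTensor, ← h2]
  refine Eq.trans ?_ (congrArg _ h1.symm)
  rw [coactAlong, LinearMap.rTensor_comp, LinearMap.comp_apply]
  rfl

/-- The same principle for the other leg, where coassociativity alone suffices. -/
theorem lTensor_coactAlong_comul (a : T →ₗc[k] D) (t : T) :
    (coactAlong a).lTensor T (comul t) =
      TensorProduct.assoc k T T D ((comul : T →ₗ[k] T ⊗[k] T).rTensor D (coactAlong a t)) := by
  have h2 : ∀ s : (T ⊗[k] T) ⊗[k] T, ((a : T →ₗ[k] D).lTensor T).lTensor T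
      (TensorProduct.assoc k T T T s) =
      TensorProduct.assoc k T T D ((a : T →ₗ[k] D).lTensor (T ⊗[k] T) s) := by
    intro s
    induction s using TensorProduct.induction_on with
    | zero => simp
    | add a b ha hb => simp only [map_add, ha, hb]
    | tmul x y =>
      induction x using TensorProduct.induction_on with
      | zero => simp
      | add a b ha hb => simp only [map_add, TensorProduct.add_tmul, ha, hb]
      | tmul x x' => simp
  rw [coactAlong_apply, rTensor_lTensor, ← h2, Coalgebra.coassoc_apply, coactAlong,
    LinearMap.lTensor_comp, LinearMap.comp_apply]

/-- The equalizer of two maps of cocommutative coalgebras. -/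
def EqCoalg (a b : T →ₗc[k] D) : Type u := LinearMap.eqLocus (coactAlong a) (coactAlong b)

namespace EqCoalg

variable (a b : T →ₗc[k] D)

instance : AddCommGroup (EqCoalg a b) :=
  inferInstanceAs (AddCommGroup (LinearMap.eqLocus (coactAlong a) (coactAlong b)))

instance : Module k (EqCoalg a b) :=
  inferInstanceAs (Module k (LinearMap.eqLocus (coactAlong a) (coactAlong b)))

/-- The inclusion of the equalizer. -/
def incl : EqCoalg a b →ₗ[k] T := (LinearMap.eqLocus (coactAlong a) (coactAlong b)).subtype

theorem incl_injective : Function.Injective (incl a b) := Submodule.subtype_injective _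

theorem coactAlong_incl (s : EqCoalg a b) :
    coactAlong a (incl a b s) = coactAlong b (incl a b s) := s.2

/-- The comultiplication, with values in `S ⊗ T`. -/
def coact : EqCoalg a b →ₗ[k] EqCoalg a b ⊗[k] T :=
  liftEq (coactAlong a) (coactAlong b) (comul ∘ₗ incl a b) (by
    ext s
    simp only [LinearMap.comp_apply, rTensor_coactAlong_comul]
    exact congrArg (fun x => TensorProduct.rightComm k T T D
      ((comul : T →ₗ[k] T ⊗[k] T).rTensor D x)) (coactAlong_incl a b s))

theorem incl_coact (s : EqCoalg a b) : (incl a b).rTensor T (coact a b s) = comul (incl a b s) :=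
  liftEq_spec _ _ _ _ s

theorem coact_mem (s : EqCoalg a b) :
    coact a b s ∈ LinearMap.range ((incl a b).lTensor (EqCoalg a b)) := by
  refine mem_range_lTensor _ _ _ _ ?_
  apply rTensor_injective_of_injective _ _ (incl_injective a b)
  rw [rTensor_lTensor, rTensor_lTensor, incl_coact, lTensor_coactAlong_comul,
    lTensor_coactAlong_comul, coactAlong_incl]

instance : CoalgebraStruct k (EqCoalg a b) where
  comul := (LinearEquiv.ofInjective ((incl a b).lTensor (EqCoalg a b))
    (lTensor_injective_of_injective _ _ (incl_injective a b))).symm.toLinearMap ∘ₗ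
    (coact a b).codRestrict _ (coact_mem a b)
  counit := counit ∘ₗ incl a b

theorem lTensor_incl_comul (s : EqCoalg a b) :
    (incl a b).lTensor (EqCoalg a b) (comul s) = coact a b s :=
  congrArg Subtype.val (LinearEquiv.apply_symm_apply (LinearEquiv.ofInjective
    ((incl a b).lTensor (EqCoalg a b)) (lTensor_injective_of_injective _ _ (incl_injective a b)))
    ((coact a b).codRestrict _ (coact_mem a b) s))

theorem map_incl_comul (s : EqCoalg a b) :
    TensorProduct.map (incl a b) (incl a b) (comul s) = comul (incl a b s) := by
  rw [← LinearMap.rTensor_comp_lTensor, LinearMap.comp_apply, lTensor_incl_comul, incl_coact]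

theorem counit_eq (s : EqCoalg a b) : (counit s : k) = counit (incl a b s) := rfl

theorem map_injective {M N M' N' : Type u} [AddCommGroup M] [Module k M] [AddCommGroup N]
    [Module k N] [AddCommGroup M'] [Module k M'] [AddCommGroup N'] [Module k N']
    (g : M →ₗ[k] M') (h : N →ₗ[k] N') (hg : Function.Injective g) (hh : Function.Injective h) :
    Function.Injective (TensorProduct.map g h) := by
  rw [← LinearMap.rTensor_comp_lTensor]
  exact (rTensor_injective_of_injective _ _ hg).comp (lTensor_injective_of_injective _ _ hh)

instance : Coalgebra k (EqCoalg a b) where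
  coassoc := by
    ext s
    apply map_injective _ _ (incl_injective a b)
      (map_injective _ _ (incl_injective a b) (incl_injective a b))
    have h1 : ∀ t : EqCoalg a b ⊗[k] EqCoalg a b,
        TensorProduct.map (incl a b) (TensorProduct.map (incl a b) (incl a b))
          (TensorProduct.assoc k _ _ _ ((comul : EqCoalg a b →ₗ[k] _).rTensor _ t)) =
        TensorProduct.assoc k _ _ _ ((comul : T →ₗ[k] _).rTensor _
          (TensorProduct.map (incl a b) (incl a b) t)) := by
      intro t
      induction t using TensorProduct.induction_on with
      | zero => simp
      | add a b ha hb => simp only [map_add, ha, hb]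
      | tmul x y =>
        simp only [LinearMap.rTensor_tmul, TensorProduct.map_tmul, ← map_incl_comul]
        induction (comul x : EqCoalg a b ⊗[k] EqCoalg a b) using TensorProduct.induction_on with
        | zero => simp
        | add a b ha hb => simp only [map_add, TensorProduct.add_tmul, ha, hb]
        | tmul x x' => simp
    have h2 : ∀ t : EqCoalg a b ⊗[k] EqCoalg a b,
        TensorProduct.map (incl a b) (TensorProduct.map (incl a b) (incl a b))
          ((comul : EqCoalg a b →ₗ[k] _).lTensor _ t) =
        (comul : T →ₗ[k] _).lTensor _ (TensorProduct.map (incl a b) (incl a b) t) := by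
      intro t
      induction t using TensorProduct.induction_on with
      | zero => simp
      | add a b ha hb => simp only [map_add, ha, hb]
      | tmul x y => simp [map_incl_comul]
    simp only [LinearMap.comp_apply, LinearEquiv.coe_coe]
    rw [h1, h2, map_incl_comul, Coalgebra.coassoc_apply]
  rTensor_counit_comp_comul := by
    ext s
    apply lTensor_injective_of_injective _ _ (incl_injective a b)
    have h : ∀ t : EqCoalg a b ⊗[k] EqCoalg a b,
        (incl a b).lTensor k ((counit : EqCoalg a b →ₗ[k] k).rTensor _ t) =
        (counit : T →ₗ[k] k).rTensor _ (TensorProduct.map (incl a b) (incl a b) t) := by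
      intro t
      induction t using TensorProduct.induction_on with
      | zero => simp
      | add a b ha hb => simp only [map_add, ha, hb]
      | tmul x y => simp [counit_eq]
    simp only [LinearMap.comp_apply, TensorProduct.mk_apply, LinearMap.lTensor_tmul]
    rw [h, map_incl_comul, Coalgebra.rTensor_counit_comul]
  lTensor_counit_comp_comul := by
    ext s
    apply rTensor_injective_of_injective _ _ (incl_injective a b)
    have h : ∀ t : EqCoalg a b ⊗[k] EqCoalg a b,
        (incl a b).rTensor k ((counit : EqCoalg a b →ₗ[k] k).lTensor _ t) =
        (counit : T →ₗ[k] k).lTensor _ (TensorProduct.map (incl a b) (incl a b) t) := by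
      intro t
      induction t using TensorProduct.induction_on with
      | zero => simp
      | add a b ha hb => simp only [map_add, ha, hb]
      | tmul x y => simp [counit_eq]
    simp only [LinearMap.comp_apply, TensorProduct.mk_apply, LinearMap.flip_apply,
      LinearMap.rTensor_tmul]
    rw [h, map_incl_comul, Coalgebra.lTensor_counit_comul]

instance : IsCocomm k (EqCoalg a b) where
  comm_comp_comul := by
    ext s
    apply map_injective _ _ (incl_injective a b) (incl_injective a b)
    simp only [LinearMap.comp_apply, LinearEquiv.coe_coe]
    rw [TensorProduct.map_comm, map_incl_comul, Coalgebra.comm_comul]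

/-- The inclusion of the equalizer, as a map of coalgebras. -/
def inclHom : EqCoalg a b →ₗc[k] T where
  __ := incl a b
  counit_comp := rfl
  map_comp_comul := LinearMap.ext (map_incl_comul a b)

theorem inclHom_apply (s : EqCoalg a b) : inclHom a b s = incl a b s := rfl

/-- A map is recovered from its coaction by applying the counit to the first leg, so equal coactions
give equal values. -/
theorem comp_inclHom : a.comp (inclHom a b) = b.comp (inclHom a b) := by
  have h : ∀ (c : T →ₗc[k] D) (t : T), c t =
      TensorProduct.lid k D ((counit : T →ₗ[k] k).rTensor D (coactAlong c t)) := by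
    intro c t
    rw [coactAlong_apply, rTensor_lTensor, Coalgebra.rTensor_counit_comul]
    simp
  ext s
  simp only [CoalgHom.comp_apply, inclHom_apply]
  rw [h a, h b, coactAlong_incl]

variable {a b} {Z : Type u} [AddCommGroup Z] [Module k Z] [Coalgebra k Z]

theorem coactAlong_comp (a : T →ₗc[k] D) (g : Z →ₗc[k] T) (z : Z) :
    coactAlong a (g z) = TensorProduct.map (g : Z →ₗ[k] T) (a.comp g : Z →ₗ[k] D) (comul z) := by
  rw [coactAlong_apply]
  have := CoalgHomClass.map_comp_comul_apply g z
  rw [← this, ← LinearMap.comp_apply, LinearMap.lTensor_comp_map]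
  rfl

/-- The universal property of the equalizer, on underlying spaces. -/
def liftLin (g : Z →ₗc[k] T) (h : a.comp g = b.comp g) : Z →ₗ[k] EqCoalg a b :=
  LinearMap.codRestrict (LinearMap.eqLocus (coactAlong a) (coactAlong b)) (g : Z →ₗ[k] T)
    (fun z => by
      change coactAlong a (g z) = coactAlong b (g z)
      rw [coactAlong_comp, coactAlong_comp, h])

theorem incl_comp_liftLin (g : Z →ₗc[k] T) (h : a.comp g = b.comp g) :
    incl a b ∘ₗ liftLin g h = (g : Z →ₗ[k] T) := rfl

/-- The universal property of the equalizer. -/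
def lift (g : Z →ₗc[k] T) (h : a.comp g = b.comp g) : Z →ₗc[k] EqCoalg a b where
  __ := liftLin g h
  counit_comp := CoalgHomClass.counit_comp g
  map_comp_comul := by
    ext z
    apply map_injective _ _ (incl_injective a b) (incl_injective a b)
    rw [LinearMap.comp_apply, LinearMap.comp_apply, map_incl_comul, ← LinearMap.comp_apply,
      ← TensorProduct.map_comp, incl_comp_liftLin]
    exact CoalgHomClass.map_comp_comul_apply g z

theorem incl_lift (g : Z →ₗc[k] T) (h : a.comp g = b.comp g) (z : Z) :
    incl a b (lift g h z) = g z := rfl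

end EqCoalg

end Equalizers


/-! ### Limits in the category of cocommutative coalgebras. -/

section Bundled

theorem CocommCoalg.hom_ext {D E : CocommCoalg k} {f g : D ⟶ E}
    (h : ∀ x, coalgMap f x = coalgMap g x) : f = g :=
  ObjectProperty.hom_ext _ (CoalgCat.hom_ext _ _ (CoalgHom.ext h))

/-- A cocommutative coalgebra as an object of the category. -/
abbrev CocommCoalg.of (k : Type u) [Field k] (D : Type u) [AddCommGroup D] [Module k D]
    [Coalgebra k D] [h : IsCocomm k D] : CocommCoalg k := ⟨CoalgCat.of k D, h⟩

/-- A map of coalgebras as a morphism of the category. -/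
def CocommCoalg.homMk {D E : CocommCoalg k} (f : D.obj →ₗc[k] E.obj) : D ⟶ E :=
  ObjectProperty.homMk ⟨f⟩

@[simp] theorem CocommCoalg.coalgMap_homMk {D E : CocommCoalg k} (f : D.obj →ₗc[k] E.obj) :
    coalgMap (CocommCoalg.homMk f) = f := rfl

@[simp] theorem CocommCoalg.coalgMap_comp_apply {D E F : CocommCoalg k} (f : D ⟶ E) (g : E ⟶ F)
    (x : D.obj) : coalgMap (f ≫ g) x = coalgMap g (coalgMap f x) := rfl

theorem CocommCoalg.coalgMap_comp {D E F : CocommCoalg k} (f : D ⟶ E) (g : E ⟶ F) :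
    coalgMap (f ≫ g) = (coalgMap g).comp (coalgMap f) := rfl

namespace CocommCoalg

/-- The product of two cocommutative coalgebras. -/
abbrev tensorObj (E F : CocommCoalg k) : CocommCoalg k := of k (E.obj ⊗[k] F.obj)

/-- The product cone. -/
def prodFan (E F : CocommCoalg k) : BinaryFan E F :=
  BinaryFan.mk (P := tensorObj E F) (homMk (projFst k E.obj F.obj)) (homMk (projSnd k E.obj F.obj))

/-- The tensor product of cocommutative coalgebras is their product. -/
def prodFanIsLimit (E F : CocommCoalg k) : IsLimit (prodFan E F) :=
  BinaryFan.isLimitMk (fun s => homMk (prodLift (coalgMap s.fst) (coalgMap s.snd)))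
    (fun s => hom_ext fun x => DFunLike.congr_fun
      (projFst_prodLift (coalgMap s.fst) (coalgMap s.snd)) x)
    (fun s => hom_ext fun x => DFunLike.congr_fun
      (projSnd_prodLift (coalgMap s.fst) (coalgMap s.snd)) x)
    (fun s m h₁ h₂ => hom_ext fun x => by
      rw [← h₁, ← h₂]
      exact (DFunLike.congr_fun (prodLift_unique (coalgMap m)) x).symm)

instance : HasBinaryProducts (CocommCoalg k) :=
  have : ∀ {E F : CocommCoalg k}, HasLimit (pair E F) :=
    fun {E F} => ⟨⟨prodFan E F, prodFanIsLimit E F⟩⟩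
  hasBinaryProducts_of_hasLimit_pair _

/-- The coalgebra `k` is terminal. -/
def isTerminalUnit : IsTerminal (of k k) :=
  IsTerminal.ofUniqueHom (fun E => homMk (counitCoalgHom k E.obj))
    (fun _ _ => hom_ext fun x => DFunLike.congr_fun (Coalgebra.ext_to_ring _ _ _) x)

instance : HasTerminal (CocommCoalg k) := isTerminalUnit.hasTerminal

/-- The fibre product `X ×_D E` of cocommutative coalgebras, on the cotensor product. -/
abbrev fibreProd {X E D : CocommCoalg k} (φ : X ⟶ D) (f : E ⟶ D) : CocommCoalg k :=
  of k (EqCoalg ((coalgMap φ).comp (projFst k X.obj E.obj))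
    ((coalgMap f).comp (projSnd k X.obj E.obj)))

variable {X E D : CocommCoalg k} (φ : X ⟶ D) (f : E ⟶ D)

/-- The inclusion `X ×_D E → X ⊗ E`. -/
def fibreIncl : fibreProd φ f ⟶ tensorObj X E := homMk (EqCoalg.inclHom _ _)

/-- The pullback cone. -/
def fibreCone : PullbackCone φ f :=
  PullbackCone.mk (fibreIncl φ f ≫ (prodFan X E).fst) (fibreIncl φ f ≫ (prodFan X E).snd)
    (hom_ext fun x => DFunLike.congr_fun (EqCoalg.comp_inclHom
      ((coalgMap φ).comp (projFst k X.obj E.obj)) ((coalgMap f).comp (projSnd k X.obj E.obj))) x)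

theorem prodLift_condition {Z : CocommCoalg k} (a : Z ⟶ X) (b : Z ⟶ E) (h : a ≫ φ = b ≫ f) :
    ((coalgMap φ).comp (projFst k X.obj E.obj)).comp (prodLift (coalgMap a) (coalgMap b)) =
      ((coalgMap f).comp (projSnd k X.obj E.obj)).comp (prodLift (coalgMap a) (coalgMap b)) := by
  rw [CoalgHom.comp_assoc, CoalgHom.comp_assoc, projFst_prodLift, projSnd_prodLift,
    ← coalgMap_comp, ← coalgMap_comp, h]

/-- The cotensor product is the pullback. -/
def fibreConeIsLimit : IsLimit (fibreCone φ f) :=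
  PullbackCone.IsLimit.mk _
    (fun s => homMk (EqCoalg.lift (prodLift (coalgMap s.fst) (coalgMap s.snd))
      (prodLift_condition φ f s.fst s.snd s.condition)))
    (fun s => hom_ext fun x => DFunLike.congr_fun
      (projFst_prodLift (coalgMap s.fst) (coalgMap s.snd)) x)
    (fun s => hom_ext fun x => DFunLike.congr_fun
      (projSnd_prodLift (coalgMap s.fst) (coalgMap s.snd)) x)
    (fun s m h₁ h₂ => hom_ext fun x => by
      apply EqCoalg.incl_injective
      rw [coalgMap_homMk, EqCoalg.incl_lift, ← h₁, ← h₂]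
      exact (DFunLike.congr_fun (prodLift_unique (coalgMap (m ≫ fibreIncl φ f))) x).symm)

instance hasPullbacks : HasPullbacks (CocommCoalg k) :=
  have : ∀ {X Y Z : CocommCoalg k} {f : X ⟶ Z} {g : Y ⟶ Z}, HasLimit (cospan f g) :=
    fun {_ _ _ f g} => ⟨⟨fibreCone f g, fibreConeIsLimit f g⟩⟩
  hasPullbacks_of_hasLimit_cospan _

variable {φ f}

/-- With the companion for `projSnd`, this rewrites membership in the fibre product as the cotensor
equation. -/
theorem coactAlong_comp_projFst (t : X.obj ⊗[k] E.obj) :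
    coactAlong ((coalgMap φ).comp (projFst k X.obj E.obj)) t =
      actL (coactAlong (coalgMap φ)) E.obj t := by
  rw [coactAlong_apply, CoalgHom.comp_toLinearMap, LinearMap.lTensor_comp, LinearMap.comp_apply,
    lTensor_projFst_comul]
  induction t using TensorProduct.induction_on with
  | zero => simp
  | add a b ha hb => simp only [map_add, ha, hb]
  | tmul x y => rw [actL_tmul, actL_tmul, ← rTensor_lTensor]; rfl

theorem coactAlong_comp_projSnd (t : X.obj ⊗[k] E.obj) :
    coactAlong ((coalgMap f).comp (projSnd k X.obj E.obj)) t =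
      (coalgMap f : E.obj →ₗ[k] D.obj).lTensor _ (actR X.obj comul t) := by
  rw [coactAlong_apply, CoalgHom.comp_toLinearMap, LinearMap.lTensor_comp, LinearMap.comp_apply,
    lTensor_projSnd_comul]

/-- Stated for an arbitrary pullback, since `Over.pullback` uses chosen limits about which only the
universal property is known. -/
theorem exists_iso_fibreProd {P : CocommCoalg k} {p₁ : P ⟶ X} {p₂ : P ⟶ E}
    (h : IsPullback p₁ p₂ φ f) : ∃ e : P ≅ fibreProd φ f,
      ∀ z, prodLift (coalgMap p₁) (coalgMap p₂) z = coalgMap (fibreIncl φ f) (coalgMap e.hom z) := by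
  let e : P ≅ fibreProd φ f := IsLimit.conePointUniqueUpToIso h.isLimit (fibreConeIsLimit φ f)
  have h₁ : e.hom ≫ fibreIncl φ f ≫ (prodFan X E).fst = p₁ :=
    IsLimit.conePointUniqueUpToIso_hom_comp h.isLimit (fibreConeIsLimit φ f) WalkingCospan.left
  have h₂ : e.hom ≫ fibreIncl φ f ≫ (prodFan X E).snd = p₂ :=
    IsLimit.conePointUniqueUpToIso_hom_comp h.isLimit (fibreConeIsLimit φ f) WalkingCospan.right
  refine ⟨e, fun z => ?_⟩
  rw [← h₁, ← h₂]
  exact DFunLike.congr_fun (prodLift_unique (coalgMap (e.hom ≫ fibreIncl φ f))) z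

theorem iso_hom_bijective {P Q : CocommCoalg k} (e : P ≅ Q) :
    Function.Bijective (coalgMap e.hom) := by
  refine Function.bijective_iff_has_inverse.mpr ⟨coalgMap e.inv, fun x => ?_, fun x => ?_⟩
  · rw [← coalgMap_comp_apply, e.hom_inv_id]; rfl
  · rw [← coalgMap_comp_apply, e.inv_hom_id]; rfl

/-- The map `x ↦ p₁ x₁ ⊗ p₂ x₂` of a pullback of cocommutative coalgebras is injective. -/
theorem isPullback_injective {P : CocommCoalg k} {p₁ : P ⟶ X} {p₂ : P ⟶ E}
    (h : IsPullback p₁ p₂ φ f) : Function.Injective (prodLift (coalgMap p₁) (coalgMap p₂)) := by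
  obtain ⟨e, he⟩ := exists_iso_fibreProd h
  intro x y hxy
  rw [he, he] at hxy
  exact (iso_hom_bijective e).1 (EqCoalg.incl_injective _ _ hxy)

/-- The map `x ↦ p₁ x₁ ⊗ p₂ x₂` of a pullback of cocommutative coalgebras is onto the cotensor
product. -/
theorem isPullback_exists {P : CocommCoalg k} {p₁ : P ⟶ X} {p₂ : P ⟶ E}
    (h : IsPullback p₁ p₂ φ f) (t : X.obj ⊗[k] E.obj)
    (ht : actL (coactAlong (coalgMap φ)) E.obj t =
      (coalgMap f : E.obj →ₗ[k] D.obj).lTensor _ (actR X.obj comul t)) :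
    ∃ z, prodLift (coalgMap p₁) (coalgMap p₂) z = t := by
  obtain ⟨e, he⟩ := exists_iso_fibreProd h
  obtain ⟨z, hz⟩ := (iso_hom_bijective e).2 ⟨t, by
    change coactAlong ((coalgMap φ).comp (projFst k X.obj E.obj)) t =
      coactAlong ((coalgMap f).comp (projSnd k X.obj E.obj)) t
    rw [coactAlong_comp_projFst, coactAlong_comp_projSnd, ht]⟩
  exact ⟨z, by rw [he, hz]; rfl⟩

end CocommCoalg

end Bundled

end Products

/-! ### The finite dual of a commutative algebra. -/

section FiniteDual

variable {k : Type u} [Field k]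

section Pairing

variable {M N P : Type u} [AddCommGroup M] [Module k M] [AddCommGroup N] [Module k N]
  [AddCommGroup P] [Module k P]

/-- The functional `s ⊗ t ↦ x s * y t`. -/
def pairing (x : M →ₗ[k] k) (y : N →ₗ[k] k) : M ⊗[k] N →ₗ[k] k :=
  LinearMap.mul' k k ∘ₗ TensorProduct.map x y

@[simp] theorem pairing_tmul (x : M →ₗ[k] k) (y : N →ₗ[k] k) (s : M) (t : N) :
    pairing x y (s ⊗ₜ t) = x s * y t := rfl

theorem pairing_map {M' N' : Type u} [AddCommGroup M'] [Module k M'] [AddCommGroup N']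
    [Module k N'] (x : M →ₗ[k] k) (y : N →ₗ[k] k) (g : M' →ₗ[k] M) (h : N' →ₗ[k] N)
    (t : M' ⊗[k] N') :
    pairing x y (TensorProduct.map g h t) = pairing (x ∘ₗ g) (y ∘ₗ h) t := by
  rw [pairing, pairing, TensorProduct.map_comp]
  rfl

theorem eq_zero_of_forall_rTensor {ι : Type*} (φ : ι → M →ₗ[k] k)
    (hφ : ∀ y, (∀ i, φ i y = 0) → y = 0) (t : M ⊗[k] N)
    (h : ∀ i, (φ i).rTensor N t = 0) : t = 0 := by
  apply (TensorProduct.comm k M N).injective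
  rw [map_zero]
  refine eq_zero_of_forall_lTensor φ hφ _ (fun i => ?_)
  rw [LinearMap.lTensor_comm, h, map_zero]

theorem eq_zero_of_forall_pairing {ι κ : Type*} (x : ι → M →ₗ[k] k) (y : κ → N →ₗ[k] k)
    (hx : ∀ m, (∀ i, x i m = 0) → m = 0) (hy : ∀ n, (∀ j, y j n = 0) → n = 0) (t : M ⊗[k] N)
    (h : ∀ i j, pairing (x i) (y j) t = 0) : t = 0 := by
  refine eq_zero_of_forall_lTensor y hy t (fun j => ?_)
  apply (TensorProduct.rid k M).injective
  rw [map_zero]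
  refine hx _ (fun i => ?_)
  rw [← h i j]
  generalize t = s
  induction s using TensorProduct.induction_on with
  | zero => simp
  | add a b ha hb => simp only [map_add, ha, hb]
  | tmul a b => simp [mul_comm]

theorem eq_of_forall_pairing {ι κ : Type*} (x : ι → M →ₗ[k] k) (y : κ → N →ₗ[k] k)
    (hx : ∀ m, (∀ i, x i m = 0) → m = 0) (hy : ∀ n, (∀ j, y j n = 0) → n = 0) {t s : M ⊗[k] N}
    (h : ∀ i j, pairing (x i) (y j) t = pairing (x i) (y j) s) : t = s := by
  rw [← sub_eq_zero]
  refine eq_zero_of_forall_pairing x y hx hy _ (fun i j => ?_)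
  rw [map_sub, h, sub_self]

end Pairing

variable (k) (A : Type u) [CommRing A] [Algebra k A]

/-- The map `f ↦ f ∘ mul`, modulo the image of `A* ⊗ A*` in `(A ⊗ A)*`. -/
def repDefect : Module.Dual k A →ₗ[k]
    (Module.Dual k (A ⊗[k] A) ⧸ LinearMap.range (TensorProduct.dualDistrib k A A)) :=
  (LinearMap.range (TensorProduct.dualDistrib k A A)).mkQ ∘ₗ (LinearMap.mul' k A).dualMap

/-- The finite dual of a commutative algebra: the functionals `f` such that `f (a * b)` is a finite
sum of products `g a * h b`. -/
def FiniteDual : Type u := LinearMap.eqLocus (repDefect k A) 0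

namespace FiniteDual

instance : AddCommGroup (FiniteDual k A) :=
  inferInstanceAs (AddCommGroup (LinearMap.eqLocus (repDefect k A) 0))

instance : Module k (FiniteDual k A) :=
  inferInstanceAs (Module k (LinearMap.eqLocus (repDefect k A) 0))

/-- The inclusion `A° → A*`. -/
def incl : FiniteDual k A →ₗ[k] Module.Dual k A := (LinearMap.eqLocus (repDefect k A) 0).subtype

theorem incl_injective : Function.Injective (incl k A) := Submodule.subtype_injective _

variable {k A}

/-- Evaluation of functionals at `a`. -/
def evDual (a : A) : Module.Dual k A →ₗ[k] k := Module.Dual.eval k A a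

@[simp] theorem evDual_apply (a : A) (f : Module.Dual k A) : evDual a f = f a := rfl

theorem dualDistrib_tmul (t : Module.Dual k A ⊗[k] Module.Dual k A) (a b : A) :
    TensorProduct.dualDistrib k A A t (a ⊗ₜ b) = pairing (evDual a) (evDual b) t := by
  induction t using TensorProduct.induction_on with
  | zero => simp
  | add a b ha hb => simp only [map_add, LinearMap.add_apply, ha, hb]
  | tmul f g => simp

theorem repDefect_eq_zero_iff (f : Module.Dual k A) : repDefect k A f = 0 ↔
    ∃ t : Module.Dual k A ⊗[k] Module.Dual k A,
      ∀ a b, pairing (evDual a) (evDual b) t = f (a * b) := by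
  rw [repDefect, LinearMap.comp_apply, Submodule.mkQ_apply, Submodule.Quotient.mk_eq_zero]
  constructor
  · rintro ⟨t, ht⟩
    refine ⟨t, fun a b => ?_⟩
    rw [← dualDistrib_tmul, ht]
    rfl
  · rintro ⟨t, ht⟩
    refine ⟨t, TensorProduct.ext' fun a b => ?_⟩
    rw [dualDistrib_tmul, ht]
    rfl

/-- The translate `b ↦ f (a * b)` of a functional. -/
def translate (a : A) : Module.Dual k A →ₗ[k] Module.Dual k A := (LinearMap.mulLeft k a).dualMap

@[simp] theorem translate_apply (a : A) (f : Module.Dual k A) (b : A) :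
    translate a f b = f (a * b) := rfl

/-- Translating the first leg of a tensor that represents `f (b * c)` gives one that represents `f
(a * b * c)`. -/
theorem repDefect_translate {f : Module.Dual k A} (hf : repDefect k A f = 0) (a : A) :
    repDefect k A (translate a f) = 0 := by
  rw [repDefect_eq_zero_iff] at hf ⊢
  obtain ⟨t, ht⟩ := hf
  refine ⟨(translate a).rTensor _ t, fun b c => ?_⟩
  rw [translate_apply, ← mul_assoc, ← ht, LinearMap.rTensor, pairing_map]
  rfl

/-- The tensor representing `f (a * b)` exists a priori only over the full dual. Contracting either
leg with an evaluation yields a translate of `f`, which is again in the finite dual. Since the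
finite dual is a kernel and tensoring is exact, each leg of the tensor can be moved into it. -/
theorem exists_comul (f : FiniteDual k A) : ∃ t : FiniteDual k A ⊗[k] FiniteDual k A,
    ∀ a b, pairing (evDual a ∘ₗ incl k A) (evDual b ∘ₗ incl k A) t = incl k A f (a * b) := by
  have hf : repDefect k A (incl k A f) = 0 := f.2
  obtain ⟨t, ht⟩ := (repDefect_eq_zero_iff _).mp hf
  have hsep : ∀ m : Module.Dual k A, (∀ a : A, evDual a m = 0) → m = 0 :=
    fun m hm => LinearMap.ext hm
  have h1 : ∀ b, TensorProduct.rid k _ ((evDual b).lTensor _ t) = translate b (incl k A f) := by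
    intro b
    ext a
    rw [translate_apply, mul_comm b a, ← ht]
    generalize t = s
    induction s using TensorProduct.induction_on with
    | zero => simp
    | add a b ha hb => simp only [map_add, LinearMap.add_apply, ha, hb]
    | tmul f g => simp [mul_comm]
  -- The first leg must be killed by `repDefect`; tested against evaluation at `b` on the second
  -- leg, it becomes the translate of `f` by `b`.
  obtain ⟨t', rfl⟩ : t ∈ LinearMap.range ((incl k A).rTensor (Module.Dual k A)) := by
    refine mem_range_rTensor _ (repDefect k A) 0 t ?_
    rw [LinearMap.rTensor_zero, LinearMap.zero_apply]
    refine eq_zero_of_forall_lTensor (fun a : A => evDual a) hsep _ (fun b => ?_)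
    rw [← rTensor_lTensor]
    apply (TensorProduct.rid k _).injective
    rw [map_zero, ← repDefect_translate hf b, ← h1]
    generalize (evDual b).lTensor _ t = s
    induction s using TensorProduct.induction_on with
    | zero => simp
    | add a b ha hb => simp only [map_add, ha, hb]
    | tmul f g => simp
  have h2 : ∀ a, TensorProduct.lid k _ ((evDual a ∘ₗ incl k A).rTensor _ t') =
      translate a (incl k A f) := by
    intro a
    ext b
    rw [translate_apply, ← ht]
    generalize t' = s
    induction s using TensorProduct.induction_on with
    | zero => simp
    | add a b ha hb => simp only [map_add, LinearMap.add_apply, ha, hb]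
    | tmul f g => simp
  -- The same for the second leg; evaluations still separate the points of the finite dual, where
  -- the first leg now lives.
  obtain ⟨t'', rfl⟩ : t' ∈ LinearMap.range ((incl k A).lTensor (FiniteDual k A)) := by
    refine mem_range_lTensor _ (repDefect k A) 0 t' ?_
    rw [LinearMap.lTensor_zero, LinearMap.zero_apply]
    refine eq_zero_of_forall_rTensor (fun a : A => evDual a ∘ₗ incl k A)
      (fun m hm => incl_injective k A (LinearMap.ext fun a => by simpa using hm a)) _ (fun a => ?_)
    rw [rTensor_lTensor]
    apply (TensorProduct.lid k _).injective
    rw [map_zero, ← repDefect_translate hf a, ← h2]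
    generalize (evDual a ∘ₗ incl k A).rTensor _ t' = s
    induction s using TensorProduct.induction_on with
    | zero => simp
    | add a b ha hb => simp only [map_add, ha, hb]
    | tmul f g => simp
  refine ⟨t'', fun a b => ?_⟩
  rw [← ht, ← LinearMap.comp_apply (LinearMap.rTensor _ _), LinearMap.rTensor_comp_lTensor,
    pairing_map]

/-- Evaluation at `a`, on the finite dual. -/
def ev (a : A) : FiniteDual k A →ₗ[k] k := evDual a ∘ₗ incl k A

theorem ev_separating (f : FiniteDual k A) (h : ∀ a : A, ev a f = 0) : f = 0 :=
  incl_injective k A (LinearMap.ext h)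

theorem ev_ext {f g : FiniteDual k A} (h : ∀ a : A, ev a f = ev a g) : f = g :=
  incl_injective k A (LinearMap.ext h)

/-- This uniqueness makes the arbitrarily chosen `comulFun` linear. It and its variants with three
legs or one leg reduce the coalgebra axioms to associativity, unitality and commutativity of `A`. -/
theorem ext_pairing {t s : FiniteDual k A ⊗[k] FiniteDual k A}
    (h : ∀ a b : A, pairing (ev a) (ev b) t = pairing (ev a) (ev b) s) : t = s :=
  eq_of_forall_pairing _ _ ev_separating ev_separating h

/-- The comultiplication of the finite dual, as a function. -/
def comulFun (f : FiniteDual k A) : FiniteDual k A ⊗[k] FiniteDual k A := (exists_comul f).choose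

theorem pairing_comulFun (f : FiniteDual k A) (a b : A) :
    pairing (ev a) (ev b) (comulFun f) = ev (a * b) f := (exists_comul f).choose_spec a b

instance : CoalgebraStruct k (FiniteDual k A) where
  comul :=
    { toFun := comulFun
      map_add' f g := ext_pairing fun a b => by simp only [map_add, pairing_comulFun]
      map_smul' c f := ext_pairing fun a b => by
        simp only [map_smul, pairing_comulFun, RingHom.id_apply] }
  counit := ev 1

theorem pairing_comul (f : FiniteDual k A) (a b : A) :
    pairing (ev a) (ev b) (comul f) = ev (a * b) f := pairing_comulFun f a b

instance : Coalgebra k (FiniteDual k A) where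
  coassoc := by
    ext f
    refine eq_of_forall_pairing (fun a : A => ev a)
      (fun b : A × A => pairing (ev b.1) (ev b.2)) ev_separating
      (fun t ht => eq_zero_of_forall_pairing _ _ ev_separating ev_separating _
        (fun b c => ht (b, c))) ?_
    rintro a ⟨b, c⟩
    have h1 : ∀ t : FiniteDual k A ⊗[k] FiniteDual k A, pairing (ev a) (pairing (ev b) (ev c))
        (TensorProduct.assoc k _ _ _ ((comul : FiniteDual k A →ₗ[k] _).rTensor _ t)) =
        pairing (ev (a * b)) (ev c) t := by
      intro t
      induction t using TensorProduct.induction_on with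
      | zero => simp
      | add a b ha hb => simp only [map_add, ha, hb]
      | tmul f g =>
        rw [LinearMap.rTensor_tmul, pairing_tmul, ← pairing_comul]
        generalize (comul f : FiniteDual k A ⊗[k] FiniteDual k A) = s
        induction s using TensorProduct.induction_on with
        | zero => simp
        | add a b ha hb => simp only [map_add, TensorProduct.add_tmul, add_mul, ha, hb]
        | tmul f g => simp [mul_assoc]
    have h2 : ∀ t : FiniteDual k A ⊗[k] FiniteDual k A, pairing (ev a) (pairing (ev b) (ev c))
        ((comul : FiniteDual k A →ₗ[k] _).lTensor _ t) = pairing (ev a) (ev (b * c)) t := by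
      intro t
      induction t using TensorProduct.induction_on with
      | zero => simp
      | add a b ha hb => simp only [map_add, ha, hb]
      | tmul f g => rw [LinearMap.lTensor_tmul, pairing_tmul, pairing_tmul, pairing_comul]
    simp only [LinearMap.comp_apply, LinearEquiv.coe_coe]
    rw [h1, h2, pairing_comul, pairing_comul, mul_assoc]
  rTensor_counit_comp_comul := by
    ext f
    refine eq_of_forall_pairing (fun _ : Unit => LinearMap.id) (fun a : A => ev a)
      (fun m h => h ()) ev_separating ?_
    rintro - a
    rw [LinearMap.comp_apply, LinearMap.rTensor, pairing_map]
    refine (pairing_comul f 1 a).trans ?_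
    simp
  lTensor_counit_comp_comul := by
    ext f
    refine eq_of_forall_pairing (fun a : A => ev a) (fun _ : Unit => LinearMap.id)
      ev_separating (fun m h => h ()) ?_
    rintro a -
    rw [LinearMap.comp_apply, LinearMap.lTensor, pairing_map]
    refine (pairing_comul f a 1).trans ?_
    simp

instance : IsCocomm k (FiniteDual k A) where
  comm_comp_comul := by
    ext f
    refine ext_pairing fun a b => ?_
    have h : ∀ t : FiniteDual k A ⊗[k] FiniteDual k A,
        pairing (ev a) (ev b) (TensorProduct.comm k _ _ t) = pairing (ev b) (ev a) t := by
      intro t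
      induction t using TensorProduct.induction_on with
      | zero => simp
      | add a b ha hb => simp only [map_add, ha, hb]
      | tmul f g => simp [mul_comm]
    simp only [LinearMap.comp_apply, LinearEquiv.coe_coe]
    rw [h, pairing_comul, pairing_comul, mul_comm]

variable {E : Type u} [AddCommGroup E] [Module k E] [Coalgebra k E]

/-- The functional `a ↦ θ a x` on `A`. -/
def ofAlgHomAux (θ : A →ₐ[k] WithConv (E →ₗ[k] k)) : E →ₗ[k] Module.Dual k A where
  toFun x :=
    { toFun a := (θ a).ofConv x
      map_add' a b := by simp
      map_smul' c a := by simp }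
  map_add' x y := by ext; simp
  map_smul' c x := by ext; simp

/-- Multiplicativity of `θ` for the convolution product, read at `x`. It shows both that the
functional attached to `x` lies in the finite dual and that the resulting map respects
comultiplication. -/
theorem pairing_ofAlgHomAux (θ : A →ₐ[k] WithConv (E →ₗ[k] k)) (x : E) (a b : A) :
    pairing (evDual a) (evDual b) (TensorProduct.map (ofAlgHomAux θ) (ofAlgHomAux θ) (comul x)) =
      ofAlgHomAux θ x (a * b) := by
  rw [pairing_map]
  change _ = (θ (a * b)).ofConv x
  rw [map_mul]
  rfl

/-- The linear map `E → A°` induced by an algebra map `A → E*`. -/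
def ofAlgHomLin (θ : A →ₐ[k] WithConv (E →ₗ[k] k)) : E →ₗ[k] FiniteDual k A :=
  LinearMap.codRestrict (LinearMap.eqLocus (repDefect k A) 0) (ofAlgHomAux θ)
    (fun x => (repDefect_eq_zero_iff _).mpr ⟨_, pairing_ofAlgHomAux θ x⟩)

/-- The coalgebra map `E → A°` induced by an algebra map `A → E*`. -/
def ofAlgHom (θ : A →ₐ[k] WithConv (E →ₗ[k] k)) : E →ₗc[k] FiniteDual k A where
  __ := ofAlgHomLin θ
  counit_comp := by
    ext x
    change (θ 1).ofConv x = counit x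
    rw [map_one]
    rfl
  map_comp_comul := by
    ext x
    refine ext_pairing fun a b => ?_
    rw [LinearMap.comp_apply, LinearMap.comp_apply, pairing_map, pairing_comul]
    have h := pairing_ofAlgHomAux θ x a b
    rw [pairing_map] at h
    exact h

theorem ev_ofAlgHom (θ : A →ₐ[k] WithConv (E →ₗ[k] k)) (a : A) (x : E) :
    ev a (ofAlgHom θ x) = (θ a).ofConv x := rfl

/-- The algebra map `A → E*` induced by a coalgebra map `E → A°`. -/
def toAlgHom (h : E →ₗc[k] FiniteDual k A) : A →ₐ[k] WithConv (E →ₗ[k] k) :=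
  AlgHom.ofLinearMap
    { toFun a := WithConv.toConv (ev a ∘ₗ (h : E →ₗ[k] FiniteDual k A))
      map_add' a b := by ext x; exact map_add (incl k A (h x)) a b
      map_smul' c a := by ext x; exact map_smul (incl k A (h x)) c a }
    (by
      ext x
      exact CoalgHomClass.counit_comp_apply h x)
    (by
      intro a b
      ext x
      change ev (a * b) (h x) = _
      rw [← pairing_comul]
      have := CoalgHomClass.map_comp_comul_apply h x
      rw [← this, pairing_map]
      rfl)

theorem toAlgHom_apply (h : E →ₗc[k] FiniteDual k A) (a : A) (x : E) :
    (toAlgHom h a).ofConv x = ev a (h x) := rfl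

/-- Coalgebra maps into the finite dual of a polynomial ring. -/
def homEquiv (S : Type u) [IsCocomm k E] :
    (S → (E →ₗ[k] k)) ≃ (E →ₗc[k] FiniteDual k (MvPolynomial S k)) where
  toFun θ := ofAlgHom (MvPolynomial.aeval fun s => WithConv.toConv (θ s))
  invFun h s := ev (MvPolynomial.X s) ∘ₗ (h : E →ₗ[k] FiniteDual k (MvPolynomial S k))
  left_inv θ := by
    ext s x
    refine (ev_ofAlgHom _ _ _).trans ?_
    rw [MvPolynomial.aeval_X]
  right_inv h := by
    ext x
    refine ev_ext fun a => ?_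
    rw [ev_ofAlgHom, ← toAlgHom_apply]
    congr 2
    refine AlgHom.congr_fun (MvPolynomial.algHom_ext fun s => ?_) a
    rw [MvPolynomial.aeval_X]
    rfl

end FiniteDual

end FiniteDual

/-! ### Cofree cocommutative coalgebras. -/

section Cofree

variable (k : Type u) [Field k]

/-- The underlying vector space of a cocommutative coalgebra. -/
def forgetVec : CocommCoalg k ⥤ ModuleCat.{u} k where
  obj E := ModuleCat.of k E.obj
  map f := ModuleCat.ofHom (coalgMap f : _ →ₗ[k] _)

/-- The set of functionals on a vector space, contravariantly. -/
def dualSet : ModuleCat.{u} k ⥤ (Type u)ᵒᵖ where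
  obj V := Opposite.op (V →ₗ[k] k)
  map f := Quiver.Hom.op (↾fun φ => φ ∘ₗ f.hom)

variable {k} in
/-- Maps out of the set of functionals in the opposite category. -/
def dualSetHomEquiv (V : ModuleCat.{u} k) (S : (Type u)ᵒᵖ) :
    ((dualSet k).obj V ⟶ S) ≃ (S.unop → (V →ₗ[k] k)) where
  toFun g := TypeCat.homEquiv g.unop
  invFun h := Quiver.Hom.op (↾h)
  left_inv _ := rfl
  right_inv _ := rfl

/-- The set of functionals is left adjoint to `S ↦ k^S`. -/
def dualSetAdj : dualSet k ⊣ Adjunction.rightAdjointOfEquiv (F := dualSet k)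
    (G_obj := fun S => ModuleCat.of k (S.unop → k))
    (fun V S => (dualSetHomEquiv V S).trans
      { toFun g := ModuleCat.ofHom (LinearMap.pi g)
        invFun h := fun s => LinearMap.proj s ∘ₗ h.hom
        left_inv _ := rfl
        right_inv _ := rfl })
    (fun _ _ _ _ _ => rfl) :=
  Adjunction.adjunctionOfEquivRight _ _

/-- The unit is the evaluation of `V` into the functions on its dual, and functionals separate
points. -/
instance (V : ModuleCat.{u} k) : Mono ((dualSetAdj k).unit.app V) := by
  rw [ModuleCat.mono_iff_injective, injective_iff_map_eq_zero]
  intro x hx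
  refine (Module.forall_dual_apply_eq_zero_iff k x).mp fun φ => ?_
  exact congrFun hx φ

variable {k} in
/-- Maps into the finite dual of a polynomial ring, categorically. -/
def finiteDualHomEquiv (E : CocommCoalg k) (S : (Type u)ᵒᵖ) :
    ((forgetVec k ⋙ dualSet k).obj E ⟶ S) ≃
      (E ⟶ CocommCoalg.of k (FiniteDual k (MvPolynomial S.unop k))) :=
  ((dualSetHomEquiv ((forgetVec k).obj E) S).trans
    (FiniteDual.homEquiv (k := k) (E := E.obj) S.unop)).trans
    { toFun h := CocommCoalg.homMk
        (E := CocommCoalg.of k (FiniteDual k (MvPolynomial S.unop k))) h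
      invFun h := coalgMap h
      left_inv _ := rfl
      right_inv _ := rfl }

/-- In the opposite category of sets, morphisms from the dual of `E` to `S` are functions from `S`
to functionals on `E`, that is, algebra maps from the polynomial ring on `S` to the convolution
algebra of `E`, that is, coalgebra maps from `E` to the finite dual of that ring. -/
instance : (forgetVec k ⋙ dualSet k).IsLeftAdjoint :=
  (Adjunction.adjunctionOfEquivRight (F := forgetVec k ⋙ dualSet k) finiteDualHomEquiv
    (by
      intro E' E S f g
      apply (finiteDualHomEquiv E' S).symm.injective
      rw [Equiv.symm_apply_apply]
      apply (dualSetHomEquiv ((forgetVec k).obj E') S).injective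
      ext s x
      have h := congrArg (fun g => dualSetHomEquiv ((forgetVec k).obj E) S g s (coalgMap f x))
        ((finiteDualHomEquiv E S).symm_apply_apply g)
      exact h.symm)).isLeftAdjoint

instance : HasEqualizers (CocommCoalg k) := hasEqualizers_of_hasPullbacks_and_binary_products

/-- Cofree cocommutative coalgebras exist. -/
instance : (forgetVec k).IsLeftAdjoint :=
  -- Adjoint triangle: `forgetVec` becomes a left adjoint after composition with the left adjoint
  -- `dualSet`, the unit of `dualSet` is a regular mono, and coalgebras have equalizers.
  isLeftAdjoint_triangle_lift (forgetVec k) (dualSetAdj k) (fun _ => regularMonoOfMono _)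

end Cofree

/-! ### Vector spaces with operators as modules over a free algebra. -/

section Operators

variable {k : Type u} [Field k] {X : Type u}

/-- The vector space `M` as a module over the free algebra on `X`, for a family of operators. -/
def OpMod {M : Type u} [AddCommGroup M] [Module k M] (_ : X → Module.End k M) : Type u := M

namespace OpMod

variable {M : Type u} [AddCommGroup M] [Module k M] (op : X → Module.End k M)

instance : AddCommGroup (OpMod op) := inferInstanceAs (AddCommGroup M)

instance : Module k (OpMod op) := inferInstanceAs (Module k M)

instance : Module (FreeAlgebra k X) (OpMod op) :=
  Module.compHom M (FreeAlgebra.lift k op).toRingHom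

theorem smul_def (a : FreeAlgebra k X) (m : M) :
    a • (show OpMod op from m) = (FreeAlgebra.lift k op a : Module.End k M) m := rfl

instance : IsScalarTower k (FreeAlgebra k X) (OpMod op) where
  smul_assoc c a m := by
    change (FreeAlgebra.lift k op (c • a) : Module.End k M) m =
      c • (FreeAlgebra.lift k op a : Module.End k M) m
    rw [map_smul]
    rfl

theorem ι_smul (x : X) (m : OpMod op) : FreeAlgebra.ι k x • m = op x m := by
  refine (smul_def op _ _).trans ?_
  rw [FreeAlgebra.lift_ι_apply]

/-- A subspace stable under the operators is a submodule. -/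
def ofStable (T : Submodule k M) (hT : ∀ x, ∀ m ∈ T, op x m ∈ T) :
    Submodule (FreeAlgebra k X) (OpMod op) where
  carrier := (T : Set M)
  add_mem' := T.add_mem
  zero_mem' := T.zero_mem
  smul_mem' a := by
    induction a using FreeAlgebra.induction with
    | grade0 r =>
      intro m hm
      have h : algebraMap k (FreeAlgebra k X) r • m = r • m := algebraMap_smul _ r m
      rw [h]
      exact T.smul_mem r hm
    | grade1 x =>
      intro m hm
      rw [ι_smul]
      exact hT x m hm
    | mul a b ha hb =>
      intro m hm
      rw [mul_smul]
      exact ha (hb hm)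
    | add a b ha hb =>
      intro m hm
      rw [add_smul]
      exact T.add_mem (ha hm) (hb hm)

/-- The subspace underlying a submodule. -/
def toSub (T : Submodule (FreeAlgebra k X) (OpMod op)) : Submodule k M := T.restrictScalars k

theorem toSub_stable (T : Submodule (FreeAlgebra k X) (OpMod op)) (x : X) (m : M)
    (hm : m ∈ toSub op T) : op x m ∈ toSub op T := by
  rw [← ι_smul op x m]
  exact T.smul_mem (FreeAlgebra.ι k x) hm

variable {op} {N : Type u} [AddCommGroup N] [Module k N] {op' : X → Module.End k N}

/-- A linear map commuting with the operators is a map of modules. -/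
def homMk (g : M →ₗ[k] N) (hg : ∀ x m, g (op x m) = op' x (g m)) :
    OpMod op →ₗ[FreeAlgebra k X] OpMod op' where
  toFun := g
  map_add' := g.map_add
  map_smul' a := by
    induction a using FreeAlgebra.induction with
    | grade0 r =>
      intro m
      have h : algebraMap k (FreeAlgebra k X) r • m = r • m := algebraMap_smul _ r m
      rw [h]
      refine (g.map_smul r m).trans ?_
      exact (algebraMap_smul (A := FreeAlgebra k X) r (show OpMod op' from g m)).symm
    | grade1 x =>
      intro m
      rw [ι_smul]
      refine (hg x m).trans (ι_smul op' x (g m)).symm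
    | mul a b ha hb =>
      intro m
      rw [mul_smul]
      refine (ha _).trans ?_
      rw [hb]
      exact (mul_smul a b (show OpMod op' from g m)).symm
    | add a b ha hb =>
      intro m
      rw [add_smul]
      refine (g.map_add _ _).trans ?_
      refine (congrArg₂ (· + ·) (ha m) (hb m)).trans ?_
      exact (add_smul a b (show OpMod op' from g m)).symm

/-- The linear map underlying a map of modules. -/
def toLin (g : OpMod op →ₗ[FreeAlgebra k X] OpMod op') : M →ₗ[k] N := g.restrictScalars k

theorem toLin_op (g : OpMod op →ₗ[FreeAlgebra k X] OpMod op') (x : X) (m : M) :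
    toLin g (op x m) = op' x (toLin g m) := by
  have h : g (FreeAlgebra.ι k x • (show OpMod op from m)) =
      FreeAlgebra.ι k x • g (show OpMod op from m) := g.map_smul _ _
  rw [ι_smul, ι_smul] at h
  exact h

end OpMod

variable {D : Type u} [AddCommGroup D] [Module k D] [Coalgebra k D]

/-- If the subcoalgebras are the subspaces stable under a family of operators, cosemisimplicity
is semisimplicity of the corresponding module. -/
theorem isCosemisimple_iff_isSemisimpleModule (op : X → Module.End k D)
    (h : ∀ T : Submodule k D, IsSubcoalgebra T ↔ ∀ x, ∀ m ∈ T, op x m ∈ T) :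
    IsCosemisimple k D ↔ IsSemisimpleModule (FreeAlgebra k X) (OpMod op) := by
  constructor
  · rintro ⟨ι, _, S, hS, hInt⟩
    let p : ι → Submodule (FreeAlgebra k X) (OpMod op) :=
      fun i => OpMod.ofStable op (S i) ((h _).mp (hS i).1)
    have hsimple : ∀ i, IsSimpleModule (FreeAlgebra k X) (p i) := by
      intro i
      rw [isSimpleModule_iff_isAtom]
      refine ⟨fun h0 => (hS i).2.1 ?_, fun T hT => ?_⟩
      · rw [eq_bot_iff]
        intro x hx
        have : x ∈ p i := hx
        rw [h0] at this
        exact this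
      · rcases (hS i).2.2 (OpMod.toSub op T) ((h _).mpr (OpMod.toSub_stable op T)) hT.le with h1 | h1
        · rw [eq_bot_iff]
          intro x hx
          have : x ∈ OpMod.toSub op T := hx
          rw [h1] at this
          exact this
        · refine absurd ?_ hT.not_ge
          intro x hx
          have hx' : x ∈ S i := hx
          rw [← h1] at hx'
          exact hx'
    refine isSemisimpleModule_of_isSemisimpleModule_submodule' (p := p) (fun i => inferInstance) ?_
    rw [eq_top_iff]
    intro x _
    have hx : x ∈ ⨆ i, S i := by
      rw [hInt.submodule_iSup_eq_top]
      trivial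
    have hle : ⨆ i, S i ≤ OpMod.toSub op (⨆ i, p i) :=
      iSup_le fun i => fun y hy => (le_iSup p i : p i ≤ _) hy
    exact hle hx
  · intro hss
    -- Independence of the simple submodules, not only that they span, is what gives a direct sum of
    -- subcoalgebras.
    obtain ⟨s, hind, htop, hs⟩ :=
      IsSemisimpleModule.exists_sSupIndep_sSup_simples_eq_top (FreeAlgebra k X) (OpMod op)
    classical
    refine ⟨s, inferInstance, fun i => OpMod.toSub op i.1, fun i => ⟨?_, ?_, ?_⟩, ?_⟩
    · exact (h _).mpr (OpMod.toSub_stable op i.1)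
    · intro h0
      have := hs i.1 i.2
      refine (isSimpleModule_iff_isAtom.mp this).1 ?_
      rw [eq_bot_iff]
      intro x hx
      have hx' : x ∈ OpMod.toSub op i.1 := hx
      have h0' : OpMod.toSub op i.1 = ⊥ := h0
      rw [h0'] at hx'
      exact hx'
    · intro T hT hle
      have := (isSimpleModule_iff_isAtom.mp (hs i.1 i.2)).le_iff.mp
        (show OpMod.ofStable op T ((h _).mp hT) ≤ i.1 from hle)
      rcases this with h1 | h1
      · left
        rw [eq_bot_iff]
        intro x hx
        have hx' : x ∈ OpMod.ofStable op T ((h _).mp hT) := hx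
        rw [h1] at hx'
        exact hx'
      · right
        refine le_antisymm hle ?_
        intro x hx
        have hx' : x ∈ i.1 := hx
        rw [← h1] at hx'
        exact hx'
    -- Being an internal direct sum concerns only the underlying additive groups, so the statement
    -- for submodules is the one for subspaces.
    · have hI : DirectSum.IsInternal (fun i : s => i.1) := by
        refine DirectSum.isInternal_submodule_of_iSupIndep_of_iSup_eq_top ?_ ?_
        · exact (sSupIndep_iff s).mp hind
        · rw [← sSup_eq_iSup']
          exact htop
      exact hI

end Operators

/-! ### Subcoalgebras as stable subspaces; semisimplicity of comodules. -/

section Subcoalgebras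

variable {k : Type u} [Field k]

/-- By exactness, `t` lies in `T ⊗ N` if and only if it vanishes in `(M ⧸ T) ⊗ N`, and vanishing
there is tested by the separating family. -/
theorem mem_range_rTensor_subtype {M N : Type u} [AddCommGroup M] [Module k M] [AddCommGroup N]
    [Module k N] {ι : Type*} (φ : ι → N →ₗ[k] k) (hφ : ∀ y, (∀ i, φ i y = 0) → y = 0)
    (T : Submodule k M) (t : M ⊗[k] N)
    (h : ∀ i, TensorProduct.rid k M ((φ i).lTensor M t) ∈ T) :
    t ∈ LinearMap.range (T.subtype.rTensor N) := by
  have hex := Module.Flat.rTensor_exact (R := k) N (LinearMap.exact_subtype_mkQ T)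
  refine (hex t).mp (eq_zero_of_forall_lTensor φ hφ _ (fun i => ?_))
  rw [← rTensor_lTensor]
  apply (TensorProduct.rid k _).injective
  rw [map_zero, ← (Submodule.Quotient.mk_eq_zero T).mpr (h i)]
  generalize (φ i).lTensor M t = s
  induction s using TensorProduct.induction_on with
  | zero => simp
  | add a b ha hb => rw [map_add, map_add, ha, hb, map_add, ← Submodule.mkQ_apply,
      ← Submodule.mkQ_apply, ← Submodule.mkQ_apply, map_add]
  | tmul f g => simp

variable {D : Type u} [AddCommGroup D] [Module k D] [Coalgebra k D]

/-- By cocommutativity, a coproduct in `T ⊗ D` is also in `D ⊗ T`, and over a field the intersection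
of these two is `T ⊗ T`. -/
theorem isSubcoalgebra_of_mem_range [IsCocomm k D] (T : Submodule k D)
    (h : ∀ x ∈ T, (comul x : D ⊗[k] D) ∈ LinearMap.range (T.subtype.rTensor D)) :
    IsSubcoalgebra T := by
  intro x hx
  obtain ⟨t, ht⟩ := h x hx
  have hexl := Module.Flat.lTensor_exact (R := k) D (LinearMap.exact_subtype_mkQ T)
  have hex := Module.Flat.lTensor_exact (R := k) T (LinearMap.exact_subtype_mkQ T)
  obtain ⟨t', ht'⟩ : t ∈ LinearMap.range (T.subtype.lTensor T) := by
    refine (hex t).mp ?_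
    apply rTensor_injective_of_injective _ _ T.subtype_injective
    rw [rTensor_lTensor, ht, map_zero]
    refine (hexl _).mpr ⟨TensorProduct.comm k _ _ t, ?_⟩
    rw [LinearMap.lTensor_comm, ht, Coalgebra.comm_comul]
  refine ⟨t', ?_⟩
  rw [← LinearMap.rTensor_comp_lTensor, LinearMap.comp_apply, ht', ht]

namespace Comodule

/-- The operator `x ↦ φ(x₁) x₀` on a comodule. -/
def actOp (V : Comodule k D) (φ : D →ₗ[k] k) : Module.End k V.carrier :=
  (TensorProduct.rid k V.carrier).toLinearMap ∘ₗ φ.lTensor V.carrier ∘ₗ V.coact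

theorem actOp_apply (V : Comodule k D) (φ : D →ₗ[k] k) (x : V.carrier) :
    V.actOp φ x = TensorProduct.rid k V.carrier (φ.lTensor V.carrier (V.coact x)) := rfl

theorem map_actOp {V W : Comodule k D} (f : V ⟶ W) (φ : D →ₗ[k] k) (x : V.carrier) :
    f.lin (V.actOp φ x) = W.actOp φ (f.lin x) := by
  rw [actOp_apply, actOp_apply, ← hom_comm_apply]
  generalize V.coact x = s
  induction s using TensorProduct.induction_on with
  | zero => simp
  | add a b ha hb => simp only [map_add, ha, hb]
  | tmul f g => simp

/-- A linear map commuting with the operators is a morphism of comodules. -/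
def homOfActOp {V W : Comodule k D} (g : V.carrier →ₗ[k] W.carrier)
    (hg : ∀ φ x, g (V.actOp φ x) = W.actOp φ (g x)) : V ⟶ W where
  lin := g
  comm := by
    ext x
    refine eq_of_forall_lTensor fun φ => ?_
    apply (TensorProduct.rid k _).injective
    refine Eq.trans ?_ (hg φ x)
    rw [actOp_apply, LinearMap.comp_apply]
    generalize V.coact x = s
    induction s using TensorProduct.induction_on with
    | zero => simp
    | add a b ha hb => simp only [map_add, ha, hb]
    | tmul f g => simp

end Comodule

variable (k D) in
/-- The operators `x ↦ φ(x₂) x₁` on a coalgebra. -/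
def regularOp : (D →ₗ[k] k) → Module.End k D := (Comodule.regular k D).actOp

/-- Stability under the operators says that `T` is a one-sided coideal, which suffices by
cocommutativity. This is the bridge from cosemisimple coalgebras to semisimple modules. -/
theorem isSubcoalgebra_iff_actOp_mem [IsCocomm k D] (T : Submodule k D) :
    IsSubcoalgebra T ↔ ∀ φ : D →ₗ[k] k, ∀ m ∈ T, regularOp k D φ m ∈ T := by
  constructor
  · intro h φ m hm
    obtain ⟨t, ht⟩ := h m hm
    change TensorProduct.rid k D (φ.lTensor D (comul m)) ∈ T
    rw [← ht]
    generalize t = s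
    induction s using TensorProduct.induction_on with
    | zero => simp
    | add a b ha hb => simp only [map_add]; exact T.add_mem ha hb
    | tmul f g => simpa using T.smul_mem _ f.2
  · intro h
    refine isSubcoalgebra_of_mem_range T fun x hx => ?_
    refine mem_range_rTensor_subtype (fun φ : D →ₗ[k] k => φ) (fun y hy => ?_) T _
      (fun φ => h φ x hx)
    exact (Module.forall_dual_apply_eq_zero_iff k y).mp hy

namespace Comodule

variable [IsCocomm k D] (hD : IsCosemisimple k D)

/-- A comodule as a module over the free algebra on the dual of the coalgebra. -/
abbrev AsModule (V : Comodule k D) : Type u := OpMod V.actOp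

theorem isSemisimpleModule_regular (hD : IsCosemisimple k D) :
    IsSemisimpleModule (FreeAlgebra k (D →ₗ[k] k)) (AsModule (regular k D)) :=
  (isCosemisimple_iff_isSemisimpleModule (regularOp k D) isSubcoalgebra_iff_actOp_mem).mp hD

/-- A morphism of comodules as a map of modules. -/
def asModuleHom {V W : Comodule k D} (f : V ⟶ W) :
    AsModule V →ₗ[FreeAlgebra k (D →ₗ[k] k)] AsModule W :=
  OpMod.homMk f.lin (fun φ x => map_actOp f φ x)

/-- The inclusion `d ↦ v ⊗ d` of `D` into a cofree comodule. -/
def tmulHom {M : Type u} [AddCommGroup M] [Module k M] (W : Comodule k D) (v : M) :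
    W ⟶ tensorR M W where
  lin := TensorProduct.mk k M W.carrier v
  comm := by
    ext y
    exact (actR_tmul W.coact v y).symm

/-- `M ⊗ D` is the sum of the subcomodules `v ⊗ D`, each a quotient of the semisimple comodule `D`.
-/
theorem isSemisimpleModule_cofree (hD : IsCosemisimple k D) (M : Type u) [AddCommGroup M]
    [Module k M] :
    IsSemisimpleModule (FreeAlgebra k (D →ₗ[k] k)) (AsModule (tensorR M (regular k D))) := by
  have := isSemisimpleModule_regular hD
  let p : M → Submodule (FreeAlgebra k (D →ₗ[k] k)) (AsModule (tensorR M (regular k D))) :=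
    fun v => LinearMap.range (asModuleHom (tmulHom (regular k D) v))
  refine isSemisimpleModule_of_isSemisimpleModule_submodule' (p := p)
    (fun v => IsSemisimpleModule.range _) ?_
  rw [eq_top_iff]
  intro x _
  have hx : ∀ x : M ⊗[k] D, x ∈ OpMod.toSub _ (⨆ v, p v) := by
    intro x
    induction x using TensorProduct.induction_on with
    | zero => exact zero_mem _
    | add a b ha hb => exact add_mem ha hb
    | tmul v d => exact (le_iSup p v : p v ≤ _) ⟨d, rfl⟩
  exact hx x

/-- The coaction as a morphism to the cofree comodule. -/
def coactHom (V : Comodule k D) : V ⟶ tensorR V.carrier (regular k D) where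
  lin := V.coact
  comm := by
    ext x
    exact ((TensorProduct.assoc k V.carrier D D).symm_apply_eq.mpr
        (coassoc_apply V x).symm).symm

theorem coact_injective (V : Comodule k D) : Function.Injective V.coact := by
  intro x y h
  rw [← counit_coact_apply V x, ← counit_coact_apply V y, h]

/-- The coaction embeds `V` into a cofree comodule, and submodules of semisimple modules are
semisimple. -/
theorem isSemisimpleModule (hD : IsCosemisimple k D) (V : Comodule k D) :
    IsSemisimpleModule (FreeAlgebra k (D →ₗ[k] k)) (AsModule V) := by
  have := isSemisimpleModule_cofree hD V.carrier
  exact IsSemisimpleModule.of_injective (asModuleHom (coactHom V)) (coact_injective V)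

/-- Over a cosemisimple coalgebra every injective morphism of comodules splits. -/
theorem exists_retraction (hD : IsCosemisimple k D) {V W : Comodule k D} (f : V ⟶ W)
    (hf : Function.Injective f.lin) : ∃ r : W ⟶ V, f ≫ r = 𝟙 V := by
  have := isSemisimpleModule hD W
  obtain ⟨h, hh⟩ := IsSemisimpleModule.extension_property (asModuleHom f) hf LinearMap.id
  refine ⟨homOfActOp (OpMod.toLin h) (OpMod.toLin_op h), ?_⟩
  ext x
  exact LinearMap.congr_fun hh x

theorem isSplitMono (hD : IsCosemisimple k D) {V W : Comodule k D} (f : V ⟶ W)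
    (hf : Function.Injective f.lin) : IsSplitMono f :=
  let ⟨r, hr⟩ := exists_retraction hD f hf
  ⟨⟨⟨r, hr⟩⟩⟩

end Comodule

end Subcoalgebras

/-! ### Retracts of left adjoint functors. -/

section RetractAdjoint

variable {𝒞 : Type*} [Category* 𝒞] {𝒟 : Type*} [Category* 𝒟] [HasEqualizers 𝒞]
  {F G : 𝒞 ⥤ 𝒟} (i : F ⟶ G) (r : G ⟶ F) (h : i ≫ r = 𝟙 F)

/-- A retract of a left adjoint functor is a left adjoint. -/
theorem isLeftAdjoint_of_retract (h : i ≫ r = 𝟙 F) [G.IsLeftAdjoint] : F.IsLeftAdjoint := by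
  let R := G.rightAdjoint
  let adj : G ⊣ R := Adjunction.ofIsLeftAdjoint G
  have hi : ∀ X, i.app X ≫ r.app X = 𝟙 _ := fun X => by rw [← NatTrans.comp_app, h]; rfl
  -- The idempotent `r ≫ i` of `G` transposes to an idempotent of `R`. Its splitting, obtained as
  -- the equalizer with the identity, is the right adjoint of `F`.
  let e : ∀ Y, R.obj Y ⟶ R.obj Y := fun Y =>
    adj.homEquiv _ _ (r.app _ ≫ i.app _ ≫ adj.counit.app Y)
  have he : ∀ {X Y} (g : X ⟶ R.obj Y),
      (adj.homEquiv _ _).symm (g ≫ e Y) = r.app _ ≫ i.app _ ≫ (adj.homEquiv _ _).symm g := by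
    intro X Y g
    rw [Adjunction.homEquiv_naturality_left_symm, Equiv.symm_apply_apply, r.naturality_assoc,
      i.naturality_assoc, Adjunction.homEquiv_counit]
  refine (Adjunction.adjunctionOfEquivRight (F := F) (G_obj := fun Y => equalizer (e Y) (𝟙 _))
    (fun X Y =>
      { toFun g := equalizer.lift (adj.homEquiv _ _ (r.app X ≫ g)) (by
          apply (adj.homEquiv _ _).symm.injective
          rw [he, Category.comp_id, Equiv.symm_apply_apply, reassoc_of% hi])
        invFun g := i.app X ≫ (adj.homEquiv _ _).symm (g ≫ equalizer.ι _ _)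
        left_inv g := by
          dsimp only
          rw [equalizer.lift_ι, Equiv.symm_apply_apply, reassoc_of% hi]
        right_inv g := by
          apply equalizer.hom_ext
          dsimp only
          rw [equalizer.lift_ι]
          apply (adj.homEquiv _ _).symm.injective
          rw [Equiv.symm_apply_apply, ← he, Category.assoc, equalizer.condition,
            Category.comp_id] }) ?_).isLeftAdjoint
  intro X' X Y f g
  apply equalizer.hom_ext
  simp only [Equiv.coe_fn_mk, equalizer.lift_ι, Category.assoc]
  rw [← Adjunction.homEquiv_naturality_left, r.naturality_assoc]

end RetractAdjoint

/-! ### Equalizers of comodules and cofree comodules. -/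

namespace Comodule

section Limits

variable {k : Type u} [Field k] {D : Type u} [AddCommGroup D] [Module k D] [Coalgebra k D]

section Equalizer

variable {V W : Comodule k D} (f g : V ⟶ W)

theorem equalizer_stable :
    f.lin.rTensor D ∘ₗ (V.coact ∘ₗ (LinearMap.eqLocus f.lin g.lin).subtype) =
      g.lin.rTensor D ∘ₗ (V.coact ∘ₗ (LinearMap.eqLocus f.lin g.lin).subtype) := by
  ext x
  have hx : f.lin x.1 = g.lin x.1 := x.2
  simp only [LinearMap.comp_apply, Submodule.subtype_apply, hom_comm_apply, hx]

/-- The equalizer of two morphisms of comodules. -/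
def equalizerObj : Comodule k D := eqSub V f.lin g.lin (equalizer_stable f g)

/-- The linear map underlying the inclusion of the equalizer. -/
def equalizerInclLin : (equalizerObj f g).carrier →ₗ[k] V.carrier :=
  (LinearMap.eqLocus f.lin g.lin).subtype

/-- The inclusion of the equalizer. -/
def equalizerIncl : equalizerObj f g ⟶ V where
  lin := equalizerInclLin f g
  comm := LinearMap.ext fun x => liftEq_spec _ _ _ (equalizer_stable f g) x

theorem equalizerIncl_injective : Function.Injective (equalizerIncl f g).lin :=
  Submodule.subtype_injective (LinearMap.eqLocus f.lin g.lin)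

theorem equalizerIncl_condition : equalizerIncl f g ≫ f = equalizerIncl f g ≫ g :=
  hom_ext _ _ (LinearMap.ext fun x => Subtype.property (p := (· ∈ LinearMap.eqLocus f.lin g.lin)) x)

/-- The linear map underlying the universal map to the equalizer. -/
def equalizerLiftLin {P : Comodule k D} (p : P ⟶ V) (h : p ≫ f = p ≫ g) :
    P.carrier →ₗ[k] (equalizerObj f g).carrier :=
  LinearMap.codRestrict (LinearMap.eqLocus f.lin g.lin) p.lin
    (fun x => LinearMap.congr_fun (congrArg Hom.lin h) x)

theorem equalizerIncl_equalizerLiftLin {P : Comodule k D} (p : P ⟶ V) (h : p ≫ f = p ≫ g) :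
    (equalizerIncl f g).lin ∘ₗ equalizerLiftLin f g p h = p.lin := rfl

/-- The universal property of the equalizer. -/
def equalizerLift {P : Comodule k D} (p : P ⟶ V) (h : p ≫ f = p ≫ g) : P ⟶ equalizerObj f g where
  lin := equalizerLiftLin f g p h
  comm := by
    ext x
    apply rTensor_injective_of_injective D _ (equalizerIncl_injective f g)
    rw [LinearMap.comp_apply, LinearMap.comp_apply, hom_comm_apply, ← LinearMap.rTensor_comp_apply,
      equalizerIncl_equalizerLiftLin, hom_comm_apply, ← LinearMap.comp_apply (equalizerIncl f g).lin,
      equalizerIncl_equalizerLiftLin]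

instance : HasEqualizers (Comodule k D) :=
  have : ∀ {V W : Comodule k D} {f g : V ⟶ W}, HasLimit (parallelPair f g) := fun {_ _ f g} =>
    ⟨⟨Fork.ofι (equalizerIncl f g) (equalizerIncl_condition f g), Fork.IsLimit.mk _
      (fun s => equalizerLift f g s.ι s.condition)
      (fun s => hom_ext _ _ (equalizerIncl_equalizerLiftLin f g s.ι s.condition))
      (fun s m hm => hom_ext _ _ (LinearMap.ext fun x => equalizerIncl_injective f g
        (LinearMap.congr_fun (congrArg Hom.lin
          (show m ≫ equalizerIncl f g = s.ι from hm)) x)))⟩⟩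
  hasEqualizers_of_hasLimit_parallelPair _

end Equalizer

theorem actR_rTensor {V M W : Type u} [AddCommGroup V] [Module k V] [AddCommGroup M] [Module k M]
    [AddCommGroup W] [Module k W] (g : V →ₗ[k] M) (w : W →ₗ[k] W ⊗[k] D) (t : V ⊗[k] W) :
    actR M w (g.rTensor W t) = (g.rTensor W).rTensor D (actR V w t) := by
  induction t using TensorProduct.induction_on with
  | zero => simp
  | add a b ha hb => simp only [map_add, ha, hb]
  | tmul x y =>
    rw [LinearMap.rTensor_tmul, actR_tmul, actR_tmul, ← LinearMap.rTensor_comp_apply]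
    rfl

variable (k D) in
/-- The map `M ⊗ D → M`, `m ⊗ d ↦ ε(d) m`. -/
def cofreeEval (M : Type u) [AddCommGroup M] [Module k M] : M ⊗[k] D →ₗ[k] M :=
  (TensorProduct.rid k M).toLinearMap ∘ₗ (counit : D →ₗ[k] k).lTensor M

theorem cofreeEval_tmul {M : Type u} [AddCommGroup M] [Module k M] (m : M) (d : D) :
    cofreeEval k D M (m ⊗ₜ d) = (counit d : k) • m := by
  simp [cofreeEval]

theorem cofreeEval_rTensor {V M : Type u} [AddCommGroup V] [Module k V] [AddCommGroup M]
    [Module k M] (g : V →ₗ[k] M) (t : V ⊗[k] D) :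
    cofreeEval k D M (g.rTensor D t) = g (cofreeEval k D V t) := by
  induction t using TensorProduct.induction_on with
  | zero => simp
  | add a b ha hb => simp only [map_add, ha, hb]
  | tmul x y => simp [cofreeEval_tmul]

theorem cofreeEval_rTensor_actR {M : Type u} [AddCommGroup M] [Module k M] (s : M ⊗[k] D) :
    (cofreeEval k D M).rTensor D (actR M (comul : D →ₗ[k] D ⊗[k] D) s) = s := by
  induction s using TensorProduct.induction_on with
  | zero => simp
  | add a b ha hb => simp only [map_add, ha, hb]
  | tmul m d =>
    rw [actR_tmul]
    have h3 : ∀ r : D ⊗[k] D, (cofreeEval k D M).rTensor D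
        (((TensorProduct.mk k M D) m).rTensor D r) =
        m ⊗ₜ TensorProduct.lid k D ((counit : D →ₗ[k] k).rTensor D r) := by
      intro r
      induction r using TensorProduct.induction_on with
      | zero => simp
      | add a b ha hb => simp only [map_add, TensorProduct.tmul_add, ha, hb]
      | tmul a b => simp [cofreeEval_tmul, TensorProduct.smul_tmul]
    rw [h3]
    simp

/-- The morphism of cofree comodules induced by a linear map. -/
def cofreeMap {M N : Type u} [AddCommGroup M] [Module k M] [AddCommGroup N] [Module k N]
    (g : M →ₗ[k] N) : tensorR M (regular k D) ⟶ tensorR N (regular k D) where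
  lin := g.rTensor D
  comm := LinearMap.ext fun t => (actR_rTensor g (comul : D →ₗ[k] D ⊗[k] D) t).symm

variable (k D) in
/-- The cofree comodule functor `M ↦ M ⊗ D`. -/
def cofree : ModuleCat.{u} k ⥤ Comodule k D where
  obj M := tensorR M (regular k D)
  map g := cofreeMap g.hom
  map_id M := hom_ext _ _ (LinearMap.rTensor_id D M)
  map_comp f g := hom_ext _ _ (LinearMap.rTensor_comp D g.hom f.hom)

variable (k D) in
/-- Cofree comodules are right adjoint to the forgetful functor. -/
def cofreeAdj : forgetMod (k := k) (D := D) ⊣ cofree k D :=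
  Adjunction.mkOfUnitCounit
    { unit :=
        { app V := coactHom V
          naturality V W f := hom_ext _ _ f.comm.symm }
      counit :=
        { app M := ModuleCat.ofHom (cofreeEval k D M)
          naturality M N g := by
            have h := cofreeEval_rTensor (k := k) (D := D) g.hom
            exact ModuleCat.hom_ext (LinearMap.ext h) }
      left_triangle := by
        ext V x
        exact counit_coact_apply V x
      right_triangle := by
        ext M : 2
        have h := cofreeEval_rTensor_actR (k := k) (D := D) (M := M)
        exact hom_ext _ _ (LinearMap.ext h) }

end Limits

/-! ### Closedness of the category of comodules. -/

section Closed

variable {k : Type u} [Field k] {D : Type u} [AddCommGroup D] [Module k D] [Coalgebra k D]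
  [IsCocomm k D] {V : Comodule k D} (σ : tensorR V.carrier (regular k D) ⟶ V)

variable (V) in
/-- A morphism from the cofree comodule, as a linear map. -/
def fromCofreeLin (σ : tensorR V.carrier (regular k D) ⟶ V) : V.carrier ⊗[k] D →ₗ[k] V.carrier :=
  σ.lin

theorem coact_fromCofreeLin (x : V.carrier) (d : D) :
    V.coact (fromCofreeLin V σ (x ⊗ₜ d)) =
      (fromCofreeLin V σ ∘ₗ TensorProduct.mk k V.carrier D x).rTensor D (comul d) := by
  refine (hom_comm_apply σ (x ⊗ₜ d)).symm.trans ?_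
  rw [LinearMap.rTensor_comp_apply]
  exact congrArg ((fromCofreeLin V σ).rTensor D)
    (actR_tmul (comul : D →ₗ[k] D ⊗[k] D) x d)

/-- The map `y ⊗ d ↦ σ(x ⊗ d) ⊗ y`. -/
def twistAt (x : V.carrier) (W : Type u) [AddCommGroup W] [Module k W] :
    W ⊗[k] D →ₗ[k] V.carrier ⊗[k] W :=
  (TensorProduct.comm k W V.carrier).toLinearMap ∘ₗ
    (fromCofreeLin V σ ∘ₗ TensorProduct.mk k V.carrier D x).lTensor W

theorem twistAt_tmul (x : V.carrier) {W : Type u} [AddCommGroup W] [Module k W] (y : W) (d : D) :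
    twistAt σ x W (y ⊗ₜ d) = fromCofreeLin V σ (x ⊗ₜ d) ⊗ₜ y := rfl

theorem actR_twistAt (W : Comodule k D) (x : V.carrier) (r : W.carrier ⊗[k] D) :
    actR V.carrier W.coact (twistAt σ x W.carrier r) =
      (twistAt σ x W.carrier).rTensor D
        (TensorProduct.rightComm k W.carrier D D (W.coact.rTensor D r)) := by
  induction r using TensorProduct.induction_on with
  | zero => simp
  | add a b ha hb => simp only [map_add, ha, hb]
  | tmul y d =>
    rw [twistAt_tmul, actR_tmul, LinearMap.rTensor_tmul]
    induction W.coact y using TensorProduct.induction_on with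
    | zero => simp
    | add a b ha hb => simp only [map_add, TensorProduct.add_tmul, ha, hb]
    | tmul y d => simp [twistAt_tmul]

theorem actL_twistAt (W : Type u) [AddCommGroup W] [Module k W] (x : V.carrier) (r : W ⊗[k] D) :
    actL V.coact W (twistAt σ x W r) =
      (twistAt σ x W).rTensor D ((TensorProduct.assoc k W D D).symm
        ((comul : D →ₗ[k] D ⊗[k] D).lTensor W r)) := by
  induction r using TensorProduct.induction_on with
  | zero => simp
  | add a b ha hb => simp only [map_add, ha, hb]
  | tmul y d =>
    rw [twistAt_tmul, actL_tmul, LinearMap.lTensor_tmul, coact_fromCofreeLin]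
    induction (comul d : D ⊗[k] D) using TensorProduct.induction_on with
    | zero => simp
    | add a b ha hb => simp only [map_add, TensorProduct.tmul_add, ha, hb]
    | tmul y d => simp [twistAt_tmul]

/-- The endomorphism `x ⊗ y ↦ ∑ σ(x ⊗ y₁) ⊗ y₀` of `V ⊗ W`. -/
def averaging (W : Comodule k D) : V.carrier ⊗[k] W.carrier →ₗ[k] V.carrier ⊗[k] W.carrier :=
  (fromCofreeLin V σ).rTensor W.carrier ∘ₗ
    (TensorProduct.rightComm k V.carrier W.carrier D).toLinearMap ∘ₗ actR V.carrier W.coact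

theorem averaging_tmul (W : Comodule k D) (x : V.carrier) (y : W.carrier) :
    averaging σ W (x ⊗ₜ y) = twistAt σ x W.carrier (W.coact y) := by
  simp only [averaging, LinearMap.comp_apply, actR_tmul]
  induction W.coact y using TensorProduct.induction_on with
  | zero => simp
  | add a b ha hb => simp only [map_add, ha, hb]
  | tmul y d => simp [twistAt_tmul]

/-- Write the image of `x ⊗ y` as `∑ σ(x ⊗ y₁) ⊗ y₀`. Colinearity of `σ` turns the coaction of `V`
into comultiplication of `y₁`, while the coaction of `W` acts on `y₀`. By coassociativity both coact
twice on `y`, with the two `D`-legs exchanged, and cocommutativity removes the exchange. -/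
theorem averaging_eq (W : Comodule k D) (t : V.carrier ⊗[k] W.carrier) :
    actL V.coact W.carrier (averaging σ W t) = actR V.carrier W.coact (averaging σ W t) := by
  induction t using TensorProduct.induction_on with
  | zero => simp
  | add a b ha hb => simp only [map_add, ha, hb]
  | tmul x y =>
    rw [averaging_tmul, actL_twistAt, actR_twistAt, coact_cocomm, ← coassoc_apply,
      LinearEquiv.symm_apply_apply]

/-- On the cotensor product the coaction of `W` may be traded for that of `V`, which `σ` undoes. -/
theorem averaging_incl (hσ : coactHom V ≫ σ = 𝟙 V) (W : Comodule k D) (t : (tens V W).carrier) :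
    averaging σ W (incl V W t) = incl V W t := by
  have h1 : fromCofreeLin V σ ∘ₗ V.coact = LinearMap.id := congrArg Hom.lin hσ
  rw [averaging, LinearMap.comp_apply, LinearMap.comp_apply, ← incl_eq]
  generalize incl V W t = s
  have h2 : (TensorProduct.rightComm k V.carrier W.carrier D).toLinearMap
      (actL V.coact W.carrier s) = V.coact.rTensor W.carrier s :=
    (TensorProduct.rightComm k V.carrier D W.carrier).symm_apply_apply _
  rw [h2, ← LinearMap.rTensor_comp_apply, h1, LinearMap.rTensor_id]
  rfl

theorem averaging_lTensor {W W' : Comodule k D} (b : W ⟶ W') (t : V.carrier ⊗[k] W.carrier) :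
    averaging σ W' (b.lin.lTensor V.carrier t) = b.lin.lTensor V.carrier (averaging σ W t) := by
  induction t using TensorProduct.induction_on with
  | zero => simp
  | add a b ha hb => simp only [map_add, ha, hb]
  | tmul x y =>
    rw [LinearMap.lTensor_tmul, averaging_tmul, averaging_tmul, ← hom_comm_apply]
    induction W.coact y using TensorProduct.induction_on with
    | zero => simp
    | add a b ha hb => simp only [map_add, ha, hb]
    | tmul y d => simp [twistAt_tmul]

/-- The retraction of `V ⊗ W` onto `V ⊗^D W` induced by a retraction of the coaction of `V`. -/
def averagingRetract : forgetMod ⋙ tensorLeft (forgetMod.obj V) ⟶ tensorLeft V ⋙ forgetMod where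
  app W := ModuleCat.ofHom (cotLift (CoalgHom.id k D) (averaging σ W)
    (fun t => (averaging_eq σ W t).trans (lTensor_id_coe _ _).symm))
  naturality _ W' b := ModuleCat.hom_ext (LinearMap.ext fun t =>
    incl_injective V W' (averaging_lTensor σ b t))

variable (V) in
/-- The inclusions `V ⊗^D W → V ⊗ W`. -/
def inclNat : tensorLeft V ⋙ forgetMod ⟶ forgetMod ⋙ tensorLeft (forgetMod.obj V) where
  app W := ι V W
  naturality _ _ b := map_whiskerLeft_ι V b

theorem inclNat_averagingRetract (hσ : coactHom V ≫ σ = 𝟙 V) :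
    inclNat V ≫ averagingRetract σ = 𝟙 _ := by
  ext W : 2
  exact ModuleCat.hom_ext (LinearMap.ext fun t => incl_injective V W (averaging_incl σ hσ W t))

instance forgetMod_isLeftAdjoint : (forgetMod (k := k) (D := D)).IsLeftAdjoint :=
  (cofreeAdj k D).isLeftAdjoint

/-- Adjoint triangle over the cofree comodule adjunction. Its unit is the coaction, a split and
hence regular mono by cosemisimplicity. -/
theorem isLeftAdjoint_of_comp_forgetMod (hD : IsCosemisimple k D) {𝒞 : Type*} [Category* 𝒞]
    [HasEqualizers 𝒞] (F : 𝒞 ⥤ Comodule k D) [(F ⋙ forgetMod).IsLeftAdjoint] :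
    F.IsLeftAdjoint := by
  refine isLeftAdjoint_triangle_lift F (cofreeAdj k D) (fun V => ?_)
  have : IsSplitMono ((cofreeAdj k D).unit.app V) := isSplitMono hD _ (coact_injective V)
  exact RegularMono.ofIsSplitMono _

/-- After forgetting to vector spaces, `averagingRetract` makes the cotensor product a natural
retract of the ordinary tensor product with `V`, which is a left adjoint. -/
theorem tensorLeft_isLeftAdjoint (hD : IsCosemisimple k D) (V : Comodule k D) :
    (tensorLeft V).IsLeftAdjoint := by
  obtain ⟨σ, hσ⟩ := exists_retraction hD (coactHom V) (coact_injective V)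
  have : (tensorLeft V ⋙ forgetMod).IsLeftAdjoint :=
    isLeftAdjoint_of_retract _ _ (inclNat_averagingRetract σ hσ)
  exact isLeftAdjoint_of_comp_forgetMod hD _

/-- Comodules over a cosemisimple cocommutative coalgebra form a closed category. -/
abbrev monoidalClosed (hD : IsCosemisimple k D) : MonoidalClosed (Comodule k D) where
  closed V :=
    have := tensorLeft_isLeftAdjoint hD V
    { rightAdj := (tensorLeft V).rightAdjoint
      adj := Adjunction.ofIsLeftAdjoint _ }

end Closed

end Comodule

/-! ### The right adjoint of `U^D`. -/

section ForgetU

variable {k : Type u} [Field k]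

/-- Forgetting the coaction on `U^D` leaves the underlying space of a coalgebra over `D`. That
functor is the composite of two left adjoints: the slice projection, whose right adjoint is the
product with `D`, and the forgetful functor of coalgebras. -/
theorem forgetU_isLeftAdjoint [HasPullbacks (CocommCoalg k)] (D : CocommCoalg k)
    (hD : IsCosemisimple k D.obj) : (forgetU D).IsLeftAdjoint := by
  have h1 : (Over.forget D).IsLeftAdjoint := (Over.forgetAdjStar D).isLeftAdjoint
  have h2 : (Over.forget D ⋙ forgetVec k).IsLeftAdjoint := inferInstance
  have h3 : (forgetU D ⋙ Comodule.forgetMod).IsLeftAdjoint := h2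
  have : HasBinaryProducts (Over D) := Over.ConstructProducts.over_binaryProduct_of_pullback
  have : HasEqualizers (Over D) := inferInstance
  exact Comodule.isLeftAdjoint_of_comp_forgetMod hD _

end ForgetU

/-! ### Tensor products of irreducible families of commuting operators. -/

section TensorOperators

variable {k : Type u} [Field k] {X Y : Type u}

/-- Finite domains over `k` are finite field extensions. As `k` is perfect, `L'` is separable, so
the tensor product is unramified over `L`, hence reduced; being also Artinian, it is semisimple. -/
theorem isSemisimpleRing_tensorProduct [PerfectField k] (L L' : Type u) [CommRing L] [CommRing L']
    [Algebra k L] [Algebra k L'] [IsDomain L] [IsDomain L'] [Module.Finite k L]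
    [Module.Finite k L'] : IsSemisimpleRing (L ⊗[k] L') := by
  have : IsArtinianRing L := IsArtinianRing.of_finite k L
  have : IsArtinianRing L' := IsArtinianRing.of_finite k L'
  let : Field L := (IsArtinianRing.isField_of_isDomain L).toField
  let : Field L' := (IsArtinianRing.isField_of_isDomain L').toField
  have : Algebra.FormallyUnramified k L' := .of_isSeparable _ _
  have : Algebra.FormallyUnramified L (L ⊗[k] L') := inferInstance
  have : IsReduced (L ⊗[k] L') := Algebra.FormallyUnramified.isReduced_of_field L _
  have : IsArtinianRing (L ⊗[k] L') := IsArtinianRing.of_finite L _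
  exact IsArtinianRing.isSemisimpleRing_of_isReduced _

/-- Subspaces stable under multiplication by algebra generators are ideals, so the two submodule
lattices coincide and one is complemented when the other is. -/
theorem isSemisimpleModule_mulLeft {R : Type u} [CommRing R] [Algebra k R] [IsSemisimpleRing R]
    (g : X → R) (hg : Algebra.adjoin k (Set.range g) = ⊤) :
    IsSemisimpleModule (FreeAlgebra k X) (OpMod (fun x => LinearMap.mulLeft k (g x))) := by
  let op : X → Module.End k R := fun x => LinearMap.mulLeft k (g x)
  have hst : ∀ T : Submodule k R, (∀ x, ∀ m ∈ T, op x m ∈ T) → ∀ r : R, ∀ m ∈ T, r * m ∈ T := by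
    intro T hT r
    have hr : r ∈ Algebra.adjoin k (Set.range g) := hg ▸ Algebra.mem_top
    induction hr using Algebra.adjoin_induction with
    | mem x hx =>
      obtain ⟨x, rfl⟩ := hx
      exact hT x
    | algebraMap c =>
      intro m hm
      rw [← Algebra.smul_def]
      exact T.smul_mem c hm
    | add a b _ _ ha hb =>
      intro m hm
      rw [add_mul]
      exact T.add_mem (ha m hm) (hb m hm)
    | mul a b _ _ ha hb =>
      intro m hm
      rw [mul_assoc]
      exact ha _ (hb m hm)
  let e : Submodule R R ≃o Submodule (FreeAlgebra k X) (OpMod op) :=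
    { toFun I := OpMod.ofStable op (I.restrictScalars k) (fun x m hm => I.smul_mem (g x) hm)
      invFun N :=
        { (OpMod.toSub op N) with
          smul_mem' := fun r m hm => hst _ (OpMod.toSub_stable op N) r m hm }
      left_inv I := rfl
      right_inv N := rfl
      map_rel_iff' := Iff.rfl }
  have h : ComplementedLattice (Submodule R R) := (isSemisimpleModule_iff R R).mp inferInstance
  exact (isSemisimpleModule_iff _ _).mpr (e.complementedLattice_iff.mp h)

/-- No proper nonzero subspace is stable under the operators. -/
def IsIrreducible {S : Type u} [AddCommGroup S] [Module k S] (op : X → Module.End k S) : Prop :=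
  ∀ T : Submodule k S, (∀ x, ∀ m ∈ T, op x m ∈ T) → T = ⊥ ∨ T = ⊤

/-- The algebra generated by commuting operators is commutative. -/
abbrev adjoinCommRing {S : Type u} [AddCommGroup S] [Module k S] (op : X → Module.End k S)
    (hc : ∀ x y, Commute (op x) (op y)) : CommRing (Algebra.adjoin k (Set.range op)) :=
  { (inferInstance : Ring (Algebra.adjoin k (Set.range op))) with
    mul_comm := (Algebra.isMulCommutative_adjoin k
      (by rintro _ ⟨x, rfl⟩ _ ⟨y, rfl⟩; exact hc x y)).is_comm.comm }

namespace IsIrreducible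

variable {S : Type u} [AddCommGroup S] [Module k S] {op : X → Module.End k S}
  (hs : IsIrreducible op)

-- The vectors reached from `v` form a stable subspace containing `v`, so by irreducibility they are
-- everything.
include hs in
theorem exists_adjoin_apply (v : S) (hv : v ≠ 0) (s : S) :
    ∃ a : Algebra.adjoin k (Set.range op), (a : Module.End k S) v = s := by
  let ev : Algebra.adjoin k (Set.range op) →ₗ[k] S :=
    LinearMap.applyₗ v ∘ₗ (Algebra.adjoin k (Set.range op)).val.toLinearMap
  rcases hs (LinearMap.range ev) (by
    rintro x _ ⟨a, rfl⟩
    exact ⟨⟨op x, Algebra.subset_adjoin ⟨x, rfl⟩⟩ * a, rfl⟩) with h | h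
  · refine absurd ?_ hv
    have : v ∈ LinearMap.range ev := ⟨1, rfl⟩
    rw [h] at this
    exact this
  · exact (h ▸ Submodule.mem_top : s ∈ LinearMap.range ev)

-- Schur's lemma: by commutativity the kernel of a nonzero element is stable, hence zero, so nonzero
-- elements act injectively.
include hs in
theorem adjoin_isDomain [Nontrivial S] (hc : ∀ x y, Commute (op x) (op y)) :
    letI := adjoinCommRing op hc
    IsDomain (Algebra.adjoin k (Set.range op)) := by
  let := adjoinCommRing op hc
  have hinj : ∀ a : Algebra.adjoin k (Set.range op), a ≠ 0 →
      ∀ m, (a : Module.End k S) m = 0 → m = 0 := by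
    intro a ha
    rcases hs (LinearMap.ker (a : Module.End k S)) (by
      intro x m hm
      have h : a * ⟨op x, Algebra.subset_adjoin ⟨x, rfl⟩⟩ =
        ⟨op x, Algebra.subset_adjoin ⟨x, rfl⟩⟩ * a := mul_comm _ _
      have h' := LinearMap.congr_fun (congrArg Subtype.val h) m
      refine h'.trans ?_
      exact (congrArg (op x) hm).trans (map_zero _)) with h | h
    · intro m hm
      have : m ∈ LinearMap.ker (a : Module.End k S) := hm
      rw [h] at this
      exact this
    · refine absurd (Subtype.ext (LinearMap.ker_eq_top.mp h)) ha
  have : Nontrivial (Algebra.adjoin k (Set.range op)) := inferInstance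
  have : NoZeroDivisors (Algebra.adjoin k (Set.range op)) := ⟨by
    intro a b hab
    by_contra hne
    rw [not_or] at hne
    obtain ⟨m, hm⟩ := exists_ne (0 : S)
    refine hm (hinj b hne.2 m (hinj a hne.1 _ ?_))
    exact LinearMap.congr_fun (congrArg Subtype.val hab) m⟩
  exact NoZeroDivisors.to_isDomain _

end IsIrreducible

/-- The operators on a tensor product given by operators on the factors. -/
def tensorOp {S T : Type u} [AddCommGroup S] [Module k S] [AddCommGroup T] [Module k T]
    (op : X → Module.End k S) (op' : Y → Module.End k T) : X ⊕ Y → Module.End k (S ⊗[k] T) :=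
  Sum.elim (fun x => (op x).rTensor T) (fun y => (op' y).lTensor S)

/-- Let `A` and `A'` be the algebras generated by the operators; they are finite domains. Acting on
a tensor of nonzero vectors exhibits `S ⊗ T` as a quotient of the semisimple ring `A ⊗ A'`. -/
theorem isSemisimpleModule_tensorOp [PerfectField k] {S T : Type u} [AddCommGroup S] [Module k S]
    [AddCommGroup T] [Module k T] [Nontrivial S] [Nontrivial T] [Module.Finite k S]
    [Module.Finite k T] {op : X → Module.End k S} {op' : Y → Module.End k T}
    (hs : IsIrreducible op) (hs' : IsIrreducible op') (hc : ∀ x y, Commute (op x) (op y))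
    (hc' : ∀ x y, Commute (op' x) (op' y)) :
    IsSemisimpleModule (FreeAlgebra k (X ⊕ Y)) (OpMod (tensorOp op op')) := by
  let A := Algebra.adjoin k (Set.range op)
  let A' := Algebra.adjoin k (Set.range op')
  let : CommRing A := adjoinCommRing op hc
  let : CommRing A' := adjoinCommRing op' hc'
  have : IsDomain A := hs.adjoin_isDomain hc
  have : IsDomain A' := hs'.adjoin_isDomain hc'
  have : Module.Finite k A := Module.Finite.of_injective A.val.toLinearMap Subtype.val_injective
  have : Module.Finite k A' := Module.Finite.of_injective A'.val.toLinearMap Subtype.val_injective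
  have : IsSemisimpleRing (A ⊗[k] A') := isSemisimpleRing_tensorProduct A A'
  let gA : X → A := fun x => ⟨op x, Algebra.subset_adjoin ⟨x, rfl⟩⟩
  let gA' : Y → A' := fun y => ⟨op' y, Algebra.subset_adjoin ⟨y, rfl⟩⟩
  let g : X ⊕ Y → A ⊗[k] A' := Sum.elim (fun x => gA x ⊗ₜ 1) (fun y => 1 ⊗ₜ gA' y)
  have hg : Algebra.adjoin k (Set.range g) = ⊤ := by
    have h1 : (⊤ : Subalgebra k A) ≤
        (Algebra.adjoin k (Set.range g)).comap Algebra.TensorProduct.includeLeft := by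
      rw [← Algebra.adjoin_adjoin_coe_preimage, Algebra.adjoin_le_iff]
      rintro ⟨_, _⟩ ⟨x, rfl⟩
      exact Algebra.subset_adjoin ⟨Sum.inl x, rfl⟩
    have h2 : (⊤ : Subalgebra k A') ≤
        (Algebra.adjoin k (Set.range g)).comap Algebra.TensorProduct.includeRight := by
      rw [← Algebra.adjoin_adjoin_coe_preimage, Algebra.adjoin_le_iff]
      rintro ⟨_, _⟩ ⟨x, rfl⟩
      exact Algebra.subset_adjoin ⟨Sum.inr x, rfl⟩
    rw [eq_top_iff]
    intro t _
    induction t using TensorProduct.induction_on with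
    | zero => exact zero_mem _
    | add a b ha hb => exact add_mem (ha trivial) (hb trivial)
    | tmul a b =>
      have h3 : a ⊗ₜ[k] b = (a ⊗ₜ 1) * (1 ⊗ₜ b) := by simp
      rw [h3]
      exact mul_mem (h1 (Algebra.mem_top (x := a))) (h2 (Algebra.mem_top (x := b)))
  have hR := isSemisimpleModule_mulLeft g hg
  obtain ⟨v, hv⟩ := exists_ne (0 : S)
  obtain ⟨w, hw⟩ := exists_ne (0 : T)
  let ev : A →ₗ[k] S := LinearMap.applyₗ v ∘ₗ A.val.toLinearMap
  let ev' : A' →ₗ[k] T := LinearMap.applyₗ w ∘ₗ A'.val.toLinearMap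
  have hev : Function.Surjective ev := hs.exists_adjoin_apply v hv
  have hev' : Function.Surjective ev' := hs'.exists_adjoin_apply w hw
  have hF : ∀ x m, TensorProduct.map ev ev' (LinearMap.mulLeft k (g x) m) =
      tensorOp op op' x (TensorProduct.map ev ev' m) := ?_
  · exact IsSemisimpleModule.of_surjective (OpMod.homMk _ hF)
      (TensorProduct.map_surjective hev hev')
  intro x m
  induction m using TensorProduct.induction_on with
  | zero => simp only [map_zero]
  | add a b ha hb => simp only [map_add, ha, hb]
  | tmul a b =>
    rcases x with x | y
    · change TensorProduct.map ev ev' ((gA x ⊗ₜ 1) * (a ⊗ₜ b)) = (op x (ev a)) ⊗ₜ (ev' b)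
      rw [Algebra.TensorProduct.tmul_mul_tmul, one_mul]
      rfl
    · change TensorProduct.map ev ev' ((1 ⊗ₜ gA' y) * (a ⊗ₜ b)) = (ev a) ⊗ₜ (op' y (ev' b))
      rw [Algebra.TensorProduct.tmul_mul_tmul, one_mul]
      rfl

end TensorOperators

/-! ### Cosemisimplicity of tensor powers. -/

section PerfectFields

variable {k : Type u} [Field k]

/-- The contraction `m ⊗ d ↦ f(d) m`. -/
def contract (M : Type u) [AddCommGroup M] [Module k M] {D : Type u} [AddCommGroup D] [Module k D]
    (f : D →ₗ[k] k) : M ⊗[k] D →ₗ[k] M :=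
  (TensorProduct.rid k M).toLinearMap ∘ₗ f.lTensor M

section Contract

variable {M : Type u} [AddCommGroup M] [Module k M] {N : Type u} [AddCommGroup N] [Module k N]
  {D : Type u} [AddCommGroup D] [Module k D]

@[simp] theorem contract_tmul (f : D →ₗ[k] k) (m : M) (d : D) :
    contract M f (m ⊗ₜ d) = f d • m := by
  simp [contract]

theorem contract_rTensor (f : D →ₗ[k] k) (g : M →ₗ[k] N) (t : M ⊗[k] D) :
    contract N f (g.rTensor D t) = g (contract M f t) := by
  induction t using TensorProduct.induction_on with
  | zero => simp
  | add a b ha hb => simp only [map_add, ha, hb]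
  | tmul x y => simp

theorem contract_contract (f g : D →ₗ[k] k) (t : (M ⊗[k] D) ⊗[k] D) :
    contract M f (contract (M ⊗[k] D) g (TensorProduct.rightComm k M D D t)) =
      contract M g (contract (M ⊗[k] D) f t) := by
  induction t using TensorProduct.induction_on with
  | zero => simp
  | add a b ha hb => simp only [map_add, ha, hb]
  | tmul x y =>
    induction x using TensorProduct.induction_on with
    | zero => simp
    | add a b ha hb => simp only [map_add, TensorProduct.add_tmul, ha, hb]
    | tmul a b => simp [smul_smul, mul_comm]

theorem contract_assoc_symm (f g : D →ₗ[k] k) (c : D →ₗ[k] D ⊗[k] D) (t : M ⊗[k] D) :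
    contract M f (contract (M ⊗[k] D) g ((TensorProduct.assoc k M D D).symm (c.lTensor M t))) =
      contract M (pairing f g ∘ₗ c) t := by
  induction t using TensorProduct.induction_on with
  | zero => simp
  | add a b ha hb => simp only [map_add, ha, hb]
  | tmul x y =>
    simp only [LinearMap.lTensor_tmul, contract_tmul, LinearMap.comp_apply]
    induction c y using TensorProduct.induction_on with
    | zero => simp
    | add a b ha hb => simp only [map_add, TensorProduct.tmul_add, ha, hb, add_smul]
    | tmul a b => simp [smul_smul, mul_comm]

end Contract

section RegularOp

variable {D : Type u} [AddCommGroup D] [Module k D] [Coalgebra k D]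

theorem regularOp_apply (f : D →ₗ[k] k) (x : D) : regularOp k D f x = contract D f (comul x) := rfl

theorem regularOp_counit : regularOp k D counit = LinearMap.id := by
  ext x
  exact Comodule.counit_coact_apply (Comodule.regular k D) x

/-- By coassociativity the operators compose by convolution of functionals, so the orbit of an
element is stable. -/
theorem regularOp_regularOp (f g : D →ₗ[k] k) (x : D) :
    regularOp k D f (regularOp k D g x) = regularOp k D (pairing f g ∘ₗ comul) x := by
  rw [regularOp_apply, regularOp_apply, regularOp_apply, ← contract_rTensor,
    ← contract_assoc_symm]
  congr 2
  exact (TensorProduct.assoc k D D D).eq_symm_apply.mpr (Coalgebra.coassoc_apply x)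

theorem regularOp_commute [IsCocomm k D] (f g : D →ₗ[k] k) :
    Commute (regularOp k D f) (regularOp k D g) := by
  ext x
  change regularOp k D f (regularOp k D g x) = regularOp k D g (regularOp k D f x)
  rw [regularOp_apply, regularOp_apply, regularOp_apply, regularOp_apply, ← contract_rTensor f,
    ← contract_rTensor g, ← contract_contract]
  congr 2
  exact Comodule.coact_cocomm (Comodule.regular k D) x

/-- The orbit `{f ⇀ x}` of an element. -/
def orbit (x : D) : Submodule k D :=
  LinearMap.range ({ toFun := fun f => regularOp k D f x
                     map_add' := fun f g => by simp [regularOp_apply, contract, LinearMap.lTensor_add]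
                     map_smul' := fun c f => by
                      simp [regularOp_apply, contract, LinearMap.lTensor_smul] } :
    (D →ₗ[k] k) →ₗ[k] D)

theorem mem_orbit (x : D) : x ∈ orbit (k := k) x :=
  ⟨counit, LinearMap.congr_fun regularOp_counit x⟩

theorem orbit_stable (x : D) (f : D →ₗ[k] k) (y : D) (hy : y ∈ orbit (k := k) x) :
    regularOp k D f y ∈ orbit (k := k) x := by
  obtain ⟨g, rfl⟩ := hy
  exact ⟨_, (regularOp_regularOp f g x).symm⟩

/-- Write the coproduct of `x` as a finite sum of pure tensors; the orbit lies in the span of their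
first legs. -/
theorem orbit_finite (x : D) : Module.Finite k (orbit (k := k) x) := by
  obtain ⟨s, hs⟩ := TensorProduct.exists_finset (R := k) (comul x : D ⊗[k] D)
  have hle : orbit (k := k) x ≤ Submodule.span k (Prod.fst '' (s : Set (D × D))) := by
    rintro _ ⟨f, rfl⟩
    change contract D f (comul x) ∈ _
    rw [hs, map_sum]
    refine Submodule.sum_mem _ fun i hi => ?_
    rw [contract_tmul]
    exact Submodule.smul_mem _ _ (Submodule.subset_span ⟨i, hi, rfl⟩)
  have : Module.Finite k (Submodule.span k (Prod.fst '' (s : Set (D × D)))) :=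
    Module.Finite.span_of_finite k (Set.Finite.image _ s.finite_toSet)
  exact Submodule.finiteDimensional_of_le hle

variable [IsCocomm k D] {S : Submodule k D} (hS : IsSimpleSubcoalgebra S)

/-- The operators on a subcoalgebra. -/
def subOp (S : Submodule k D) (hS : IsSubcoalgebra S) (f : D →ₗ[k] k) : Module.End k S :=
  (regularOp k D f).restrict (fun m hm => (isSubcoalgebra_iff_actOp_mem S).mp hS f m hm)

theorem subOp_commute (hS : IsSubcoalgebra S) (f g : D →ₗ[k] k) :
    Commute (subOp S hS f) (subOp S hS g) := by
  ext m
  exact LinearMap.congr_fun (regularOp_commute f g) (m : D)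

include hS in
theorem IsSimpleSubcoalgebra.isIrreducible : IsIrreducible (subOp S hS.1) := by
  intro T hT
  rcases hS.2.2 (T.map S.subtype) ((isSubcoalgebra_iff_actOp_mem _).mpr (by
    rintro f _ ⟨m, hm, rfl⟩
    exact ⟨_, hT f m hm, rfl⟩)) (Submodule.map_subtype_le S T) with h | h
  · left
    rw [eq_bot_iff]
    intro m hm
    have : (m : D) ∈ T.map S.subtype := ⟨m, hm, rfl⟩
    rw [h] at this
    exact Subtype.ext this
  · right
    rw [eq_top_iff]
    intro m _
    have : (m : D) ∈ T.map S.subtype := by rw [h]; exact m.2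
    obtain ⟨m', hm', h'⟩ := this
    rwa [← Subtype.ext h']

include hS in
theorem IsSimpleSubcoalgebra.nontrivial : Nontrivial S := Submodule.nontrivial_iff_ne_bot.mpr hS.2.1

-- The orbit of a nonzero element is a finite-dimensional nonzero subcoalgebra contained in `S`, so
-- it is `S`.
include hS in
theorem IsSimpleSubcoalgebra.finite : Module.Finite k S := by
  obtain ⟨x, hx, h0⟩ := Submodule.exists_mem_ne_zero_of_ne_bot hS.2.1
  have hle : orbit (k := k) x ≤ S := by
    rintro _ ⟨f, rfl⟩
    exact (isSubcoalgebra_iff_actOp_mem S).mp hS.1 f x hx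
  rcases hS.2.2 _ ((isSubcoalgebra_iff_actOp_mem _).mpr (orbit_stable x)) hle with h | h
  · have := mem_orbit (k := k) x
    rw [h] at this
    exact absurd this h0
  · rw [← h]
    exact orbit_finite x

end RegularOp

variable {D C : Type u} [AddCommGroup D] [Module k D] [Coalgebra k D] [IsCocomm k D]
  [AddCommGroup C] [Module k C] [Coalgebra k C] [IsCocomm k C]

theorem regularOp_pairing (f : D →ₗ[k] k) (g : C →ₗ[k] k) :
    regularOp k (D ⊗[k] C) (pairing f g) =
      TensorProduct.map (regularOp k D f) (regularOp k C g) := by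
  apply TensorProduct.ext'
  intro x y
  rw [regularOp_apply, TensorProduct.comul_tmul, TensorProduct.map_tmul, regularOp_apply,
    regularOp_apply]
  generalize (comul x : D ⊗[k] D) = s
  generalize (comul y : C ⊗[k] C) = r
  induction s using TensorProduct.induction_on with
  | zero => simp
  | add a b ha hb => simp only [map_add, TensorProduct.add_tmul, ha, hb]
  | tmul a b =>
    induction r using TensorProduct.induction_on with
    | zero => simp
    | add a b ha hb => simp only [map_add, TensorProduct.tmul_add, ha, hb]
    | tmul c d => simp [TensorProduct.smul_tmul', TensorProduct.tmul_smul, smul_smul, mul_comm]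

/-- Not every functional on `D ⊗ C` comes from a finite sum of products `f ⊗ g`, but these products
separate points, and the operator of `f ⊗ g` is the composite of the operators of its factors. -/
theorem isSubcoalgebra_iff_tensorOp_mem (T : Submodule k (D ⊗[k] C)) :
    IsSubcoalgebra T ↔ ∀ x, ∀ m ∈ T, tensorOp (regularOp k D) (regularOp k C) x m ∈ T := by
  constructor
  · intro h x m hm
    rw [isSubcoalgebra_iff_actOp_mem] at h
    rcases x with f | g
    · have h1 := h (pairing f counit) m hm
      rw [regularOp_pairing, regularOp_counit] at h1
      exact h1
    · have h1 := h (pairing counit g) m hm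
      rw [regularOp_pairing, regularOp_counit] at h1
      exact h1
  · intro h
    refine isSubcoalgebra_of_mem_range T fun x hx => ?_
    refine mem_range_rTensor_subtype
      (fun p : (D →ₗ[k] k) × (C →ₗ[k] k) => pairing p.1 p.2) (fun y hy => ?_) T _ (fun p => ?_)
    · exact eq_zero_of_forall_pairing (fun f : D →ₗ[k] k => f) (fun f : C →ₗ[k] k => f)
        (fun y => (Module.forall_dual_apply_eq_zero_iff k y).mp)
        (fun y => (Module.forall_dual_apply_eq_zero_iff k y).mp) y (fun f g => hy (f, g))
    · have h1 := LinearMap.congr_fun (regularOp_pairing p.1 p.2) x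
      refine (show _ = _ from h1) ▸ ?_
      rw [← LinearMap.lTensor_comp_rTensor]
      exact h (Sum.inr p.2) _ (h (Sum.inl p.1) _ hx)

/-- Over a perfect field, tensor products of cocommutative cosemisimple coalgebras are
cosemisimple. -/
theorem IsCosemisimple.tensorProduct [PerfectField k] (hD : IsCosemisimple k D)
    (hC : IsCosemisimple k C) : IsCosemisimple k (D ⊗[k] C) := by
  rw [isCosemisimple_iff_isSemisimpleModule _ isSubcoalgebra_iff_tensorOp_mem]
  obtain ⟨ι, _, S, hS, hInt⟩ := hD
  obtain ⟨ι', _, S', hS', hInt'⟩ := hC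
  have hss : ∀ i j, IsSemisimpleModule (FreeAlgebra k ((D →ₗ[k] k) ⊕ (C →ₗ[k] k)))
      (OpMod (tensorOp (subOp (S i) (hS i).1) (subOp (S' j) (hS' j).1))) := by
    intro i j
    have := (hS i).finite
    have := (hS' j).finite
    have := (hS i).nontrivial
    have := (hS' j).nontrivial
    exact isSemisimpleModule_tensorOp (hS i).isIrreducible (hS' j).isIrreducible
      (subOp_commute _) (subOp_commute _)
  let F : ∀ p : ι × ι', OpMod (tensorOp (subOp (S p.1) (hS p.1).1) (subOp (S' p.2) (hS' p.2).1))
      →ₗ[FreeAlgebra k ((D →ₗ[k] k) ⊕ (C →ₗ[k] k))]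
      OpMod (tensorOp (regularOp k D) (regularOp k C)) := fun p =>
    OpMod.homMk (TensorProduct.map (S p.1).subtype (S' p.2).subtype) (by
      intro x m
      induction m using TensorProduct.induction_on with
      | zero => simp only [map_zero]
      | add a b ha hb => simp only [map_add, ha, hb]
      | tmul a b => rcases x with x | x <;> rfl)
  -- `D ⊗ C` is the sum of the images of the `S i ⊗ S' j`. These are semisimple but need not be
  -- simple.
  refine isSemisimpleModule_of_isSemisimpleModule_submodule' (p := fun p => LinearMap.range (F p))
    (fun p => have := hss p.1 p.2; IsSemisimpleModule.range _) ?_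
  rw [eq_top_iff]
  intro t _
  let N := OpMod.toSub (tensorOp (regularOp k D) (regularOp k C)) (⨆ p, LinearMap.range (F p))
  have hxy : ∀ (x : D) (y : C), x ⊗ₜ[k] y ∈ N := by
    intro x y
    have hx : x ∈ ⨆ i, S i := by rw [hInt.submodule_iSup_eq_top]; trivial
    have hy : y ∈ ⨆ i, S' i := by rw [hInt'.submodule_iSup_eq_top]; trivial
    induction hx using Submodule.iSup_induction' with
    | zero => rw [TensorProduct.zero_tmul]; exact zero_mem _
    | add a b _ _ ha hb => rw [TensorProduct.add_tmul]; exact add_mem ha hb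
    | mem i x hx =>
      induction hy using Submodule.iSup_induction' with
      | zero => rw [TensorProduct.tmul_zero]; exact zero_mem _
      | add a b _ _ ha hb => rw [TensorProduct.tmul_add]; exact add_mem ha hb
      | mem j y hy =>
        exact (le_iSup (fun p => LinearMap.range (F p)) (i, j) :
          LinearMap.range (F (i, j)) ≤ _) ⟨(⟨x, hx⟩ : S i) ⊗ₜ (⟨y, hy⟩ : S' j), rfl⟩
  have ht : ∀ t : D ⊗[k] C, t ∈ N := by
    intro t
    induction t using TensorProduct.induction_on with
    | zero => exact zero_mem _
    | add a b ha hb => exact add_mem ha hb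
    | tmul a b => exact hxy a b
  exact ht t

variable (k) in
theorem isCosemisimple_self : IsCosemisimple k k := by
  have hsub : ∀ T : Submodule k k, T = ⊥ ∨ T = ⊤ := fun T => eq_bot_or_eq_top T
  refine ⟨PUnit, inferInstance, fun _ => ⊤, fun _ => ⟨?_, top_ne_bot, fun T _ _ => hsub T⟩, ?_⟩
  · rw [isSubcoalgebra_iff_actOp_mem]
    intros
    trivial
  · refine DirectSum.isInternal_submodule_of_iSupIndep_of_iSup_eq_top ?_ (iSup_const)
    exact fun i => by simp [Subsingleton.elim _ i]

theorem isCosemisimple_tensorPow (C : CocommCoalg k) (hC : IsCosemisimple k C.obj)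
    (hk : PerfectField k ∨ ∀ n : ℕ, IsCosemisimple k (tensorPow C n).obj) :
    ∀ n, IsCosemisimple k (tensorPow C n).obj := by
  rcases hk with hk | hk
  · intro n
    induction n using Nat.twoStepInduction with
    | zero => exact isCosemisimple_self k
    | one => exact hC
    | more n _ ih => exact ih.tensorProduct hC
  · exact hk

end PerfectFields

/-! ### The projection formula and strong monoidality of a right adjoint. -/

section ProjectionFormula

open Functor.LaxMonoidal Functor.OplaxMonoidal

variable {𝒜 : Type*} [Category* 𝒜] [MonoidalCategory 𝒜] {ℬ : Type*} [Category* ℬ]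
  [MonoidalCategory ℬ] {F : 𝒜 ⥤ ℬ} {K : ℬ ⥤ 𝒜} (adj : F ⊣ K) [F.OplaxMonoidal]

/-- The projection morphism `F(X ⊗ KV) ⟶ FX ⊗ V` of an adjunction with oplax left adjoint. -/
def projHom (X : 𝒜) (V : ℬ) : F.obj (X ⊗ K.obj V) ⟶ F.obj X ⊗ V :=
  δ F X (K.obj V) ≫ F.obj X ◁ adj.counit.app V

variable [K.LaxMonoidal] [adj.IsMonoidal]

theorem map_whiskerLeft_ε_projHom (X : 𝒜) :
    F.map (X ◁ ε K) ≫ projHom adj X (𝟙_ ℬ) = F.map (ρ_ X).hom ≫ (ρ_ (F.obj X)).inv := by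
  rw [projHom, ← δ_natural_right_assoc, ← MonoidalCategory.whiskerLeft_comp,
    Adjunction.map_ε_comp_counit_app_unit, Functor.OplaxMonoidal.right_unitality,
    Iso.map_hom_inv_id_assoc]

/-- Projecting out `V ⊗ W` amounts to projecting out `W` and then `V`. When all projections are
invertible, so is `F` applied to `X ◁ μ`; for `X` the unit object and `F` reflecting isomorphisms,
`μ` itself is invertible. -/
theorem map_whiskerLeft_μ_projHom (X : 𝒜) (V W : ℬ) :
    F.map (X ◁ μ K V W) ≫ projHom adj X (V ⊗ W) =
      F.map (α_ X (K.obj V) (K.obj W)).inv ≫ projHom adj (X ⊗ K.obj V) W ≫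
        projHom adj X V ▷ W ≫ (α_ _ _ _).hom := by
  have h : projHom adj (X ⊗ K.obj V) W ≫ projHom adj X V ▷ W ≫ (α_ _ _ _).hom =
      F.map (α_ X (K.obj V) (K.obj W)).hom ≫ δ F X (K.obj V ⊗ K.obj W) ≫
        F.obj X ◁ (δ F (K.obj V) (K.obj W) ≫ (adj.counit.app V ⊗ₘ adj.counit.app W)) := by
    simp only [projHom, Category.assoc, MonoidalCategory.comp_whiskerRight,
      MonoidalCategory.whiskerLeft_comp]
    rw [← Functor.OplaxMonoidal.associativity_assoc, MonoidalCategory.whisker_exchange_assoc,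
      MonoidalCategory.whisker_exchange_assoc]
    simp [MonoidalCategory.tensorHom_def]
  rw [h, Iso.map_inv_hom_id_assoc, projHom, ← δ_natural_right_assoc,
    ← MonoidalCategory.whiskerLeft_comp, Adjunction.map_μ_comp_counit_app_tensor]

variable [F.ReflectsIsomorphisms] [∀ X V, IsIso (projHom adj X V)]

include adj in
theorem isIso_of_isIso_map_whiskerLeft_unit {Y Z : 𝒜} (g : Y ⟶ Z) [IsIso (F.map (𝟙_ 𝒜 ◁ g))] :
    IsIso g := by
  have h1 : IsIso (𝟙_ 𝒜 ◁ g) := isIso_of_reflects_iso _ F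
  have h2 : g = (λ_ Y).inv ≫ 𝟙_ 𝒜 ◁ g ≫ (λ_ Z).hom := by simp
  rw [h2]
  infer_instance

include adj in
theorem isIso_ε_of_projHom : IsIso (ε K) := by
  have : IsIso (F.map (𝟙_ 𝒜 ◁ ε K) ≫ projHom adj (𝟙_ 𝒜) (𝟙_ ℬ)) := by
    rw [map_whiskerLeft_ε_projHom]
    infer_instance
  have : IsIso (F.map (𝟙_ 𝒜 ◁ ε K)) := IsIso.of_isIso_comp_right _ (projHom adj (𝟙_ 𝒜) (𝟙_ ℬ))
  exact isIso_of_isIso_map_whiskerLeft_unit adj _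

include adj in
theorem isIso_μ_of_projHom (V W : ℬ) : IsIso (μ K V W) := by
  have : IsIso (F.map (𝟙_ 𝒜 ◁ μ K V W) ≫ projHom adj (𝟙_ 𝒜) (V ⊗ W)) := by
    rw [map_whiskerLeft_μ_projHom]
    infer_instance
  have : IsIso (F.map (𝟙_ 𝒜 ◁ μ K V W)) :=
    IsIso.of_isIso_comp_right _ (projHom adj (𝟙_ 𝒜) (V ⊗ W))
  exact isIso_of_isIso_map_whiskerLeft_unit adj _

end ProjectionFormula

/-! ### The right adjoint of a braided oplax functor is braided. -/

section BraidedAdjoint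

open Functor.LaxMonoidal Functor.OplaxMonoidal

variable {𝒜 : Type*} [Category* 𝒜] [MonoidalCategory 𝒜] [BraidedCategory 𝒜] {ℬ : Type*}
  [Category* ℬ] [MonoidalCategory ℬ] [BraidedCategory ℬ] {F : 𝒜 ⥤ ℬ} {K : ℬ ⥤ 𝒜}
  (adj : F ⊣ K) [F.OplaxMonoidal] [K.LaxMonoidal] [adj.IsMonoidal]

-- Transposed to the left adjoint, the identity becomes compatibility of `δ` with the braiding
-- together with naturality of the braiding at the counit.
include adj in
theorem rightAdjoint_braided (hF : ∀ X Y, F.map (β_ X Y).hom ≫ δ F Y X = δ F X Y ≫ (β_ _ _).hom)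
    (V W : ℬ) :
    μ K V W ≫ K.map (β_ V W).hom = (β_ _ _).hom ≫ μ K W V := by
  apply (adj.homEquiv _ _).symm.injective
  rw [Adjunction.homEquiv_counit, Adjunction.homEquiv_counit, Functor.map_comp, Functor.map_comp,
    Category.assoc, Category.assoc, adj.counit_naturality, adj.map_μ_comp_counit_app_tensor,
    adj.map_μ_comp_counit_app_tensor_assoc, reassoc_of% hF,
    BraidedCategory.braiding_naturality]

end BraidedAdjoint

/-! ### The projection formula and preservation of internal homs. -/

section ProjectionFormulaBraided

open Functor.LaxMonoidal Functor.OplaxMonoidal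

variable {𝒜 : Type*} [Category* 𝒜] [MonoidalCategory 𝒜] [SymmetricCategory 𝒜] {ℬ : Type*}
  [Category* ℬ] [MonoidalCategory ℬ] [SymmetricCategory ℬ] {F : 𝒜 ⥤ ℬ} {K : ℬ ⥤ 𝒜}
  (adj : F ⊣ K) [F.OplaxMonoidal] [K.LaxMonoidal] [adj.IsMonoidal]
  (hF : ∀ X Y, F.map (β_ X Y).hom ≫ δ F Y X = δ F X Y ≫ (β_ _ _).hom)

/-- The projection morphism `F(KV ⊗ X) ⟶ V ⊗ FX`. -/
def projHom' (V : ℬ) (X : 𝒜) : F.obj (K.obj V ⊗ X) ⟶ V ⊗ F.obj X :=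
  δ F (K.obj V) X ≫ adj.counit.app V ▷ F.obj X

include hF in
theorem isIso_projHom' [∀ X V, IsIso (projHom adj X V)] (V : ℬ) (X : 𝒜) :
    IsIso (projHom' adj V X) := by
  have h : projHom' adj V X = F.map (β_ _ _).hom ≫ projHom adj X V ≫ (β_ _ _).hom := by
    rw [projHom', projHom, Category.assoc, BraidedCategory.braiding_naturality_right,
      reassoc_of% hF, SymmetricCategory.symmetry_assoc]
  rw [h]
  infer_instance

variable [MonoidalClosed 𝒜] [MonoidalClosed ℬ]

/-- After transposing along the adjunctions, composition with the closed comparison becomes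
precomposition with the projection `projHom'`. By Yoneda the comparison is then invertible when the
projections are. -/
theorem homEquiv_symm_uncurry_closedComparison (V W : ℬ) {Z : 𝒜}
    (g : Z ⟶ K.obj ((ihom V).obj W)) :
    (adj.homEquiv _ _).symm (MonoidalClosed.uncurry (g ≫ closedComparison K V W)) =
      projHom' adj V Z ≫ MonoidalClosed.uncurry ((adj.homEquiv _ _).symm g) := by
  rw [closedComparison, ← MonoidalClosed.curry_natural_left, MonoidalClosed.uncurry_curry,
    Adjunction.homEquiv_counit, Adjunction.homEquiv_counit, MonoidalClosed.uncurry_eq, projHom']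
  simp only [Functor.map_comp, Category.assoc]
  rw [adj.counit_naturality, adj.map_μ_comp_counit_app_tensor_assoc, ← δ_natural_right_assoc,
    MonoidalCategory.tensorHom_def', MonoidalCategory.whiskerLeft_comp]
  simp only [Category.assoc]
  rw [MonoidalCategory.whisker_exchange_assoc, MonoidalCategory.whisker_exchange_assoc]

include adj hF in
theorem isIso_closedComparison [∀ X V, IsIso (projHom adj X V)] (V W : ℬ) :
    IsIso (closedComparison K V W) := by
  rw [isIso_iff_yoneda_map_bijective]
  intro Z
  have := isIso_projHom' adj hF V Z
  have h : (fun g : Z ⟶ K.obj ((ihom V).obj W) => g ≫ closedComparison K V W) =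
      (fun h => MonoidalClosed.curry (adj.homEquiv _ _ (projHom' adj V Z ≫
        MonoidalClosed.uncurry h))) ∘ (adj.homEquiv _ _).symm := by
    funext g
    simp only [Function.comp_apply]
    rw [← homEquiv_symm_uncurry_closedComparison, Equiv.apply_symm_apply,
      MonoidalClosed.curry_uncurry]
  rw [h]
  refine Function.Bijective.comp ?_ (Equiv.bijective _)
  exact Equiv.bijective (((ihom.adjunction V).homEquiv (F.obj Z) W).symm.trans
    (((asIso (projHom' adj V Z)).homFromEquiv.symm).trans
    ((adj.homEquiv _ _).trans ((ihom.adjunction (K.obj V)).homEquiv Z (K.obj W)))))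

end ProjectionFormulaBraided

/-! ### Corestriction, change of coalgebra and their projection formula. -/

namespace Comodule

variable {k : Type u} [Field k] {D : Type u} [AddCommGroup D] [Module k D] [Coalgebra k D]
  {C : Type u} [AddCommGroup C] [Module k C] [Coalgebra k C]

theorem bijective_of_isIso {V W : Comodule k D} (g : V ⟶ W) [IsIso g] :
    Function.Bijective g.lin := by
  refine Function.bijective_iff_has_inverse.mpr ⟨(inv g).lin, fun x => ?_, fun x => ?_⟩
  · exact LinearMap.congr_fun (congrArg Hom.lin (IsIso.hom_inv_id g)) x
  · exact LinearMap.congr_fun (congrArg Hom.lin (IsIso.inv_hom_id g)) x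

theorem isIso_of_bijective {V W : Comodule k D} (g : V ⟶ W) (h : Function.Bijective g.lin) :
    IsIso g := by
  have h2 : g = (isoMk (LinearEquiv.ofBijective g.lin h) g.comm).hom := hom_ext _ _ rfl
  rw [h2]
  infer_instance

theorem actL_lTensor_comp {V W : Type u} [AddCommGroup V] [Module k V] [AddCommGroup W]
    [Module k W] (f : D →ₗ[k] C) (v : V →ₗ[k] V ⊗[k] D) (t : V ⊗[k] W) :
    actL (f.lTensor V ∘ₗ v) W t = f.lTensor (V ⊗[k] W) (actL v W t) := by
  induction t using TensorProduct.induction_on with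
  | zero => simp
  | add a b ha hb => simp only [map_add, ha, hb]
  | tmul x y => rw [actL_tmul, actL_tmul, LinearMap.comp_apply, rTensor_lTensor]

theorem actR_lTensor_comp {V W : Type u} [AddCommGroup V] [Module k V] [AddCommGroup W]
    [Module k W] (f : D →ₗ[k] C) (w : W →ₗ[k] W ⊗[k] D) (t : V ⊗[k] W) :
    actR V (f.lTensor W ∘ₗ w) t = f.lTensor (V ⊗[k] W) (actR V w t) := by
  induction t using TensorProduct.induction_on with
  | zero => simp
  | add a b ha hb => simp only [map_add, ha, hb]
  | tmul x y => rw [actR_tmul, actR_tmul, LinearMap.comp_apply, rTensor_lTensor]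

section Corestrict

variable (f : D →ₗc[k] C)

/-- Corestriction `f_! : Vec^D ⥤ Vec^C` along `f : D → C`. -/
def corestrictFunctor : Comodule k D ⥤ Comodule k C where
  obj V := V.corestrict f
  map {V W} a :=
    { lin := a.lin
      comm := LinearMap.ext fun x =>
        (rTensor_lTensor a.lin (f : D →ₗ[k] C) (V.coact x)).trans
          (congrArg _ (hom_comm_apply a x)) }

instance : (corestrictFunctor f).ReflectsIsomorphisms where
  reflects g _ := isIso_of_bijective g (bijective_of_isIso ((corestrictFunctor f).map g))

variable [IsCocomm k D]

/-- The inclusion `f^* V → V ⊗ D`. -/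
def pullIncl (V : Comodule k C) : ((Comodule.pullback f).obj V).carrier →ₗ[k] V.carrier ⊗[k] D :=
  cotIncl f V (regular k D)

theorem pullIncl_injective (V : Comodule k C) : Function.Injective (pullIncl f V) :=
  cotIncl_injective f V (regular k D)

theorem pullIncl_coact (V : Comodule k C) (t : ((Comodule.pullback f).obj V).carrier) :
    (pullIncl f V).rTensor D (((Comodule.pullback f).obj V).coact t) =
      actR V.carrier (comul : D →ₗ[k] D ⊗[k] D) (pullIncl f V t) :=
  cotIncl_coact f V (regular k D) t

theorem pullIncl_eq (V : Comodule k C) (t : ((Comodule.pullback f).obj V).carrier) :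
    actL V.coact D (pullIncl f V t) = (f : D →ₗ[k] C).lTensor (V.carrier ⊗[k] D)
      (actR V.carrier (comul : D →ₗ[k] D ⊗[k] D) (pullIncl f V t)) :=
  cotIncl_eq f V (regular k D) t

theorem pullIncl_map {V W : Comodule k C} (a : V ⟶ W)
    (t : ((Comodule.pullback f).obj V).carrier) :
    pullIncl f W (((Comodule.pullback f).map a).lin t) = a.lin.rTensor D (pullIncl f V t) := rfl

/-- A linear map into `f^* V`, given by its composite with the inclusion. -/
def pullLiftLin {V : Comodule k C} {P : Type u} [AddCommGroup P] [Module k P]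
    (p : P →ₗ[k] V.carrier ⊗[k] D)
    (h : ∀ x, actL V.coact D (p x) = (f : D →ₗ[k] C).lTensor (V.carrier ⊗[k] D)
      (actR V.carrier (comul : D →ₗ[k] D ⊗[k] D) (p x))) :
    P →ₗ[k] ((Comodule.pullback f).obj V).carrier :=
  cotLift f (W := regular k D) p h

theorem pullIncl_pullLiftLin {V : Comodule k C} {P : Type u} [AddCommGroup P] [Module k P]
    (p : P →ₗ[k] V.carrier ⊗[k] D)
    (h : ∀ x, actL V.coact D (p x) = (f : D →ₗ[k] C).lTensor (V.carrier ⊗[k] D)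
      (actR V.carrier (comul : D →ₗ[k] D ⊗[k] D) (p x))) :
    pullIncl f V ∘ₗ pullLiftLin f p h = p := rfl

/-- A morphism into `f^* V`, given by its composite with the inclusion. -/
def pullLift {V : Comodule k C} {P : Comodule k D} (p : P.carrier →ₗ[k] V.carrier ⊗[k] D)
    (h : ∀ x, actL V.coact D (p x) = (f : D →ₗ[k] C).lTensor (V.carrier ⊗[k] D)
      (actR V.carrier (comul : D →ₗ[k] D ⊗[k] D) (p x)))
    (h' : ∀ x, p.rTensor D (P.coact x) = actR V.carrier (comul : D →ₗ[k] D ⊗[k] D) (p x)) :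
    P ⟶ (Comodule.pullback f).obj V where
  lin := pullLiftLin f p h
  comm := by
    apply LinearMap.ext
    intro x
    apply rTensor_injective_of_injective D _ (pullIncl_injective f V)
    rw [LinearMap.comp_apply, ← LinearMap.rTensor_comp_apply, pullIncl_pullLiftLin, h',
      LinearMap.comp_apply, pullIncl_coact, ← LinearMap.comp_apply (pullIncl f V),
      pullIncl_pullLiftLin]

/-- The map `f^* V → V`, `v ⊗ d ↦ ε(d) v`. -/
def pullEval (V : Comodule k C) : ((Comodule.pullback f).obj V).carrier →ₗ[k] V.carrier :=
  cofreeEval k D V.carrier ∘ₗ pullIncl f V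

theorem pullEval_map {V W : Comodule k C} (a : V ⟶ W)
    (t : ((Comodule.pullback f).obj V).carrier) :
    pullEval f W (((Comodule.pullback f).map a).lin t) = a.lin (pullEval f V t) :=
  (congrArg _ (pullIncl_map f a t)).trans (cofreeEval_rTensor a.lin _)

theorem rTensor_pullEval_coact (V : Comodule k C) (t : ((Comodule.pullback f).obj V).carrier) :
    (pullEval f V).rTensor D (((Comodule.pullback f).obj V).coact t) = pullIncl f V t := by
  rw [pullEval, LinearMap.rTensor_comp_apply, pullIncl_coact, cofreeEval_rTensor_actR]

theorem cofreeEval_rTensor_actL {V : Type u} [AddCommGroup V] [Module k V]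
    (v : V →ₗ[k] V ⊗[k] C) (s : V ⊗[k] D) :
    (cofreeEval k D V).rTensor C (actL v D s) = v (cofreeEval k D V s) := by
  induction s using TensorProduct.induction_on with
  | zero => simp
  | add a b ha hb => simp only [map_add, ha, hb]
  | tmul x d =>
    rw [actL_tmul, cofreeEval_tmul, map_smul]
    induction v x using TensorProduct.induction_on with
    | zero => simp
    | add a b ha hb => simp only [map_add, smul_add, ha, hb]
    | tmul x y => simp [TensorProduct.smul_tmul', cofreeEval_tmul]

theorem coact_pullEval (V : Comodule k C) (t : ((Comodule.pullback f).obj V).carrier) :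
    V.coact (pullEval f V t) = (f : D →ₗ[k] C).lTensor V.carrier (pullIncl f V t) := by
  rw [pullEval, LinearMap.comp_apply, ← cofreeEval_rTensor_actL, pullIncl_eq, rTensor_lTensor,
    cofreeEval_rTensor_actR]

/-- The counit `f_! f^* V → V`. -/
def pullCounit (V : Comodule k C) :
    (corestrictFunctor f).obj ((Comodule.pullback f).obj V) ⟶ V where
  lin := pullEval f V
  comm := LinearMap.ext fun t =>
    ((rTensor_lTensor (pullEval f V) (f : D →ₗ[k] C)
      (((Comodule.pullback f).obj V).coact t)).trans
        (congrArg _ (rTensor_pullEval_coact f V t))).trans (coact_pullEval f V t).symm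

theorem coact_coact (X : Comodule k D) (x : X.carrier) :
    X.coact.rTensor D (X.coact x) = actR X.carrier (comul : D →ₗ[k] D ⊗[k] D) (X.coact x) :=
  hom_comm_apply (coactHom X) x

theorem actL_coact (X : Comodule k D) (x : X.carrier) :
    actL X.coact D (X.coact x) = actR X.carrier (comul : D →ₗ[k] D ⊗[k] D) (X.coact x) :=
  (coact_cocomm X x).trans (coact_coact X x)

/-- The unit `X → f^* f_! X`. -/
def pullUnit (X : Comodule k D) :
    X ⟶ (Comodule.pullback f).obj ((corestrictFunctor f).obj X) :=
  pullLift f (V := (corestrictFunctor f).obj X) X.coact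
    (fun x => (actL_lTensor_comp (f : D →ₗ[k] C) X.coact (X.coact x)).trans
      (congrArg _ (actL_coact X x)))
    (fun x => coact_coact X x)

theorem pullEval_pullUnit (X : Comodule k D) (x : X.carrier) :
    pullEval f _ ((pullUnit f X).lin x) = x := counit_coact_apply X x

/-- Corestriction is left adjoint to change of coalgebra. -/
def pullAdj : corestrictFunctor f ⊣ Comodule.pullback f :=
  Adjunction.mkOfUnitCounit
    { unit :=
        { app X := pullUnit f X
          naturality X Y g := hom_ext _ _ (LinearMap.ext fun x => pullIncl_injective f _
            (hom_comm_apply g x).symm) }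
      counit :=
        { app V := pullCounit f V
          naturality V W g := hom_ext _ _ (LinearMap.ext fun t => pullEval_map f g t) }
      left_triangle := by
        ext X : 2
        exact hom_ext _ _ (LinearMap.ext fun x => pullEval_pullUnit f X x)
      right_triangle := by
        ext V : 2
        exact hom_ext _ _ (LinearMap.ext fun t => pullIncl_injective f V
          (rTensor_pullEval_coact f V t)) }

/-- Morphisms into `f^* V` are determined by their composites with `f^* V → V`. -/
theorem pull_hom_ext {P : Comodule k D} {V : Comodule k C} {a b : P ⟶ (Comodule.pullback f).obj V}
    (h : ∀ x, pullEval f V (a.lin x) = pullEval f V (b.lin x)) : a = b := by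
  apply ((pullAdj f).homEquiv _ _).symm.injective
  rw [Adjunction.homEquiv_counit, Adjunction.homEquiv_counit]
  exact hom_ext _ _ (LinearMap.ext h)

variable [IsCocomm k C]

/-- The inclusion `X ⊗^D Y → X ⊗^C Y`. -/
def corestrictδ (X Y : Comodule k D) : (corestrictFunctor f).obj (X ⊗ Y) ⟶
    (corestrictFunctor f).obj X ⊗ (corestrictFunctor f).obj Y :=
  homMk (P := (corestrictFunctor f).obj (X ⊗ Y)) (V := (corestrictFunctor f).obj X)
    (W := (corestrictFunctor f).obj Y) (incl X Y)
    (fun t => (actL_lTensor_comp (f : D →ₗ[k] C) X.coact (incl X Y t)).trans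
      ((congrArg _ (incl_eq X Y t)).trans
        (actR_lTensor_comp (f : D →ₗ[k] C) Y.coact (incl X Y t)).symm))
    (fun t => (rTensor_lTensor (incl X Y) (f : D →ₗ[k] C) ((tens X Y).coact t)).trans
      ((congrArg _ (incl_coact X Y t)).trans
        (actR_lTensor_comp (f : D →ₗ[k] C) Y.coact (incl X Y t)).symm))

/-- The map `f`, as a morphism of comodules. -/
def corestrictη : (corestrictFunctor f).obj (𝟙_ (Comodule k D)) ⟶ 𝟙_ (Comodule k C) where
  lin := (f : D →ₗ[k] C)
  comm := by
    apply LinearMap.ext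
    intro d
    have h := LinearMap.congr_fun (CoalgHomClass.map_comp_comul f) d
    rw [← LinearMap.rTensor_comp_lTensor] at h
    exact h

/-- The inclusion `X ⊗^D Y → X ⊗ Y`, regarded as a map of the underlying spaces of
corestrictions. -/
def corestrictι (X Y : Comodule k D) : forgetMod.obj ((corestrictFunctor f).obj (X ⊗ Y)) ⟶
    forgetMod.obj ((corestrictFunctor f).obj X) ⊗ forgetMod.obj ((corestrictFunctor f).obj Y) :=
  ι X Y

theorem map_corestrictδ_ι (X Y : Comodule k D) :
    forgetMod.map (corestrictδ f X Y) ≫ ι _ _ = corestrictι f X Y := rfl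

theorem map_map_whiskerLeft_corestrictι (X : Comodule k D) {Y Y' : Comodule k D} (b : Y ⟶ Y') :
    forgetMod.map ((corestrictFunctor f).map (X ◁ b)) ≫ corestrictι f X Y' =
      corestrictι f X Y ≫ _ ◁ forgetMod.map ((corestrictFunctor f).map b) := rfl

theorem map_map_whiskerRight_corestrictι {X X' : Comodule k D} (a : X ⟶ X') (Y : Comodule k D) :
    forgetMod.map ((corestrictFunctor f).map (a ▷ Y)) ≫ corestrictι f X' Y =
      corestrictι f X Y ≫ forgetMod.map ((corestrictFunctor f).map a) ▷ _ := rfl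

theorem map_map_associator_corestrictι (X Y Z : Comodule k D) :
    forgetMod.map ((corestrictFunctor f).map (α_ X Y Z).hom) ≫ corestrictι f X (Y ⊗ Z) ≫
      _ ◁ corestrictι f Y Z =
    corestrictι f (X ⊗ Y) Z ≫ corestrictι f X Y ▷ _ ≫ (α_ _ _ _).hom :=
  map_associator_ι X Y Z

theorem map_map_leftUnitor_corestrict (X : Comodule k D) :
    forgetMod.map ((corestrictFunctor f).map (λ_ X).hom) = corestrictι f (𝟙_ _) X ≫
      (counitHom (k := k) (D := D)) ▷ _ ≫ (λ_ _).hom := map_leftUnitor X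

theorem map_map_rightUnitor_corestrict (X : Comodule k D) :
    forgetMod.map ((corestrictFunctor f).map (ρ_ X).hom) = corestrictι f X (𝟙_ _) ≫
      _ ◁ (counitHom (k := k) (D := D)) ≫ (ρ_ _).hom := map_rightUnitor X

theorem map_corestrictη_counit :
    forgetMod.map (corestrictη f) ≫ counitHom = (counitHom (k := k) (D := D) :) :=
  ModuleCat.hom_ext (CoalgHomClass.counit_comp f)

instance : (corestrictFunctor f).OplaxMonoidal where
  η := corestrictη f
  δ := corestrictδ f
  δ_natural_left {X X'} a Y := by
    apply forgetMod.map_injective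
    rw [← cancel_mono (ι _ _)]
    simp only [Functor.map_comp, Category.assoc]
    rw [map_whiskerRight_ι, reassoc_of% map_corestrictδ_ι, map_corestrictδ_ι,
      map_map_whiskerRight_corestrictι]
  δ_natural_right {Y Y'} X b := by
    apply forgetMod.map_injective
    rw [← cancel_mono (ι _ _)]
    simp only [Functor.map_comp, Category.assoc]
    rw [map_whiskerLeft_ι, reassoc_of% map_corestrictδ_ι, map_corestrictδ_ι,
      map_map_whiskerLeft_corestrictι]
  oplax_associativity X Y Z := by
    apply forgetMod.map_injective
    rw [← cancel_mono (ι _ _), ← cancel_mono (_ ◁ ι _ _)]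
    simp only [Functor.map_comp, Category.assoc]
    rw [map_associator_ι, reassoc_of% map_whiskerRight_ι, reassoc_of% map_corestrictδ_ι,
      ← MonoidalCategory.comp_whiskerRight_assoc, map_corestrictδ_ι, reassoc_of% map_whiskerLeft_ι,
      reassoc_of% map_corestrictδ_ι, ← MonoidalCategory.whiskerLeft_comp, map_corestrictδ_ι,
      map_map_associator_corestrictι]
  oplax_left_unitality X := by
    have h : corestrictδ f (𝟙_ _) X ≫ corestrictη f ▷ (corestrictFunctor f).obj X ≫ (λ_ _).hom =
        (corestrictFunctor f).map (λ_ X).hom := by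
      apply forgetMod.map_injective
      rw [Functor.map_comp, Functor.map_comp, map_leftUnitor, reassoc_of% map_whiskerRight_ι,
        reassoc_of% map_corestrictδ_ι, ← MonoidalCategory.comp_whiskerRight_assoc,
        map_corestrictη_counit, map_map_leftUnitor_corestrict]
      rfl
    rw [← cancel_mono (λ_ _).hom, Category.assoc, Category.assoc, h, ← Functor.map_comp]
    simp
  oplax_right_unitality X := by
    have h : corestrictδ f X (𝟙_ _) ≫ (corestrictFunctor f).obj X ◁ corestrictη f ≫ (ρ_ _).hom =
        (corestrictFunctor f).map (ρ_ X).hom := by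
      apply forgetMod.map_injective
      rw [Functor.map_comp, Functor.map_comp, map_rightUnitor, reassoc_of% map_whiskerLeft_ι,
        reassoc_of% map_corestrictδ_ι, ← MonoidalCategory.whiskerLeft_comp_assoc,
        map_corestrictη_counit, map_map_rightUnitor_corestrict]
    rw [← cancel_mono (ρ_ _).hom, Category.assoc, Category.assoc, h, ← Functor.map_comp]
    simp

theorem corestrict_braided (X Y : Comodule k D) :
    (corestrictFunctor f).map (β_ X Y).hom ≫ Functor.OplaxMonoidal.δ (corestrictFunctor f) Y X =
      Functor.OplaxMonoidal.δ (corestrictFunctor f) X Y ≫ (β_ _ _).hom := by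
  apply forgetMod.map_injective
  rw [← cancel_mono (ι _ _)]
  rfl

section ProjectionIso

variable (X : Comodule k D) (V : Comodule k C)

/-- The linear map underlying the projection `X ⊗^D f^* V → X ⊗^C V`. -/
def projLin : (tens X ((Comodule.pullback f).obj V)).carrier →ₗ[k]
    (tens ((corestrictFunctor f).obj X) V).carrier :=
  (projHom (pullAdj f) X V).lin

/-- The inclusion `X ⊗^C V → X ⊗ V`. -/
def corestrictIncl : (tens ((corestrictFunctor f).obj X) V).carrier →ₗ[k]
    X.carrier ⊗[k] V.carrier :=
  incl ((corestrictFunctor f).obj X) V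

theorem corestrictIncl_eq (s : (tens ((corestrictFunctor f).obj X) V).carrier) :
    (f : D →ₗ[k] C).lTensor (X.carrier ⊗[k] V.carrier)
      (actL X.coact V.carrier (corestrictIncl f X V s)) =
      actR X.carrier V.coact (corestrictIncl f X V s) :=
  (actL_lTensor_comp (f : D →ₗ[k] C) X.coact _).symm.trans
    (incl_eq ((corestrictFunctor f).obj X) V s)

theorem corestrictIncl_projLin (t : (tens X ((Comodule.pullback f).obj V)).carrier) :
    corestrictIncl f X V (projLin f X V t) =
      (pullEval f V).lTensor X.carrier (incl X ((Comodule.pullback f).obj V) t) := rfl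

theorem rTensor_lTensor_actR {X W V : Type u} [AddCommGroup X] [Module k X] [AddCommGroup W]
    [Module k W] [AddCommGroup V] [Module k V] (g : W →ₗ[k] V) (w : W →ₗ[k] W ⊗[k] D)
    (s : X ⊗[k] W) :
    (g.lTensor X).rTensor D (actR X w s) =
      (TensorProduct.assoc k X V D).symm ((g.rTensor D ∘ₗ w).lTensor X s) := by
  induction s using TensorProduct.induction_on with
  | zero => simp
  | add a b ha hb => simp only [map_add, ha, hb]
  | tmul x y =>
    rw [actR_tmul, LinearMap.lTensor_tmul, LinearMap.comp_apply]
    induction w y using TensorProduct.induction_on with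
    | zero => simp
    | add a b ha hb => simp only [map_add, TensorProduct.tmul_add, ha, hb]
    | tmul a b => simp

/-- The projection discards the `D`-leg, and the coaction of `X` restores it: on the cotensor
product that coaction equals the one of `f^* V`, whose evaluation is the inclusion into `V ⊗ D`.
Injectivity of the projection follows. -/
theorem actL_corestrictIncl_projLin (t : (tens X ((Comodule.pullback f).obj V)).carrier) :
    actL X.coact V.carrier (corestrictIncl f X V (projLin f X V t)) =
      (TensorProduct.assoc k X.carrier V.carrier D).symm ((pullIncl f V).lTensor X.carrier
        (incl X ((Comodule.pullback f).obj V) t)) := by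
  rw [corestrictIncl_projLin, actL_lTensor, incl_eq, rTensor_lTensor_actR]
  congr 3
  exact LinearMap.ext (rTensor_pullEval_coact f V)

theorem projLin_injective : Function.Injective (projLin f X V) := by
  intro t t' h
  apply incl_injective
  apply lTensor_injective_of_injective X.carrier _ (pullIncl_injective f V)
  apply (TensorProduct.assoc k X.carrier V.carrier D).symm.injective
  rw [← actL_corestrictIncl_projLin, ← actL_corestrictIncl_projLin, h]

variable {X V}

/-- The inverse of the projection is to be `x ⊗ v ↦ ∑ x₀ ⊗ v ⊗ x₁`. This lemma and
`lTensor_actR_atssoc_actL`-style expansion of the other leg compare the two sides of the equation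
defining `f^* V`; they agree once `u` lies in the cotensor product over `C`. -/
theorem lTensor_actL_assoc_actL (u : X.carrier ⊗[k] V.carrier) :
    (actL V.coact D).lTensor X.carrier (TensorProduct.assoc k X.carrier V.carrier D
      (actL X.coact V.carrier u)) =
    TensorProduct.assoc k X.carrier (V.carrier ⊗[k] D) C
      ((TensorProduct.assoc k X.carrier V.carrier D).toLinearMap.rTensor C
        ((actL X.coact V.carrier).rTensor C (actR X.carrier V.coact u))) := by
  induction u using TensorProduct.induction_on with
  | zero => simp
  | add a b ha hb => simp only [map_add, ha, hb]
  | tmul x v =>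
    let T : (X.carrier ⊗[k] D) ⊗[k] (V.carrier ⊗[k] C) →ₗ[k]
        X.carrier ⊗[k] ((V.carrier ⊗[k] D) ⊗[k] C) :=
      (TensorProduct.assoc k V.carrier D C).symm.toLinearMap.lTensor X.carrier ∘ₗ
        (TensorProduct.assoc k X.carrier V.carrier (D ⊗[k] C)).toLinearMap ∘ₗ
          (TensorProduct.tensorTensorTensorComm k X.carrier D V.carrier C).toLinearMap
    have h1 : ∀ s : X.carrier ⊗[k] D, (actL V.coact D).lTensor X.carrier
        (TensorProduct.assoc k X.carrier V.carrier D
          (((TensorProduct.mk k X.carrier V.carrier).flip v).rTensor D s)) =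
        T (s ⊗ₜ V.coact v) := by
      intro s
      induction s using TensorProduct.induction_on with
      | zero => simp
      | add a b ha hb => simp only [map_add, TensorProduct.add_tmul, ha, hb]
      | tmul a d =>
        simp only [LinearMap.rTensor_tmul, LinearMap.flip_apply, TensorProduct.mk_apply,
          TensorProduct.assoc_tmul, LinearMap.lTensor_tmul, actL_tmul]
        induction V.coact v using TensorProduct.induction_on with
        | zero => simp
        | add a b ha hb => simp only [map_add, TensorProduct.tmul_add, ha, hb]
        | tmul a b => simp [T]
    have h2 : ∀ r : V.carrier ⊗[k] C, TensorProduct.assoc k X.carrier (V.carrier ⊗[k] D) C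
        ((TensorProduct.assoc k X.carrier V.carrier D).toLinearMap.rTensor C
          ((actL X.coact V.carrier).rTensor C
            (((TensorProduct.mk k X.carrier V.carrier) x).rTensor C r))) =
        T (X.coact x ⊗ₜ r) := by
      intro r
      induction r using TensorProduct.induction_on with
      | zero => simp
      | add a b ha hb => simp only [map_add, TensorProduct.tmul_add, ha, hb]
      | tmul a d =>
        simp only [LinearMap.rTensor_tmul, TensorProduct.mk_apply, actL_tmul]
        induction X.coact x using TensorProduct.induction_on with
        | zero => simp
        | add a b ha hb => simp only [map_add, TensorProduct.add_tmul, ha, hb]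
        | tmul a b => simp [T]
    rw [actL_tmul, actR_tmul, h1, h2]

theorem lTensor_actR_assoc_actL (u : X.carrier ⊗[k] V.carrier) :
    ((f : D →ₗ[k] C).lTensor (V.carrier ⊗[k] D) ∘ₗ
      actR V.carrier (comul : D →ₗ[k] D ⊗[k] D)).lTensor X.carrier
        (TensorProduct.assoc k X.carrier V.carrier D (actL X.coact V.carrier u)) =
    TensorProduct.assoc k X.carrier (V.carrier ⊗[k] D) C
      ((TensorProduct.assoc k X.carrier V.carrier D).toLinearMap.rTensor C
        ((actL X.coact V.carrier).rTensor C ((f : D →ₗ[k] C).lTensor (X.carrier ⊗[k] V.carrier)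
      (actL X.coact V.carrier u)))) := by
  induction u using TensorProduct.induction_on with
  | zero => simp
  | add a b ha hb => simp only [map_add, ha, hb]
  | tmul x v =>
    let Ψ : X.carrier ⊗[k] (D ⊗[k] D) →ₗ[k] X.carrier ⊗[k] ((V.carrier ⊗[k] D) ⊗[k] C) :=
      (TensorProduct.map (TensorProduct.mk k V.carrier D v) (f : D →ₗ[k] C)).lTensor X.carrier
    have h1 : ∀ r : X.carrier ⊗[k] D, ((f : D →ₗ[k] C).lTensor (V.carrier ⊗[k] D) ∘ₗ
        actR V.carrier (comul : D →ₗ[k] D ⊗[k] D)).lTensor X.carrier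
          (TensorProduct.assoc k X.carrier V.carrier D
            (((TensorProduct.mk k X.carrier V.carrier).flip v).rTensor D r)) =
        Ψ ((comul : D →ₗ[k] D ⊗[k] D).lTensor X.carrier r) := by
      intro r
      induction r using TensorProduct.induction_on with
      | zero => simp
      | add a b ha hb => simp only [map_add, ha, hb]
      | tmul a d =>
        simp only [LinearMap.rTensor_tmul, LinearMap.flip_apply, TensorProduct.mk_apply,
          TensorProduct.assoc_tmul, LinearMap.lTensor_tmul, LinearMap.comp_apply, actR_tmul, Ψ]
        induction (comul d : D ⊗[k] D) using TensorProduct.induction_on with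
        | zero => simp
        | add a b ha hb => simp only [map_add, TensorProduct.tmul_add, ha, hb]
        | tmul a b => simp
    have h2 : ∀ r : X.carrier ⊗[k] D, TensorProduct.assoc k X.carrier (V.carrier ⊗[k] D) C
      ((TensorProduct.assoc k X.carrier V.carrier D).toLinearMap.rTensor C
        ((actL X.coact V.carrier).rTensor C ((f : D →ₗ[k] C).lTensor (X.carrier ⊗[k] V.carrier)
          (((TensorProduct.mk k X.carrier V.carrier).flip v).rTensor D r)))) =
        Ψ (TensorProduct.assoc k X.carrier D D (X.coact.rTensor D r)) := by
      intro r
      induction r using TensorProduct.induction_on with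
      | zero => simp
      | add a b ha hb => simp only [map_add, ha, hb]
      | tmul a d =>
        simp only [LinearMap.rTensor_tmul, LinearMap.flip_apply, TensorProduct.mk_apply,
          LinearMap.lTensor_tmul, actL_tmul, Ψ]
        induction X.coact a using TensorProduct.induction_on with
        | zero => simp
        | add a b ha hb => simp only [map_add, TensorProduct.add_tmul, ha, hb]
        | tmul a b => simp
    rw [actL_tmul, h1, h2, coassoc_apply]

/-- The candidate inverse always satisfies the cotensor equation over `D`: by `actL_coact`, coacting
twice on `X` agrees with comultiplying the `D`-leg. -/
theorem actL_assoc_actL (u : X.carrier ⊗[k] V.carrier) :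
    actL X.coact (V.carrier ⊗[k] D) (TensorProduct.assoc k X.carrier V.carrier D
      (actL X.coact V.carrier u)) =
    actR X.carrier (actR V.carrier (comul : D →ₗ[k] D ⊗[k] D))
      (TensorProduct.assoc k X.carrier V.carrier D (actL X.coact V.carrier u)) := by
  induction u using TensorProduct.induction_on with
  | zero => simp
  | add a b ha hb => simp only [map_add, ha, hb]
  | tmul x v =>
    let Ξ : (X.carrier ⊗[k] D) ⊗[k] D →ₗ[k] (X.carrier ⊗[k] (V.carrier ⊗[k] D)) ⊗[k] D :=
      ((TensorProduct.mk k V.carrier D v).lTensor X.carrier).rTensor D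
    have h1 : ∀ r : X.carrier ⊗[k] D, actL X.coact (V.carrier ⊗[k] D)
        (TensorProduct.assoc k X.carrier V.carrier D
          (((TensorProduct.mk k X.carrier V.carrier).flip v).rTensor D r)) =
        Ξ (actL X.coact D r) := by
      intro r
      induction r using TensorProduct.induction_on with
      | zero => simp
      | add a b ha hb => simp only [map_add, ha, hb]
      | tmul a d =>
        simp only [LinearMap.rTensor_tmul, LinearMap.flip_apply, TensorProduct.mk_apply,
          TensorProduct.assoc_tmul, actL_tmul, Ξ]
        induction X.coact a using TensorProduct.induction_on with
        | zero => simp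
        | add a b ha hb => simp only [map_add, ha, hb]
        | tmul a b => simp
    have h2 : ∀ r : X.carrier ⊗[k] D,
        actR X.carrier (actR V.carrier (comul : D →ₗ[k] D ⊗[k] D))
        (TensorProduct.assoc k X.carrier V.carrier D
          (((TensorProduct.mk k X.carrier V.carrier).flip v).rTensor D r)) =
        Ξ (actR X.carrier (comul : D →ₗ[k] D ⊗[k] D) r) := by
      intro r
      induction r using TensorProduct.induction_on with
      | zero => simp
      | add a b ha hb => simp only [map_add, ha, hb]
      | tmul a d =>
        simp only [LinearMap.rTensor_tmul, LinearMap.flip_apply, TensorProduct.mk_apply,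
          TensorProduct.assoc_tmul, actR_tmul, Ξ]
        induction (comul d : D ⊗[k] D) using TensorProduct.induction_on with
        | zero => simp
        | add a b ha hb => simp only [map_add, ha, hb]
        | tmul a b => simp
    rw [actL_tmul, h1, h2, actL_coact]

theorem lTensor_cofreeEval_assoc_actL (u : X.carrier ⊗[k] V.carrier) :
    (cofreeEval k D V.carrier).lTensor X.carrier (TensorProduct.assoc k X.carrier V.carrier D
      (actL X.coact V.carrier u)) = u := by
  induction u using TensorProduct.induction_on with
  | zero => simp
  | add a b ha hb => simp only [map_add, ha, hb]
  | tmul x v =>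
    rw [actL_tmul]
    have h : ∀ r : X.carrier ⊗[k] D, (cofreeEval k D V.carrier).lTensor X.carrier
        (TensorProduct.assoc k X.carrier V.carrier D
          (((TensorProduct.mk k X.carrier V.carrier).flip v).rTensor D r)) =
        cofreeEval k D X.carrier r ⊗ₜ v := by
      intro r
      induction r using TensorProduct.induction_on with
      | zero => simp
      | add a b ha hb => simp only [map_add, TensorProduct.add_tmul, ha, hb]
      | tmul a d => simp [cofreeEval_tmul, TensorProduct.smul_tmul]
    rw [h]
    congr 1
    exact counit_coact_apply X x

variable (X V)

/-- The inclusion `f^* V → V ⊗ D` as a morphism. -/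
def pullInclHom : (Comodule.pullback f).obj V ⟶ tensorR V.carrier (regular k D) :=
  ⟨pullIncl f V, LinearMap.ext (pullIncl_coact f V)⟩

/-- The preimage of `∑ x ⊗ v` is `∑ x₀ ⊗ v ⊗ x₁`. It lies in `X ⊗ f^* V` because the tensor
satisfies the cotensor equation over `C`, and then in the cotensor product over `D`. -/
theorem projLin_surjective : Function.Surjective (projLin f X V) := by
  intro s
  let r := TensorProduct.assoc k X.carrier V.carrier D
    (actL X.coact V.carrier (corestrictIncl f X V s))
  obtain ⟨t, ht⟩ : r ∈ LinearMap.range ((pullIncl f V).lTensor X.carrier) := by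
    refine mem_range_lTensor X.carrier (actL V.coact D) ((f : D →ₗ[k] C).lTensor
      (V.carrier ⊗[k] D) ∘ₗ actR V.carrier (comul : D →ₗ[k] D ⊗[k] D)) r ?_
    rw [lTensor_actL_assoc_actL, lTensor_actR_assoc_actL, corestrictIncl_eq]
  have h1 : actL X.coact _ t = actR X.carrier ((Comodule.pullback f).obj V).coact t := by
    apply rTensor_injective_of_injective D _
      (lTensor_injective_of_injective X.carrier _ (pullIncl_injective f V))
    rw [← actL_lTensor, ht, actL_assoc_actL]
    refine Eq.trans ?_ (actR_map LinearMap.id (pullInclHom f V) t)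
    exact congrArg _ ht.symm
  -- The element `t` is regarded as a map out of `k`, so that `cotLift` places it in the cotensor
  -- product.
  refine ⟨cotLift (CoalgHom.id k D) (P := k) (LinearMap.toSpanSingleton k _ t) ?_ 1, ?_⟩
  · intro c
    rw [LinearMap.toSpanSingleton_apply, map_smul, map_smul, map_smul, h1, lTensor_id_coe]
  · apply incl_injective
    refine (corestrictIncl_projLin f X V _).trans ?_
    have h2 : incl X ((Comodule.pullback f).obj V) (cotLift (CoalgHom.id k D) (P := k)
        (LinearMap.toSpanSingleton k _ t) (by
          intro c
          rw [LinearMap.toSpanSingleton_apply, map_smul, map_smul, map_smul, h1,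
            lTensor_id_coe]) 1) = t := one_smul k t
    rw [h2, pullEval, LinearMap.lTensor_comp_apply, ht, lTensor_cofreeEval_assoc_actL]
    rfl

instance (X : Comodule k D) (V : Comodule k C) : IsIso (projHom (pullAdj f) X V) :=
  isIso_of_bijective _ ⟨projLin_injective f X V, projLin_surjective f X V⟩

end ProjectionIso

end Corestrict

end Comodule

/-! ### The functor `f^*`: monoidal structure and right adjoint. -/

section PullK

variable {k : Type u} [Field k]

open Functor.LaxMonoidal Functor.OplaxMonoidal

variable {E D : CocommCoalg k} (f : E ⟶ D)

/-- Corestriction `f_! : Vec^E ⥤ Vec^D` along `f : E ⟶ D`. -/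
abbrev pushK : VecC E ⥤ VecC D := Comodule.corestrictFunctor (coalgMap f)

/-- The adjunction `f_! ⊣ f^*`. -/
def adjK : pushK f ⊣ pullK f := Comodule.pullAdj (coalgMap f)

instance (X : VecC E) (V : VecC D) : IsIso (projHom (adjK f) X V) :=
  inferInstanceAs (IsIso (projHom (Comodule.pullAdj (coalgMap f)) X V))

/-- The lax monoidal structure of `f^*`. -/
abbrev pullKLaxMonoidal : (pullK f).LaxMonoidal := (adjK f).rightAdjointLaxMonoidal

/-- The strong monoidal structure of `f^*`. -/
abbrev pullKMonoidal : (pullK f).Monoidal :=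
  letI := pullKLaxMonoidal f
  haveI : IsIso (ε (pullK f)) := isIso_ε_of_projHom (adjK f)
  haveI : ∀ V W, IsIso (μ (pullK f) V W) := isIso_μ_of_projHom (adjK f)
  Functor.Monoidal.ofLaxMonoidal (pullK f)

instance pullKBraided : (pullK f).Braided :=
  { pullKMonoidal f with
    braided := letI := pullKLaxMonoidal f
      rightAdjoint_braided (adjK f) (Comodule.corestrict_braided (coalgMap f)) }

instance : (adjK f).IsMonoidal where
  leftAdjoint_ε := rfl
  leftAdjoint_μ _ _ := rfl

/-- The map `f^* V → V`, `v ⊗ d ↦ ε(d) v`. -/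
def evalK (V : VecC D) : ((pullK f).obj V).carrier →ₗ[k] V.carrier :=
  Comodule.pullEval (coalgMap f) V

/-- Composition with the counit is injective by adjointness. The coherence conditions for `f^*` are
checked this way, after evaluation. -/
theorem pullK_hom_ext {P : VecC E} {V : VecC D} {a b : P ⟶ (pullK f).obj V}
    (h : ∀ x, evalK f V (a.lin x) = evalK f V (b.lin x)) : a = b :=
  Comodule.pull_hom_ext (coalgMap f) h

theorem evalK_map {V W : VecC D} (a : V ⟶ W) (t : ((pullK f).obj V).carrier) :
    evalK f W (((pullK f).map a).lin t) = a.lin (evalK f V t) :=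
  Comodule.pullEval_map (coalgMap f) a t

theorem evalK_ε (d : E.obj) :
    evalK f (𝟙_ (VecC D)) ((ε (pullK f)).lin d) = coalgMap f d :=
  LinearMap.congr_fun (congrArg Comodule.Hom.lin ((adjK f).map_ε_comp_counit_app_unit)) d

theorem incl_evalK_μ (V W : VecC D) (t : ((pullK f).obj V ⊗ (pullK f).obj W).carrier) :
    Comodule.incl V W (evalK f (V ⊗ W) ((μ (pullK f) V W).lin t)) =
      TensorProduct.map (evalK f V) (evalK f W) (Comodule.incl _ _ t) :=
  congrArg (Comodule.incl V W) (LinearMap.congr_fun (congrArg Comodule.Hom.lin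
    ((adjK f).map_μ_comp_counit_app_tensor V W)) t)

theorem homEquiv_adjK_eval {P : VecC E} {V : VecC D} (a : (pushK f).obj P ⟶ V) (x : P.carrier) :
    evalK f V (((adjK f).homEquiv P V a).lin x) = a.lin x := by
  have h := congrArg Comodule.Hom.lin (((adjK f).homEquiv P V).symm_apply_apply a)
  rw [Adjunction.homEquiv_counit] at h
  exact LinearMap.congr_fun h x

/-- By the projection formula `f_! f^*` is the tensor product with `f_!` of the unit, a left adjoint
because `Vec^D` is closed. The adjoint triangle theorem over `f_! ⊣ f^*` then applies to `f^*`. -/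
theorem pullK_isLeftAdjoint (hE : IsCosemisimple k E.obj) (hD : IsCosemisimple k D.obj) :
    (pullK f).IsLeftAdjoint := by
  have hL : (tensorLeft ((pushK f).obj (𝟙_ _))).IsLeftAdjoint :=
    Comodule.tensorLeft_isLeftAdjoint hD _
  let e : tensorLeft ((pushK f).obj (𝟙_ _)) ≅ pullK f ⋙ pushK f :=
    (NatIso.ofComponents (F := pullK f ⋙ pushK f) (G := tensorLeft ((pushK f).obj (𝟙_ _)))
      (fun V => (pushK f).mapIso (λ_ _).symm ≪≫ asIso (projHom (adjK f) _ V))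
      (fun {V W} a => by
        have h := (adjK f).counit_naturality a
        simp only [Functor.comp_map, Iso.trans_hom, Functor.mapIso_hom, Iso.symm_hom, asIso_hom,
          Category.assoc, projHom, curriedTensor_obj_map]
        rw [← MonoidalCategory.whiskerLeft_comp, ← h, MonoidalCategory.whiskerLeft_comp,
          δ_natural_right_assoc, ← Functor.map_comp_assoc, ← Functor.map_comp_assoc,
          MonoidalCategory.leftUnitor_inv_naturality])).symm
  have : (pullK f ⋙ pushK f).IsLeftAdjoint := Functor.isLeftAdjoint_of_iso e
  refine isLeftAdjoint_triangle_lift (pullK f) (adjK f) (fun X => ?_)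
  -- Evaluation is only a linear left inverse of the unit; cosemisimplicity of `E` upgrades
  -- injectivity to a splitting by comodule maps.
  have : IsSplitMono ((adjK f).unit.app X) := Comodule.isSplitMono hE _ (by
    intro x y h
    have h2 := congrArg (evalK f _) h
    have h3 : ∀ x : X.carrier, evalK f _ (((adjK f).unit.app X).lin x) = x :=
      fun x => Comodule.pullEval_pullUnit (coalgMap f) X x
    rwa [h3, h3] at h2)
  exact RegularMono.ofIsSplitMono _

end PullK

/-! ### Coherence of `f ↦ f^*`. -/

section PseudofunctorK

variable {k : Type u} [Field k]

open Functor.LaxMonoidal Functor.OplaxMonoidal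

theorem linearCoe_coalgMap_comp {G E D : CocommCoalg k} (g : G ⟶ E) (f : E ⟶ D) :
    (coalgMap (g ≫ f) : G.obj →ₗ[k] D.obj) =
      (coalgMap f : E.obj →ₗ[k] D.obj) ∘ₗ (coalgMap g : G.obj →ₗ[k] E.obj) := rfl

/-- Corestriction along the identity. -/
def Comodule.corestrictId {D : Type u} [AddCommGroup D] [Module k D] [Coalgebra k D]
    (V : Comodule k D) : V ≅ V.corestrict (CoalgHom.id k D) :=
  Comodule.isoMk (V := V) (W := V.corestrict (CoalgHom.id k D)) (LinearEquiv.refl k V.carrier)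
    (LinearMap.ext fun x =>
      (LinearMap.congr_fun (LinearMap.rTensor_id D V.carrier) (V.coact x)).trans
        (LinearMap.congr_fun (LinearMap.lTensor_id V.carrier D) (V.coact x)).symm)

/-- `1_! ≅ 1`. -/
def pushKId (D : CocommCoalg k) : 𝟭 (VecC D) ≅ pushK (𝟙 D) :=
  NatIso.ofComponents (fun V => Comodule.corestrictId V) (fun _ => rfl)

/-- Corestriction along a composite. -/
def Comodule.corestrictComp {G E D : Type u} [AddCommGroup D] [Module k D] [Coalgebra k D]
    [AddCommGroup E] [Module k E] [Coalgebra k E] [AddCommGroup G] [Module k G] [Coalgebra k G]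
    (g : G →ₗc[k] E) (f : E →ₗc[k] D) (V : Comodule k G) :
    (V.corestrict g).corestrict f ≅ V.corestrict (f.comp g) :=
  Comodule.isoMk (V := (V.corestrict g).corestrict f) (W := V.corestrict (f.comp g))
    (LinearEquiv.refl k V.carrier) (LinearMap.ext fun x =>
      (LinearMap.congr_fun (LinearMap.rTensor_id D V.carrier) ((f : E →ₗ[k] D).lTensor V.carrier
        ((g : G →ₗ[k] E).lTensor V.carrier (V.coact x)))).trans
        (LinearMap.lTensor_comp_apply V.carrier (f : E →ₗ[k] D) (g : G →ₗ[k] E)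
          (V.coact x)).symm)

/-- `(g ≫ f)_! ≅ f_! g_!`. -/
def pushKComp {G E D : CocommCoalg k} (g : G ⟶ E) (f : E ⟶ D) :
    pushK g ⋙ pushK f ≅ pushK (g ≫ f) :=
  NatIso.ofComponents (fun V => Comodule.corestrictComp (coalgMap g) (coalgMap f) V)
    (fun _ => rfl)

/-- `1^* ≅ 1`. -/
def pullKId (D : CocommCoalg k) : pullK (𝟙 D) ≅ 𝟭 (VecC D) :=
  conjugateIsoEquiv (adjK (𝟙 D)) Adjunction.id (pushKId D)

/-- `(g ≫ f)^* ≅ g^* f^*`. -/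
def pullKComp {G E D : CocommCoalg k} (g : G ⟶ E) (f : E ⟶ D) :
    pullK (g ≫ f) ≅ pullK f ⋙ pullK g :=
  conjugateIsoEquiv (adjK (g ≫ f)) ((adjK g).comp (adjK f)) (pushKComp g f)

theorem pullKId_lin {D : CocommCoalg k} (V : VecC D) (t : ((pullK (𝟙 D)).obj V).carrier) :
    ((pullKId D).hom.app V).lin t = evalK (𝟙 D) V t :=
  LinearMap.congr_fun (congrArg Comodule.Hom.lin
    (conjugateEquiv_counit (adjK (𝟙 D)) Adjunction.id (pushKId D).hom V)) t

/-- Conjugation is characterized by compatibility with counits, and the comparison of corestrictions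
is the identity on underlying spaces. Hence every coherence law becomes an equality of iterated
evaluations. -/
theorem evalK_pullKComp {G E D : CocommCoalg k} (g : G ⟶ E) (f : E ⟶ D) (V : VecC D)
    (t : ((pullK (g ≫ f)).obj V).carrier) :
    evalK f V (evalK g _ (((pullKComp g f).hom.app V).lin t)) = evalK (g ≫ f) V t := by
  have h := LinearMap.congr_fun (congrArg Comodule.Hom.lin
    (conjugateEquiv_counit (adjK (g ≫ f)) ((adjK g).comp (adjK f)) (pushKComp g f).hom V)) t
  rw [Adjunction.comp_counit_app] at h
  exact h

theorem evalK_eqToHom {E D : CocommCoalg k} {f f' : E ⟶ D} (e : f = f') (V : VecC D)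
    (h : (pullK f).obj V = (pullK f').obj V) (t : ((pullK f).obj V).carrier) :
    evalK f' V ((eqToHom h).lin t) = evalK f V t := by
  subst e
  rfl

variable {C : CocommCoalg k}

theorem pullK_hom_ext₂ {G E D : CocommCoalg k} {g : G ⟶ E} {f : E ⟶ D} {P : VecC G} {V : VecC D}
    {a b : P ⟶ (pullK g).obj ((pullK f).obj V)}
    (h : ∀ x, evalK f V (evalK g _ (a.lin x)) = evalK f V (evalK g _ (b.lin x))) : a = b := by
  apply ((adjK g).homEquiv _ _).symm.injective
  rw [Adjunction.homEquiv_counit, Adjunction.homEquiv_counit]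
  exact pullK_hom_ext f h

theorem pullK_hom_ext₃ {H G E D : CocommCoalg k} {h : H ⟶ G} {g : G ⟶ E} {f : E ⟶ D}
    {P : VecC H} {V : VecC D} {a b : P ⟶ (pullK h).obj ((pullK g).obj ((pullK f).obj V))}
    (hab : ∀ x, evalK f V (evalK g _ (evalK h _ (a.lin x))) =
      evalK f V (evalK g _ (evalK h _ (b.lin x)))) : a = b := by
  apply ((adjK h).homEquiv _ _).symm.injective
  rw [Adjunction.homEquiv_counit, Adjunction.homEquiv_counit]
  exact pullK_hom_ext₂ hab

variable (C) in
/-- `f ↦ f^*` is a pseudofunctor on the powers of `C`. -/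
def psK : PseudofunctorStructure (B := Powers C) (F := fun D => VecC D.obj)
    (fun {J I : Powers C} (f : J ⟶ I) => pullK f.hom) where
  mapId D := pullKId D.obj
  mapComp g f := pullKComp g.hom f.hom
  assoc h g f X := by
    refine pullK_hom_ext₃ (h := h.hom) (g := g.hom) (f := f.hom) fun x => ?_
    have h1 := (congrArg (evalK f.hom X) (evalK_pullKComp h.hom g.hom ((pullK f.hom).obj X)
      (((pullKComp (h.hom ≫ g.hom) f.hom).hom.app X).lin x))).trans
      (evalK_pullKComp (h.hom ≫ g.hom) f.hom X x)
    refine h1.trans ?_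
    refine Eq.symm ?_
    refine (congrArg (fun y => evalK f.hom X (evalK g.hom _ y))
      (evalK_map h.hom ((pullKComp g.hom f.hom).hom.app X) _)).trans ?_
    refine (evalK_pullKComp g.hom f.hom X _).trans ?_
    refine (evalK_pullKComp h.hom (g.hom ≫ f.hom) X _).trans ?_
    exact evalK_eqToHom (Category.assoc h.hom g.hom f.hom) X _ x
  id_left f X := by
    refine pullK_hom_ext f.hom fun x => ?_
    refine (congrArg (evalK f.hom X) (pullKId_lin _ _)).trans ?_
    refine (evalK_pullKComp (𝟙 _) f.hom X x).trans ?_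
    exact (evalK_eqToHom (Category.id_comp f.hom) X _ x).symm
  id_right f X := by
    refine pullK_hom_ext f.hom fun x => ?_
    refine (evalK_map f.hom ((pullKId _).hom.app X) _).trans ?_
    refine (pullKId_lin _ _).trans ?_
    refine (evalK_pullKComp f.hom (𝟙 _) X x).trans ?_
    exact (evalK_eqToHom (Category.comp_id f.hom) X _ x).symm

theorem pullKId_monoidal (D : CocommCoalg k) : NatTrans.IsMonoidal (pullKId D).hom where
  unit := Comodule.hom_ext _ _ (LinearMap.ext fun x => (pullKId_lin _ _).trans (evalK_ε (𝟙 D) x))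
  tensor V W := Comodule.hom_ext _ _ (LinearMap.ext fun x => by
    apply Comodule.incl_injective
    refine (congrArg _ (pullKId_lin _ _)).trans ((incl_evalK_μ (𝟙 D) V W x).trans ?_)
    have h : ∀ V : VecC D, ((pullKId D).hom.app V).lin = evalK (𝟙 D) V :=
      fun V => LinearMap.ext (pullKId_lin V)
    refine Eq.trans ?_ (Comodule.incl_tensMap ((pullKId D).hom.app V)
      ((pullKId D).hom.app W) x).symm
    rw [h, h])

theorem map_evalK_evalK {G E D : CocommCoalg k} (g : G ⟶ E) (f : E ⟶ D) (V W : VecC D)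
    (s : ((pullK (g ≫ f)).obj V).carrier ⊗[k] ((pullK (g ≫ f)).obj W).carrier) :
    TensorProduct.map (evalK f V) (evalK f W) (TensorProduct.map (evalK g _) (evalK g _)
      (TensorProduct.map ((pullKComp g f).hom.app V).lin ((pullKComp g f).hom.app W).lin s)) =
    TensorProduct.map (evalK (g ≫ f) V) (evalK (g ≫ f) W) s := by
  induction s using TensorProduct.induction_on with
  | zero => simp
  | add a b ha hb => simp only [map_add, ha, hb]
  | tmul a b =>
    exact congrArg₂ (· ⊗ₜ[k] ·) (evalK_pullKComp g f V a) (evalK_pullKComp g f W b)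

theorem pullKComp_monoidal {G E D : CocommCoalg k} (g : G ⟶ E) (f : E ⟶ D) :
    NatTrans.IsMonoidal (pullKComp g f).hom where
  unit := by
    refine pullK_hom_ext₂ fun x => ?_
    refine (evalK_pullKComp g f _ _).trans ((evalK_ε (g ≫ f) x).trans ?_)
    refine Eq.symm ?_
    refine (congrArg (evalK f _) (evalK_map g (ε (pullK f)) _)).trans ?_
    refine (congrArg (fun y => evalK f _ ((ε (pullK f)).lin y)) (evalK_ε g x)).trans ?_
    exact evalK_ε f _
  tensor V W := by
    refine pullK_hom_ext₂ fun x => ?_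
    apply Comodule.incl_injective
    refine (congrArg (Comodule.incl V W) (evalK_pullKComp g f _ _)).trans
      ((incl_evalK_μ (g ≫ f) V W x).trans ?_)
    refine (map_evalK_evalK g f V W _).symm.trans ?_
    refine Eq.symm ?_
    refine (congrArg (fun y => Comodule.incl V W (evalK f _ y))
      (evalK_map g (μ (pullK f) V W) _)).trans ?_
    refine (incl_evalK_μ f V W _).trans ?_
    refine congrArg (TensorProduct.map (evalK f V) (evalK f W)) ?_
    exact incl_evalK_μ g ((pullK f).obj V) ((pullK f).obj W) _

end PseudofunctorK

/-! ### Calculus of the maps `z ↦ a(z₁) ⊗ b(z₂)`. -/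

section Pairs

variable {k : Type u} [Field k]

namespace CocommCoalg

variable {Z E F G : CocommCoalg k}

/-- The map `Z → E ⊗ F`, `z ↦ a(z₁) ⊗ b(z₂)`. -/
def pair (a : Z ⟶ E) (b : Z ⟶ F) : Z.obj →ₗ[k] E.obj ⊗[k] F.obj :=
  (prodLift (coalgMap a) (coalgMap b) : Z.obj →ₗ[k] E.obj ⊗[k] F.obj)

theorem pair_def (a : Z ⟶ E) (b : Z ⟶ F) (z : Z.obj) : pair a b z =
    TensorProduct.map (coalgMap a : Z.obj →ₗ[k] E.obj) (coalgMap b : Z.obj →ₗ[k] F.obj)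
      (comul z) := rfl

theorem pair_comp {Y : CocommCoalg k} (g : Y ⟶ Z) (a : Z ⟶ E) (b : Z ⟶ F) (y : Y.obj) :
    pair a b (coalgMap g y) = pair (g ≫ a) (g ≫ b) y := by
  rw [pair_def, pair_def, ← CoalgHomClass.map_comp_comul_apply, TensorProduct.map_map]
  rfl

theorem map_pair {E' F' : CocommCoalg k} (a : Z ⟶ E) (b : Z ⟶ F) (a' : E ⟶ E') (b' : F ⟶ F')
    (z : Z.obj) : TensorProduct.map (coalgMap a' : E.obj →ₗ[k] E'.obj)
      (coalgMap b' : F.obj →ₗ[k] F'.obj) (pair a b z) = pair (a ≫ a') (b ≫ b') z := by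
  rw [pair_def, pair_def, TensorProduct.map_map]
  rfl

theorem comm_pair (a : Z ⟶ E) (b : Z ⟶ F) (z : Z.obj) :
    TensorProduct.comm k _ _ (pair a b z) = pair b a z := by
  rw [pair_def, pair_def, ← TensorProduct.map_comm, Coalgebra.comm_comul]

theorem rTensor_pair (a : E ⟶ F) (b : E ⟶ G) {H : CocommCoalg k} (p : Z ⟶ E) (c : Z ⟶ H)
    (z : Z.obj) : (pair a b).rTensor H.obj (pair p c z) =
      TensorProduct.map (pair (p ≫ a) (p ≫ b)) (coalgMap c : Z.obj →ₗ[k] H.obj) (comul z) := by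
  rw [pair_def, LinearMap.rTensor, TensorProduct.map_map]
  congr 2
  exact LinearMap.ext fun x => pair_comp p a b x

theorem lTensor_pair (a : E ⟶ F) (b : E ⟶ G) {H : CocommCoalg k} (p : Z ⟶ E) (c : Z ⟶ H)
    (z : Z.obj) : (pair a b).lTensor H.obj (pair c p z) =
      TensorProduct.map (coalgMap c : Z.obj →ₗ[k] H.obj) (pair (p ≫ a) (p ≫ b)) (comul z) := by
  rw [pair_def, LinearMap.lTensor, TensorProduct.map_map]
  congr 2
  exact LinearMap.ext fun x => pair_comp p a b x

theorem assoc_map_pair (a : Z ⟶ E) (b : Z ⟶ F) (c : Z ⟶ G) (z : Z.obj) :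
    TensorProduct.assoc k _ _ _
      (TensorProduct.map (pair a b) (coalgMap c : Z.obj →ₗ[k] G.obj) (comul z)) =
    TensorProduct.map (coalgMap a : Z.obj →ₗ[k] E.obj) (pair b c) (comul z) := by
  have h1 : TensorProduct.map (pair a b) (coalgMap c : Z.obj →ₗ[k] G.obj) (comul z) =
      TensorProduct.map (TensorProduct.map (coalgMap a : Z.obj →ₗ[k] E.obj)
        (coalgMap b : Z.obj →ₗ[k] F.obj)) (coalgMap c : Z.obj →ₗ[k] G.obj)
        (comul.rTensor Z.obj (comul z)) := by
    rw [LinearMap.rTensor, TensorProduct.map_map]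
    rfl
  have h2 : TensorProduct.map (coalgMap a : Z.obj →ₗ[k] E.obj) (pair b c) (comul z) =
      TensorProduct.map (coalgMap a : Z.obj →ₗ[k] E.obj)
        (TensorProduct.map (coalgMap b : Z.obj →ₗ[k] F.obj) (coalgMap c : Z.obj →ₗ[k] G.obj))
        (comul.lTensor Z.obj (comul z)) := by
    rw [LinearMap.lTensor, TensorProduct.map_map]
    rfl
  rw [h1, h2, ← TensorProduct.map_map_assoc, Coalgebra.coassoc_apply]

theorem rTensor_counit_pair (a : Z ⟶ E) (b : Z ⟶ F) (z : Z.obj) :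
    TensorProduct.lid k _ ((counit : E.obj →ₗ[k] k).rTensor F.obj (pair a b z)) =
      coalgMap b z :=
  DFunLike.congr_fun (projSnd_prodLift (coalgMap a) (coalgMap b)) z

theorem lTensor_counit_pair (a : Z ⟶ E) (b : Z ⟶ F) (z : Z.obj) :
    TensorProduct.rid k _ ((counit : F.obj →ₗ[k] k).lTensor E.obj (pair a b z)) =
      coalgMap a z :=
  DFunLike.congr_fun (projFst_prodLift (coalgMap a) (coalgMap b)) z

variable {D : CocommCoalg k}

theorem actL_pair (φ : E ⟶ D) (a : Z ⟶ E) (b : Z ⟶ F) (z : Z.obj) :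
    actL (coactAlong (coalgMap φ)) F.obj (pair a b z) =
      (pair a b).rTensor D.obj (coactAlong (coalgMap (a ≫ φ)) z) := by
  refine (coactAlong_comp_projFst (φ := φ) _).symm.trans ?_
  refine (EqCoalg.coactAlong_comp ((coalgMap φ).comp (projFst k E.obj F.obj))
    (prodLift (coalgMap a) (coalgMap b)) z).trans ?_
  rw [CoalgHom.comp_assoc, projFst_prodLift, coactAlong_apply]
  exact (LinearMap.congr_fun (LinearMap.rTensor_comp_lTensor _ _ _) _).symm

theorem actR_pair (ψ : F ⟶ D) (a : Z ⟶ E) (b : Z ⟶ F) (z : Z.obj) :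
    actR E.obj (coactAlong (coalgMap ψ)) (pair a b z) =
      (pair a b).rTensor D.obj (coactAlong (coalgMap (b ≫ ψ)) z) := by
  refine (Comodule.actR_lTensor_comp _ _ _).trans ?_
  refine (coactAlong_comp_projSnd (f := ψ) _).symm.trans ?_
  refine (EqCoalg.coactAlong_comp ((coalgMap ψ).comp (projSnd k E.obj F.obj))
    (prodLift (coalgMap a) (coalgMap b)) z).trans ?_
  rw [CoalgHom.comp_assoc, projSnd_prodLift, coactAlong_apply]
  exact (LinearMap.congr_fun (LinearMap.rTensor_comp_lTensor _ _ _) _).symm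

theorem pair_injective {φ : E ⟶ D} {ψ : F ⟶ D} {a : Z ⟶ E} {b : Z ⟶ F}
    (h : IsPullback a b φ ψ) : Function.Injective (pair a b) := isPullback_injective h

theorem exists_pair_eq {φ : E ⟶ D} {ψ : F ⟶ D} {a : Z ⟶ E} {b : Z ⟶ F}
    (h : IsPullback a b φ ψ) (t : E.obj ⊗[k] F.obj)
    (ht : actL (coactAlong (coalgMap φ)) F.obj t = actR E.obj (coactAlong (coalgMap ψ)) t) :
    ∃ z, pair a b z = t :=
  isPullback_exists h t (ht.trans (Comodule.actR_lTensor_comp _ _ _))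

end CocommCoalg

end Pairs

/-! ### The monoidal structure of `U^D` and the LNL adjunction. -/

section MonoidalU

variable {k : Type u} [Field k]

open Functor.LaxMonoidal Functor.OplaxMonoidal CartesianMonoidalCategory

variable {D : CocommCoalg k}

/-- The morphism `U Z ⟶ U X ⊗ U Y` with components `a : Z ⟶ X` and `b : Z ⟶ Y`. -/
def pairU {Z X Y : Over D} (a : Z ⟶ X) (b : Z ⟶ Y) :
    (forgetU D).obj Z ⟶ (forgetU D).obj X ⊗ (forgetU D).obj Y :=
  Comodule.homMk (P := (forgetU D).obj Z) (V := (forgetU D).obj X) (W := (forgetU D).obj Y)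
    (CocommCoalg.pair a.left b.left)
    (fun z => (CocommCoalg.actL_pair X.hom a.left b.left z).trans
      ((congrArg (fun c : Z.left ⟶ D => (CocommCoalg.pair a.left b.left).rTensor D.obj
        (coactAlong (coalgMap c) z)) ((Over.w a).trans (Over.w b).symm)).trans
        (CocommCoalg.actR_pair Y.hom a.left b.left z).symm))
    (fun z => Eq.trans (congrArg (fun c : Z.left ⟶ D => (CocommCoalg.pair a.left b.left).rTensor
        D.obj (coactAlong (coalgMap c) z)) (Over.w b).symm)
      (CocommCoalg.actR_pair Y.hom a.left b.left z).symm)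

theorem map_comp_pairU {Z' Z X Y : Over D} (g : Z' ⟶ Z) (a : Z ⟶ X) (b : Z ⟶ Y) :
    (forgetU D).map g ≫ pairU a b = pairU (g ≫ a) (g ≫ b) := by
  apply Comodule.hom_ext
  apply LinearMap.ext
  intro z
  apply Comodule.incl_injective
  exact CocommCoalg.pair_comp g.left a.left b.left z

theorem pairU_comp_map {Z X Y X' Y' : Over D} (a : Z ⟶ X) (b : Z ⟶ Y) (a' : X ⟶ X')
    (b' : Y ⟶ Y') : pairU a b ≫ ((forgetU D).map a' ⊗ₘ (forgetU D).map b') =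
      pairU (a ≫ a') (b ≫ b') := by
  apply Comodule.hom_ext
  apply LinearMap.ext
  intro z
  apply Comodule.incl_injective
  exact CocommCoalg.map_pair a.left b.left a'.left b'.left z

theorem pairU_braiding {Z X Y : Over D} (a : Z ⟶ X) (b : Z ⟶ Y) :
    pairU a b ≫ (β_ _ _).hom = pairU b a := by
  apply Comodule.hom_ext
  apply LinearMap.ext
  intro z
  apply Comodule.incl_injective
  exact CocommCoalg.comm_pair a.left b.left z

/-- Both sides send `z` to its threefold coproduct with the three components applied. The
intermediate objects `P` and `Q` leave room for the two bracketings of a triple product. -/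
theorem pairU_associator {Z P Q X Y W : Over D} (a : P ⟶ X) (b : P ⟶ Y) (p : Z ⟶ P) (c : Z ⟶ W)
    (a' : Z ⟶ X) (q : Z ⟶ Q) (b' : Q ⟶ Y) (c' : Q ⟶ W) (ha : p ≫ a = a') (hb : p ≫ b = q ≫ b')
    (hc : c = q ≫ c') :
    pairU p c ≫ pairU a b ▷ (forgetU D).obj W ≫ (α_ _ _ _).hom =
      pairU a' q ≫ (forgetU D).obj X ◁ pairU b' c' := by
  apply Comodule.hom_ext
  apply LinearMap.ext
  intro z
  apply Comodule.inclR_injective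
  have hb' : p.left ≫ b.left = q.left ≫ b'.left := congrArg CommaMorphism.left hb
  refine (Comodule.inclR_assocHom _ _ _ _).trans ?_
  refine (congrArg (TensorProduct.assoc k _ _ _) ((LinearMap.rTensor_comp_apply _
    (Comodule.incl _ _) (pairU a b).lin (CocommCoalg.pair p.left c.left z)).symm.trans
    (CocommCoalg.rTensor_pair a.left b.left p.left c.left z))).trans ?_
  refine Eq.trans ?_ ((LinearMap.lTensor_comp_apply _ (Comodule.incl _ _) (pairU b' c').lin
    (CocommCoalg.pair a'.left q.left z)).symm.trans
    (CocommCoalg.lTensor_pair b'.left c'.left q.left a'.left z)).symm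
  rw [hb']
  subst ha hc
  exact CocommCoalg.assoc_map_pair (p.left ≫ a.left) (q.left ≫ b'.left) (q.left ≫ c'.left) z

variable [HasPullbacks (CocommCoalg k)]

attribute [local instance] Over.cartesianMonoidalCategory Over.braidedCategory

variable (D) in
/-- The unit comparison of `U^D`, the identity of `D`. -/
def unitU : (forgetU D).obj (𝟙_ (Over D)) ⟶ 𝟙_ (VecC D) where
  lin := (LinearMap.id : D.obj →ₗ[k] D.obj)
  comm := by
    apply LinearMap.ext
    intro d
    have h : ∀ t : D.obj ⊗[k] D.obj, (LinearMap.id : D.obj →ₗ[k] D.obj).rTensor D.obj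
      ((LinearMap.id : D.obj →ₗ[k] D.obj).lTensor D.obj t) = t := by simp
    exact h (comul (R := k) (A := D.obj) d)

theorem pairU_leftUnitor {Z X : Over D} (a : Z ⟶ 𝟙_ (Over D)) (b : Z ⟶ X) :
    pairU a b ≫ unitU D ▷ (forgetU D).obj X ≫ (λ_ _).hom = (forgetU D).map b := by
  apply Comodule.forgetMod.map_injective
  rw [Functor.map_comp, Functor.map_comp, Comodule.map_leftUnitor,
    reassoc_of% Comodule.map_whiskerRight_ι, ← MonoidalCategory.comp_whiskerRight_assoc]
  apply ModuleCat.hom_ext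
  apply LinearMap.ext
  intro z
  exact CocommCoalg.rTensor_counit_pair a.left b.left z

theorem pairU_rightUnitor {Z X : Over D} (b : Z ⟶ X) (a : Z ⟶ 𝟙_ (Over D)) :
    pairU b a ≫ (forgetU D).obj X ◁ unitU D ≫ (ρ_ _).hom = (forgetU D).map b := by
  apply Comodule.forgetMod.map_injective
  rw [Functor.map_comp, Functor.map_comp, Comodule.map_rightUnitor,
    reassoc_of% Comodule.map_whiskerLeft_ι, ← MonoidalCategory.whiskerLeft_comp_assoc]
  apply ModuleCat.hom_ext
  apply LinearMap.ext
  intro z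
  exact CocommCoalg.lTensor_counit_pair b.left a.left z

variable (D) in
/-- The oplax monoidal structure of `U^D`. -/
abbrev oplaxU : (forgetU D).OplaxMonoidal where
  η := unitU D
  δ X Y := pairU (fst X Y) (snd X Y)
  δ_natural_left {X X'} f Y := by
    rw [map_comp_pairU, ← MonoidalCategory.tensorHom_id, ← (forgetU D).map_id, pairU_comp_map]
    simp
  δ_natural_right {Y Y'} X f := by
    rw [map_comp_pairU, ← MonoidalCategory.id_tensorHom, ← (forgetU D).map_id, pairU_comp_map]
    simp
  oplax_associativity X Y Z := by
    rw [reassoc_of% map_comp_pairU]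
    exact pairU_associator _ _ _ _ _ _ _ _ (by simp) (by simp) (by simp)
  oplax_left_unitality X := by
    rw [← cancel_mono (λ_ _).hom, Category.assoc, Category.assoc, pairU_leftUnitor,
      ← Functor.map_comp]
    simp
  oplax_right_unitality X := by
    rw [← cancel_mono (ρ_ _).hom, Category.assoc, Category.assoc, pairU_rightUnitor,
      ← Functor.map_comp]
    simp

instance : IsIso (unitU D) := Comodule.isIso_of_bijective _ Function.bijective_id

/-- A product over `D` is a fibre product of coalgebras, and its underlying space is the cotensor
product. -/
theorem isIso_pairU {Z X Y : Over D} (a : Z ⟶ X) (b : Z ⟶ Y)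
    (h : IsPullback a.left b.left X.hom Y.hom) : IsIso (pairU a b) := by
  refine Comodule.isIso_of_bijective _ ⟨fun x y hxy => ?_, fun t => ?_⟩
  · exact CocommCoalg.pair_injective h (congrArg (Comodule.incl _ _) hxy)
  · obtain ⟨z, hz⟩ := CocommCoalg.exists_pair_eq h (Comodule.incl _ _ t) (Comodule.incl_eq _ _ t)
    exact ⟨z, Comodule.incl_injective _ _ hz⟩

instance (X Y : Over D) : IsIso (pairU (fst X Y) (snd X Y)) :=
  isIso_pairU _ _ (IsPullback.of_hasPullback X.hom Y.hom)

variable (D) in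
/-- The strong monoidal structure of `U^D`. -/
abbrev monoidalU : (forgetU D).Monoidal :=
  letI := oplaxU D
  haveI : IsIso (η (forgetU D)) := inferInstanceAs (IsIso (unitU D))
  haveI : ∀ X Y, IsIso (δ (forgetU D) X Y) := fun X Y =>
    inferInstanceAs (IsIso (pairU (fst X Y) (snd X Y)))
  Functor.Monoidal.ofOplaxMonoidal (forgetU D)

theorem map_braiding_pairU (X Y : Over D) :
    (forgetU D).map (β_ X Y).hom ≫ pairU (fst Y X) (snd Y X) =
      pairU (fst X Y) (snd X Y) ≫ (β_ _ _).hom := by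
  rw [map_comp_pairU, pairU_braiding]
  simp

variable (D) in
/-- The symmetric monoidal structure of `U^D`. -/
abbrev braidedU : (forgetU D).Braided :=
  { monoidalU D with
    braided := fun X Y => by
      let := monoidalU D
      have h := map_braiding_pairU X Y
      have h1 : ∀ X Y, pairU (fst X Y) (snd X Y) = δ (forgetU D) X Y := fun _ _ => rfl
      rw [h1, h1] at h
      rw [← cancel_epi (δ (forgetU D) X Y), ← cancel_mono (δ (forgetU D) Y X)]
      simp [h] }

variable (D) in
/-- The linear-non-linear adjunction `U^D ⊣ R^D` over a cosemisimple coalgebra `D`. -/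
def lnlAdjunction (hD : IsCosemisimple k D.obj) : LNLAdjunction (forgetU D) :=
  letI := braidedU D
  haveI := forgetU_isLeftAdjoint D hD
  let adj := Adjunction.ofIsLeftAdjoint (forgetU D)
  -- Transporting the monoidal structure of `U^D` along the adjunction makes the unit and the counit
  -- monoidal by construction.
  letI : (forgetU D).rightAdjoint.LaxMonoidal := adj.rightAdjointLaxMonoidal
  haveI : adj.IsMonoidal := { leftAdjoint_ε := rfl, leftAdjoint_μ := fun _ _ => rfl }
  letI : (forgetU D).rightAdjoint.LaxBraided :=
    { braided := rightAdjoint_braided adj map_braiding_pairU }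
  { cartesian := Over.cartesianMonoidalCategory D
    braided := Over.braidedCategory D
    closed := Comodule.monoidalClosed hD
    monoidalU := braidedU D
    R := (forgetU D).rightAdjoint
    adj := adj
    unit_monoidal := inferInstance
    counit_monoidal := inferInstance }

end MonoidalU

/-! ### Mates of a square of left adjoints and compatibility with units. -/

section UnitComparison

variable {𝒞 𝒞' ℳ ℳ' : Type*} [Category* 𝒞] [Category* 𝒞'] [Category* ℳ] [Category* ℳ']
  {U : 𝒞 ⥤ ℳ} {R : ℳ ⥤ 𝒞} {U' : 𝒞' ⥤ ℳ'} {R' : ℳ' ⥤ 𝒞'} {S : 𝒞' ⥤ 𝒞} {L : 𝒞 ⥤ 𝒞'}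
  {P : ℳ' ⥤ ℳ} {K : ℳ ⥤ ℳ'} (adjU : U ⊣ R) (adjU' : U' ⊣ R') (adjS : S ⊣ L) (adjP : P ⊣ K)
  (e : U' ⋙ P ⟶ S ⋙ U)

/-- The transformation `L ⋙ U' ⟶ U ⋙ K` corresponding to `U' ⋙ P ⟶ S ⋙ U` under adjunctions
`S ⊣ L` and `P ⊣ K`. -/
def leftMate : L ⋙ U' ⟶ U ⋙ K where
  app X := adjP.homEquiv _ _ (e.app (L.obj X) ≫ U.map (adjS.counit.app X))
  naturality X Y g := by
    have h := e.naturality (L.map g)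
    simp only [Functor.comp_map] at h ⊢
    rw [← Adjunction.homEquiv_naturality_left, ← Adjunction.homEquiv_naturality_right,
      reassoc_of% h, Category.assoc, ← Functor.map_comp, ← Functor.map_comp,
      adjS.counit_naturality]

theorem map_leftMate_counit (X : 𝒞) :
    P.map ((leftMate adjS adjP e).app X) ≫ adjP.counit.app (U.obj X) =
      e.app (L.obj X) ≫ U.map (adjS.counit.app X) :=
  (adjP.homEquiv_counit _ _ _).symm.trans (Equiv.symm_apply_apply _ _)

/-- Both comparisons come from the single transformation `e`: one is its conjugate along the
composite adjunctions, the other its partial mate. Transposing to the left adjoints reduces the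
identity to naturality and the triangle laws. It supplies `LNLMorphism.unit_comp`. -/
theorem map_unit_conjugateEquiv (X : 𝒞) :
    L.map (adjU.unit.app X) ≫
      (conjugateEquiv (adjS.comp adjU) (adjU'.comp adjP) e).app (U.obj X) =
    adjU'.unit.app (L.obj X) ≫ R'.map ((leftMate adjS adjP e).app X) := by
  apply ((adjU'.comp adjP).homEquiv _ _).symm.injective
  rw [Adjunction.homEquiv_counit, Adjunction.homEquiv_counit, Functor.map_comp, Category.assoc,
    conjugateEquiv_counit, Adjunction.comp_counit_app, Adjunction.comp_counit_app]
  have h : P.map (U'.map (L.map (adjU.unit.app X))) ≫ e.app (L.obj (R.obj (U.obj X))) =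
    e.app (L.obj X) ≫ U.map (S.map (L.map (adjU.unit.app X))) := e.naturality _
  simp only [Functor.comp_map, Functor.map_comp, Category.assoc]
  refine ((reassoc_of% h) _).trans ?_
  rw [← Functor.map_comp_assoc, adjS.counit_naturality, Functor.map_comp_assoc,
    adjU.left_triangle_components, Category.comp_id, ← map_leftMate_counit adjS adjP,
    ← P.map_comp_assoc (U'.map (R'.map _)), adjU'.counit_naturality, Functor.map_comp_assoc,
    ← P.map_comp_assoc (U'.map (adjU'.unit.app _))]
  exact (Category.id_comp _).symm.trans (congrArg (· ≫ _) ((P.map_id _).symm.trans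
    (congrArg P.map (adjU'.left_triangle_components (L.obj X)).symm)))

/-- A morphism of linear-non-linear adjunctions `(L, K)` where `L` and `K` have left adjoints
compatible with `U` and `U'`. -/
def LNLMorphism.ofLeftAdjoints [MonoidalCategory ℳ] [SymmetricCategory ℳ]
    [MonoidalCategory ℳ'] [SymmetricCategory ℳ'] (A : LNLAdjunction U) (A' : LNLAdjunction U')
    (i : U' ⋙ P ≅ S ⋙ U) (isoU : U ⋙ K ≅ L ⋙ U') (hU : isoU.inv = leftMate adjS adjP i.hom)
    [PreservesFiniteProducts L] [K.Braided]
    (closedK : letI := A.closed; letI := A'.closed; ∀ X Y : ℳ, IsIso (closedComparison K X Y))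
    (isoU_monoidal :
      letI := A.cartesian; letI := A.braided; letI := A'.cartesian; letI := A'.braided
      letI := A.monoidalU; letI := A'.monoidalU
      letI := Functor.Braided.ofChosenFiniteProducts L
      NatTrans.IsMonoidal isoU.hom) : LNLMorphism A A' L K where
  closedK := closedK
  isoU := isoU
  isoU_monoidal := isoU_monoidal
  isoR := conjugateIsoEquiv (adjS.comp A.adj) (A'.adj.comp adjP) i
  unit_comp X := by
    have h := map_unit_conjugateEquiv A.adj A'.adj adjS adjP i.hom X
    refine ((reassoc_of% h) _).trans ?_
    rw [← Functor.map_comp, ← hU, Iso.inv_hom_id_app]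
    exact (congrArg (_ ≫ ·) (A'.R.map_id _)).trans (Category.comp_id _)

end UnitComparison

/-! ### Coherence of pullback of slice categories. -/

section PullbackL

variable {𝒜 : Type*} [Category* 𝒜] [HasPullbacks 𝒜]

theorem overPullback_hom_ext {E D : 𝒜} {f : E ⟶ D} {P : Over E} {X : Over D}
    {a b : P ⟶ (Over.pullback f).obj X}
    (h : a.left ≫ pullback.fst X.hom f = b.left ≫ pullback.fst X.hom f) : a = b := by
  apply Over.OverMorphism.ext
  apply pullback.hom_ext h
  exact (Over.w a).trans (Over.w b).symm

theorem overPullback_map_fst {E D : 𝒜} (f : E ⟶ D) {X Y : Over D} (a : X ⟶ Y) :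
    ((Over.pullback f).map a).left ≫ pullback.fst Y.hom f = pullback.fst X.hom f ≫ a.left :=
  pullback.lift_fst _ _ _

theorem overPullback_counit_left {E D : 𝒜} (f : E ⟶ D) (X : Over D) :
    ((Over.mapPullbackAdj f).counit.app X).left = pullback.fst X.hom f := by
  simp

theorem overPullbackId_left {D : 𝒜} (X : Over D) :
    ((Over.pullbackId (X := D)).hom.app X).left = pullback.fst X.hom (𝟙 D) := by
  have h := congrArg CommaMorphism.left (conjugateEquiv_counit (Over.mapPullbackAdj (𝟙 D))
    Adjunction.id (Over.mapId D).symm.hom X)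
  exact (Category.comp_id _).symm.trans (h.trans ((Category.id_comp _).trans
    (overPullback_counit_left (𝟙 D) X)))

/-- The comparison is a conjugate, so it is compatible with the counits, and these are the first
projections of the pullbacks. -/
theorem overPullbackComp_left {G E D : 𝒜} (g : G ⟶ E) (f : E ⟶ D) (X : Over D) :
    ((Over.pullbackComp g f).hom.app X).left ≫
      pullback.fst ((Over.pullback f).obj X).hom g ≫ pullback.fst X.hom f =
    pullback.fst X.hom (g ≫ f) := by
  have h := congrArg CommaMorphism.left (conjugateEquiv_counit (Over.mapPullbackAdj (g ≫ f))
    ((Over.mapPullbackAdj g).comp (Over.mapPullbackAdj f)) (Over.mapComp g f).symm.hom X)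
  rw [Adjunction.comp_counit_app] at h
  refine Eq.trans ?_ (h.trans ((Category.id_comp _).trans (overPullback_counit_left (g ≫ f) X)))
  refine congrArg (_ ≫ ·) ?_
  exact (congrArg₂ (· ≫ ·) (overPullback_counit_left g ((Over.pullback f).obj X))
    (overPullback_counit_left f X)).symm

theorem overPullback_eqToHom_fst {E D : 𝒜} {f f' : E ⟶ D} (e : f = f') (X : Over D)
    (h : (Over.pullback f).obj X = (Over.pullback f').obj X) :
    (eqToHom h).left ≫ pullback.fst X.hom f' = pullback.fst X.hom f := by
  subst e
  exact Category.id_comp _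

theorem overPullback_hom_ext₃ {H G E D : 𝒜} {h : H ⟶ G} {g : G ⟶ E} {f : E ⟶ D} {P : Over H}
    {X : Over D} {a b : P ⟶ (Over.pullback h).obj ((Over.pullback g).obj ((Over.pullback f).obj X))}
    (hab : a.left ≫ pullback.fst ((Over.pullback g).obj ((Over.pullback f).obj X)).hom h ≫
        pullback.fst ((Over.pullback f).obj X).hom g ≫ pullback.fst X.hom f =
      b.left ≫ pullback.fst ((Over.pullback g).obj ((Over.pullback f).obj X)).hom h ≫
        pullback.fst ((Over.pullback f).obj X).hom g ≫ pullback.fst X.hom f) : a = b := by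
  apply ((Over.mapPullbackAdj h).homEquiv _ _).symm.injective
  apply ((Over.mapPullbackAdj g).homEquiv _ _).symm.injective
  apply overPullback_hom_ext
  simpa [Adjunction.homEquiv_counit] using hab

/-- `f ↦ L_f` is a pseudofunctor on any full subcategory. -/
def psL (Q : ObjectProperty 𝒜) : PseudofunctorStructure (B := Q.FullSubcategory)
    (F := fun D => Over D.obj)
    (fun {J I : Q.FullSubcategory} (f : J ⟶ I) => Over.pullback f.hom) where
  mapId _ := Over.pullbackId
  mapComp g f := Over.pullbackComp g.hom f.hom
  assoc h g f X := by
    refine overPullback_hom_ext₃ (h := h.hom) (g := g.hom) (f := f.hom) ?_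
    have h1 := overPullbackComp_left (h.hom ≫ g.hom) f.hom X
    have h2 := overPullbackComp_left h.hom g.hom ((Over.pullback f.hom).obj X)
    have h3 := overPullbackComp_left h.hom (g.hom ≫ f.hom) X
    have h4 := overPullbackComp_left g.hom f.hom X
    have h5 := overPullback_map_fst h.hom ((Over.pullbackComp g.hom f.hom).hom.app X)
    have h6 : (eqToHom (show (Over.pullback ((h.hom ≫ g.hom) ≫ f.hom)).obj X =
        (Over.pullback (h.hom ≫ g.hom ≫ f.hom)).obj X by simp only [Category.assoc])).left ≫
        pullback.fst X.hom (h.hom ≫ g.hom ≫ f.hom) = _ :=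
      overPullback_eqToHom_fst (Category.assoc h.hom g.hom f.hom) X _
    -- Composed with the three projections, both sides reduce to the single projection of the total
    -- pullback.
    refine Eq.trans (b := pullback.fst X.hom ((h.hom ≫ g.hom) ≫ f.hom)) ?_ ?_
    · refine (Category.assoc _ _ _).trans ?_
      refine (congrArg (_ ≫ ·) ((Category.assoc _ _ _).symm.trans
        ((Category.assoc _ _ _).symm.trans (congrArg (· ≫ _) ((Category.assoc _ _ _).trans h2))))).trans
        ?_
      exact h1
    · refine Eq.symm ?_
      refine (Category.assoc _ _ _).trans ?_
      refine (congrArg (_ ≫ ·) ((Category.assoc _ _ _).trans (congrArg (_ ≫ ·)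
        ((Category.assoc _ _ _).symm.trans ((congrArg (· ≫ _) h5).trans
          ((Category.assoc _ _ _).trans (congrArg (_ ≫ ·) h4))))))).trans ?_
      exact (congrArg (_ ≫ ·) h3).trans h6
  id_left f X := by
    refine overPullback_hom_ext (f := f.hom) ?_
    refine (Category.assoc _ _ _).trans ?_
    refine (congrArg (_ ≫ · ≫ _) (overPullbackId_left _)).trans ?_
    refine (overPullbackComp_left (𝟙 _) f.hom X).trans ?_
    exact (overPullback_eqToHom_fst (Category.id_comp f.hom) X _).symm
  id_right f X := by
    refine overPullback_hom_ext (f := f.hom) ?_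
    refine (Category.assoc _ _ _).trans ?_
    refine (congrArg (_ ≫ ·) ((overPullback_map_fst f.hom (Over.pullbackId.hom.app X)).trans
      (congrArg (_ ≫ ·) (overPullbackId_left X)))).trans ?_
    refine (overPullbackComp_left f.hom (𝟙 _) X).trans ?_
    exact (overPullback_eqToHom_fst (Category.comp_id f.hom) X _).symm

end PullbackL

/-! ### The morphism `(L_f, K_f)` of LNL adjunctions. -/

section MorphismLK

variable {k : Type u} [Field k] [HasPullbacks (CocommCoalg k)] {E D : CocommCoalg k}
  (f : E ⟶ D)

open Functor.LaxMonoidal Functor.OplaxMonoidal CartesianMonoidalCategory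

/-- `f_! U^E = U^D f_!`. -/
def pushKU : forgetU E ⋙ pushK f ≅ Over.map f ⋙ forgetU D :=
  NatIso.ofComponents (fun X => Comodule.isoMk (V := (pushK f).obj ((forgetU E).obj X))
    (W := (forgetU D).obj ((Over.map f).obj X)) (LinearEquiv.refl k X.left.obj)
    (LinearMap.ext fun z => by
      have h : ∀ t : X.left.obj ⊗[k] X.left.obj,
          (LinearMap.id : X.left.obj →ₗ[k] X.left.obj).rTensor D.obj
          ((coalgMap f : E.obj →ₗ[k] D.obj).lTensor X.left.obj
            ((coalgMap X.hom : X.left.obj →ₗ[k] E.obj).lTensor X.left.obj t)) =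
          (coalgMap (X.hom ≫ f) : X.left.obj →ₗ[k] D.obj).lTensor X.left.obj t := by
        intro t
        rw [LinearMap.rTensor_id_apply, ← LinearMap.lTensor_comp_apply, linearCoe_coalgMap_comp]
      exact h (comul (R := k) (A := X.left.obj) z))) (fun _ => rfl)

/-- The comparison `U^E L_f ⟶ K_f U^D`. -/
def mateU : Over.pullback f ⋙ forgetU E ⟶ forgetU D ⋙ pullK f :=
  leftMate (Over.mapPullbackAdj f) (adjK f) (pushKU f).hom

theorem evalK_mateU (X : Over D) (z : ((Over.pullback f).obj X).left.obj) :
    evalK f _ (((mateU f).app X).lin z) = coalgMap (pullback.fst X.hom f) z := by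
  refine (homEquiv_adjK_eval f ((pushKU f).hom.app _ ≫
    (forgetU D).map ((Over.mapPullbackAdj f).counit.app X)) z).trans ?_
  exact DFunLike.congr_fun (congrArg (fun a => coalgMap a) (overPullback_counit_left f X)) z

/-- Colinearity recovers `h` from its evaluation: composed with the inclusion into `X ⊗ E` it is `z
↦ a(z₁) ⊗ z₂`, which maps a pullback bijectively onto the cotensor product. It serves both for
`mateU` and for the squares of the Beck–Chevalley condition. -/
theorem isIso_of_evalK_eq {Z : Over E} {X : Over D} (a : Z.left ⟶ X.left)
    (ha : IsPullback a Z.hom X.hom f) (h : (forgetU E).obj Z ⟶ (pullK f).obj ((forgetU D).obj X))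
    (h₁ : ∀ z : Z.left.obj, evalK f _ (h.lin z) = coalgMap a z) : IsIso h := by
  have h₂ : ∀ z : Z.left.obj, Comodule.pullIncl (coalgMap f) ((forgetU D).obj X) (h.lin z) =
      CocommCoalg.pair a Z.hom z := by
    intro z
    refine (Comodule.rTensor_pullEval_coact (coalgMap f) _ _).symm.trans ?_
    refine (congrArg _ (Comodule.hom_comm_apply h z).symm).trans ?_
    refine (LinearMap.rTensor_comp_apply _ _ _ _).symm.trans ?_
    have h₃ : evalK f _ ∘ₗ h.lin = (coalgMap a : Z.left.obj →ₗ[k] X.left.obj) := LinearMap.ext h₁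
    refine (LinearMap.congr_fun (congrArg (LinearMap.rTensor E.obj) h₃) _).trans ?_
    exact LinearMap.congr_fun (LinearMap.rTensor_comp_lTensor _ _ _) _
  refine Comodule.isIso_of_bijective _ ⟨fun x y hxy => ?_, fun t => ?_⟩
  · exact CocommCoalg.pair_injective ha ((h₂ x).symm.trans ((congrArg _ hxy).trans (h₂ y)))
  · obtain ⟨z, hz⟩ := CocommCoalg.isPullback_exists ha
      (Comodule.pullIncl (coalgMap f) ((forgetU D).obj X) t)
      (Comodule.pullIncl_eq (coalgMap f) ((forgetU D).obj X) t)
    exact ⟨z, Comodule.pullIncl_injective _ _ ((h₂ z).trans hz)⟩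

instance : IsIso (mateU f) :=
  have : ∀ X, IsIso ((mateU f).app X) := fun X =>
    isIso_of_evalK_eq f (pullback.fst X.hom f) (IsPullback.of_hasPullback X.hom f) _
      (evalK_mateU f X)
  NatIso.isIso_of_isIso_app _

/-- The isomorphism `K_f U^D ≅ U^E L_f`. -/
def isoKU : forgetU D ⋙ pullK f ≅ Over.pullback f ⋙ forgetU E := (asIso (mateU f)).symm

theorem isoKU_inv : (isoKU f).inv = leftMate (Over.mapPullbackAdj f) (adjK f) (pushKU f).hom := by
  change (asIso (mateU f)).symm.inv = mateU f
  rw [Iso.symm_inv, asIso_hom]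

attribute [local instance] Over.cartesianMonoidalCategory Over.braidedCategory braidedU

theorem unitU_ε (D : CocommCoalg k) (d : D.obj) : (ε (forgetU D)).lin d = d := by
  have h : ε (forgetU D) ≫ unitU D = 𝟙 _ := Functor.Monoidal.ε_η (forgetU D)
  exact LinearMap.congr_fun (congrArg Comodule.Hom.lin h) d

/-- After evaluation and inclusion into the plain tensor product both sides become a pair of
projections. It is phrased with the explicit maps `pairU` because the lax structure of `U` is
available only as their inverse. -/
theorem map_μ_mateU (X Y : Over D) : (forgetU E).map (μ (Over.pullback f) X Y) ≫
    (mateU f).app (X ⊗ Y) ≫ (pullK f).map (pairU (fst X Y) (snd X Y)) =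
      pairU (fst _ _) (snd _ _) ≫ ((mateU f).app X ⊗ₘ (mateU f).app Y) ≫ μ (pullK f) _ _ := by
  refine pullK_hom_ext f fun z => ?_
  apply Comodule.incl_injective
  refine (congrArg _ (evalK_map f (pairU (fst X Y) (snd X Y)) _)).trans ?_
  refine (congrArg (CocommCoalg.pair _ _) (evalK_mateU f (X ⊗ Y) _)).trans ?_
  refine (CocommCoalg.pair_comp _ _ _ _).trans ((CocommCoalg.pair_comp _ _ _ _).trans ?_)
  refine Eq.symm ((incl_evalK_μ f _ _ _).trans ?_)
  refine (TensorProduct.map_map _ _ _ _ _).trans ?_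
  have h : ∀ X : Over D, evalK f _ ∘ₗ ((mateU f).app X).lin = (coalgMap (pullback.fst X.hom f) :
    (pullback X.hom f).obj →ₗ[k] X.left.obj) := fun X => LinearMap.ext (evalK_mateU f X)
  refine (congrArg₂ (fun a b => TensorProduct.map a b _) (h X) (h Y)).trans ?_
  refine (CocommCoalg.map_pair _ _ (pullback.fst X.hom f) (pullback.fst Y.hom f) z).trans ?_
  exact congrArg₂ (fun a b => CocommCoalg.pair a b z) (Over.μ_pullback_left_fst_fst X Y).symm
    (Over.μ_pullback_left_fst_snd X Y).symm

theorem mateU_monoidal : NatTrans.IsMonoidal (mateU f) where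
  unit := by
    refine pullK_hom_ext f fun d => ?_
    refine (evalK_mateU f _ _).trans ?_
    refine Eq.symm ((evalK_map f (ε (forgetU D)) _).trans ?_)
    refine (unitU_ε D _).trans ?_
    refine (evalK_ε f _).trans ?_
    have h : (ε (Over.pullback f)).left ≫ pullback.fst (𝟙 D) f = f := by
      rw [Over.ε_pullback_left, IsIso.inv_comp_eq, ← pullback.condition, Category.comp_id]
    refine Eq.trans ?_ (congrArg (fun y => coalgMap (pullback.fst (𝟙 D) f)
      (coalgMap (ε (Over.pullback f)).left y)) (unitU_ε E d).symm)
    exact DFunLike.congr_fun (congrArg (fun a => coalgMap a) h.symm) d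
  tensor X Y := by
    rw [Functor.LaxMonoidal.comp_μ, Functor.LaxMonoidal.comp_μ]
    rw [← cancel_epi (δ (forgetU E) _ _), ← cancel_mono ((pullK f).map (δ (forgetU D) X Y))]
    simp only [Category.assoc, Functor.Monoidal.δ_μ_assoc]
    rw [← Functor.map_comp, Functor.Monoidal.μ_δ, CategoryTheory.Functor.map_id, Category.comp_id]
    exact map_μ_mateU f X Y

theorem isoKU_monoidal : NatTrans.IsMonoidal (isoKU f).hom :=
  have : NatTrans.IsMonoidal (asIso (mateU f)).hom := mateU_monoidal f
  inferInstanceAs (NatTrans.IsMonoidal (asIso (mateU f)).inv)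

theorem closedComparison_pullK (hD : IsCosemisimple k D.obj) (hE : IsCosemisimple k E.obj)
    (X Y : VecC D) :
    letI := Comodule.monoidalClosed hD
    letI := Comodule.monoidalClosed hE
    IsIso (closedComparison (pullK f) X Y) := by
  let := Comodule.monoidalClosed hD
  let := Comodule.monoidalClosed hE
  exact isIso_closedComparison (adjK f) (Comodule.corestrict_braided (coalgMap f)) X Y

/-- `(L_f, K_f)` is a morphism of linear-non-linear adjunctions. -/
def lnlMorphism (hD : IsCosemisimple k D.obj) (hE : IsCosemisimple k E.obj) :
    LNLMorphism (lnlAdjunction D hD) (lnlAdjunction E hE) (Over.pullback f) (pullK f) :=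
  have := (Over.mapPullbackAdj f).rightAdjoint_preservesLimits.{0, 0}
  LNLMorphism.ofLeftAdjoints (Over.mapPullbackAdj f) (adjK f) (lnlAdjunction D hD)
    (lnlAdjunction E hE) (pushKU f) (isoKU f) (isoKU_inv f) (closedComparison_pullK f hD hE)
    (isoKU_monoidal f)

theorem isoKU_pullKId (D : CocommCoalg k) (X : Over D) :
    (isoKU (𝟙 D)).hom.app X ≫ (forgetU D).map (Over.pullbackId.hom.app X) =
      (pullKId D).hom.app ((forgetU D).obj X) := by
  rw [← cancel_epi ((isoKU (𝟙 D)).inv.app X), Iso.inv_hom_id_app_assoc]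
  apply Comodule.hom_ext
  apply LinearMap.ext
  intro z
  refine Eq.trans ?_ ((pullKId_lin _ _).trans (evalK_mateU (𝟙 D) X z)).symm
  exact DFunLike.congr_fun (congrArg (fun a => coalgMap a) (overPullbackId_left X)) z

theorem isoKU_pullKComp {G : CocommCoalg k} (g : G ⟶ E) (X : Over D) :
    (isoKU (g ≫ f)).hom.app X ≫ (forgetU G).map ((Over.pullbackComp g f).hom.app X) =
      (pullKComp g f).hom.app ((forgetU D).obj X) ≫ (pullK g).map ((isoKU f).hom.app X) ≫
        (isoKU g).hom.app ((Over.pullback f).obj X) := by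
  rw [← cancel_epi ((isoKU (g ≫ f)).inv.app X), Iso.inv_hom_id_app_assoc,
    ← cancel_mono ((isoKU g).inv.app ((Over.pullback f).obj X)),
    ← cancel_mono ((pullK g).map ((isoKU f).inv.app X))]
  simp only [Category.assoc]
  rw [Iso.hom_inv_id_app_assoc, ← Functor.map_comp, Iso.hom_inv_id_app]
  refine pullK_hom_ext₂ (g := g) (f := f) fun z => ?_
  refine (congrArg (evalK f _) (evalK_map g ((mateU f).app X) _)).trans ?_
  refine (evalK_mateU f X _).trans ?_
  refine (congrArg (fun y => coalgMap (pullback.fst X.hom f) y) (evalK_mateU g _ _)).trans ?_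
  refine (DFunLike.congr_fun (congrArg (fun a => coalgMap a) (overPullbackComp_left g f X)) z).trans
    ?_
  refine Eq.symm ?_
  exact (congrArg (evalK f _) (evalK_map g (𝟙 _) _)).trans
    ((evalK_pullKComp g f _ _).trans (evalK_mateU (g ≫ f) X z))

end MorphismLK

/-! ### Beck–Chevalley for right adjoints from Beck–Chevalley for left adjoints. -/

section IteratedMate

variable {𝒜 ℬ 𝒞 𝒟 : Type*} [Category* 𝒜] [Category* ℬ] [Category* 𝒞] [Category* 𝒟]
  {F₁ : 𝒜 ⥤ 𝒞} {U₁ : 𝒞 ⥤ 𝒜} {F₂ : ℬ ⥤ 𝒟} {U₂ : 𝒟 ⥤ ℬ} {L₁ : 𝒜 ⥤ ℬ} {R₁ : ℬ ⥤ 𝒜} {L₂ : 𝒞 ⥤ 𝒟}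
  {R₂ : 𝒟 ⥤ 𝒞} (adj₁ : L₁ ⊣ R₁) (adj₂ : L₂ ⊣ R₂) (adj₃ : F₁ ⊣ U₁) (adj₄ : F₂ ⊣ U₂)

-- Taking mates along both pairs of adjunctions gives a conjugate, and conjugates of isomorphisms
-- are isomorphisms. So it suffices to invert the mate along the left adjoints of the other two
-- sides, whose components appear in `h`.
include adj₁ adj₂ in
theorem isIso_mateEquiv_of_isIso_map (b : TwoSquare R₁ F₂ F₁ R₂)
    (h : ∀ X, IsIso (L₂.map (F₁.map (adj₁.unit.app X) ≫ b.natTrans.app (L₁.obj X)) ≫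
      adj₂.counit.app (F₂.obj (L₁.obj X)))) :
    IsIso (mateEquiv adj₄ adj₃ b).natTrans := by
  obtain ⟨a, rfl⟩ := (mateEquiv adj₁ adj₂).surjective b
  rw [iterated_mateEquiv_conjugateEquiv]
  have ha : ∀ X, a.natTrans.app X = L₂.map (F₁.map (adj₁.unit.app X) ≫
      ((mateEquiv adj₁ adj₂) a).natTrans.app (L₁.obj X)) ≫ adj₂.counit.app (F₂.obj (L₁.obj X)) := by
    intro X
    refine Eq.symm ((congrArg (fun g => L₂.map g ≫ adj₂.counit.app _)
      (unit_mateEquiv adj₁ adj₂ a X)).trans ?_)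
    exact (congrArg (fun g => L₂.map g ≫ adj₂.counit.app _)
      (adj₂.homEquiv_unit _ _ (a.natTrans.app X)).symm).trans
      ((adj₂.homEquiv_counit _ _ _).symm.trans (Equiv.symm_apply_apply _ _))
  have : ∀ X, IsIso (a.natTrans.app X) := fun X => by rw [ha]; exact h X
  have : IsIso a.natTrans := NatIso.isIso_of_isIso_app _
  exact inferInstanceAs (IsIso (conjugateEquiv _ _ a.natTrans))

end IteratedMate

/-! ### The Beck–Chevalley condition for comodules. -/

section BeckChevalley

theorem PseudofunctorStructure.squareIso_hom_app {B : Type u} [Category.{v} B] {F : B → Type*}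
    [∀ I, Category* (F I)] {K : ∀ {J I : B}, (J ⟶ I) → (F I ⥤ F J)}
    (ps : PseudofunctorStructure K) {I J I' J' : B} (p : J' ⟶ J) (f : J ⟶ I) (f' : J' ⟶ I')
    (q : I' ⟶ I) (w : f' ≫ q = p ≫ f) (X : F I) :
    (ps.squareIso p f f' q w).hom.app X = (ps.mapComp p f).inv.app X ≫ eqToHom (by rw [w]) ≫
      (ps.mapComp f' q).hom.app X := by
  simp [PseudofunctorStructure.squareIso, eqToHom_app]

variable {k : Type u} [Field k]

theorem Comodule.exists_pullIncl_eq {D C : Type u} [AddCommGroup D] [Module k D] [Coalgebra k D]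
    [IsCocomm k D] [AddCommGroup C] [Module k C] [Coalgebra k C] (f : D →ₗc[k] C)
    (V : Comodule k C) (x : V.carrier ⊗[k] D)
    (h : actL V.coact D x = (f : D →ₗ[k] C).lTensor (V.carrier ⊗[k] D)
      (actR V.carrier (comul : D →ₗ[k] D ⊗[k] D) x)) : ∃ t, pullIncl f V t = x :=
  ⟨⟨x, h⟩, rfl⟩

theorem Comodule.exists_incl_eq {D : Type u} [AddCommGroup D] [Module k D] [Coalgebra k D]
    [IsCocomm k D] (V W : Comodule k D) (x : V.carrier ⊗[k] W.carrier)
    (h : actL V.coact W.carrier x = actR V.carrier W.coact x) : ∃ t, incl V W t = x :=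
  ⟨⟨x, h.trans (lTensor_id_coe _ _).symm⟩, rfl⟩

variable {I J I' J' : CocommCoalg k} {f : J ⟶ I} {p : J' ⟶ J} {f' : J' ⟶ I'} {q : I' ⟶ I}

/-- The comparison of `U^J(p)` and `f^* U^I(q)` for a commutative square `f' ≫ q = p ≫ f`. -/
def squareU (w : f' ≫ q = p ≫ f) : (forgetU J).obj (Over.mk p) ⟶
    (pullK f).obj ((forgetU I).obj (Over.mk q)) :=
  (adjK f).homEquiv _ _ ((pushKU f).hom.app (Over.mk p) ≫
    (forgetU I).map (Over.homMk (U := (Over.map f).obj (Over.mk p)) (V := Over.mk q) f' w))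

theorem evalK_squareU (w : f' ≫ q = p ≫ f) (z : J'.obj) :
    evalK f _ ((squareU w).lin z) = coalgMap f' z :=
  homEquiv_adjK_eval f ((pushKU f).hom.app (Over.mk p) ≫
    (forgetU I).map (Over.homMk (U := (Over.map f).obj (Over.mk p)) (V := Over.mk q) f' w)) z

theorem isIso_squareU (h : IsPullback f' p q f) : IsIso (squareU h.w) :=
  isIso_of_evalK_eq (Z := Over.mk p) (X := Over.mk q) f f' h (squareU h.w) (evalK_squareU h.w)

/-- `p^* Y` and the cotensor product of `Y` with `U^J(p)` are the same subspace of `Y ⊗ J'`, which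
makes the projection formula for `f` applicable to `p^* Y`. -/
theorem exists_incl_of_pullIncl (Y : VecC J) (t : ((pullK p).obj Y).carrier) :
    ∃ x, Comodule.incl Y ((forgetU J).obj (Over.mk p)) x =
      Comodule.pullIncl (coalgMap p) Y t :=
  Comodule.exists_incl_eq Y ((forgetU J).obj (Over.mk p)) _
    ((Comodule.pullIncl_eq (coalgMap p) Y t).trans (Comodule.actR_lTensor_comp _ _ _).symm)

theorem exists_pullIncl_of_incl (Y : VecC J)
    (x : (Comodule.tens Y ((forgetU J).obj (Over.mk p))).carrier) :
    ∃ t, Comodule.pullIncl (coalgMap p) Y t =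
      Comodule.incl Y ((forgetU J).obj (Over.mk p)) x :=
  Comodule.exists_pullIncl_eq (coalgMap p) Y _
    ((Comodule.incl_eq Y ((forgetU J).obj (Over.mk p)) x).trans
      (Comodule.actR_lTensor_comp _ _ _))

/-- The map `Y ⊗^J J' → Y ⊗^I I'`. -/
def squareLin (w : f' ≫ q = p ≫ f) (Y : VecC J) :
    (Comodule.tens Y ((forgetU J).obj (Over.mk p))).carrier →ₗ[k]
      (Comodule.tens ((pushK f).obj Y) ((forgetU I).obj (Over.mk q))).carrier :=
  ((pushK f).map (Y ◁ squareU w) ≫ projHom (adjK f) Y ((forgetU I).obj (Over.mk q))).lin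

/-- The pullback property identifies `J'` with `f^* I'`, and the projection formula replaces the
cotensor product with `f^* I'` over `J` by the one with `I'` over `I`. -/
theorem squareLin_bijective (h : IsPullback f' p q f) (Y : VecC J) :
    Function.Bijective (squareLin h.w Y) := by
  have := isIso_squareU h
  exact Comodule.bijective_of_isIso _

theorem incl_squareLin (w : f' ≫ q = p ≫ f) (Y : VecC J)
    (x : (Comodule.tens Y ((forgetU J).obj (Over.mk p))).carrier) :
    Comodule.incl _ _ (squareLin w Y x) = (coalgMap f' : J'.obj →ₗ[k] I'.obj).lTensor Y.carrier
      (Comodule.incl Y ((forgetU J).obj (Over.mk p)) x) := by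
  have h : evalK f _ ∘ₗ (squareU w).lin = (coalgMap f' : J'.obj →ₗ[k] I'.obj) :=
    LinearMap.ext (evalK_squareU w)
  refine (Comodule.corestrictIncl_projLin (coalgMap f) Y ((forgetU I).obj (Over.mk q))
    ((Y ◁ squareU w).lin x)).trans ?_
  refine (LinearMap.lTensor_comp_apply _ (evalK f _) (squareU w).lin _).symm.trans ?_
  exact LinearMap.congr_fun (congrArg (LinearMap.lTensor Y.carrier) h) _

/-- Inside the plain tensor products the evaluation condition forces `g` to act as `f'` on the
second leg. This is the map `squareLin`, already known to be bijective. -/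
theorem isIso_of_evalK_eq_evalK (h : IsPullback f' p q f) (Y : VecC J)
    (g : (pushK f').obj ((pullK p).obj Y) ⟶ (pullK q).obj ((pushK f).obj Y))
    (hg : ∀ t, evalK q _ (g.lin t) = evalK p Y t) : IsIso g := by
  have h₁ : ∀ t, Comodule.pullIncl (coalgMap q) ((pushK f).obj Y) (g.lin t) =
      (coalgMap f' : J'.obj →ₗ[k] I'.obj).lTensor Y.carrier
        (Comodule.pullIncl (coalgMap p) Y t) := by
    intro t
    refine (Comodule.rTensor_pullEval_coact (coalgMap q) _ _).symm.trans ?_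
    refine (congrArg _ (Comodule.hom_comm_apply g t).symm).trans ?_
    refine (LinearMap.rTensor_comp_apply _ _ _ _).symm.trans ?_
    have h₃ : evalK q _ ∘ₗ g.lin = evalK p Y := LinearMap.ext hg
    refine (LinearMap.congr_fun (congrArg (LinearMap.rTensor I'.obj) h₃) _).trans ?_
    refine (rTensor_lTensor (evalK p Y) _ _).trans ?_
    exact congrArg _ (Comodule.rTensor_pullEval_coact (coalgMap p) Y t)
  refine Comodule.isIso_of_bijective _ ⟨fun t t' htt => ?_, fun s => ?_⟩
  · obtain ⟨x, hx⟩ := exists_incl_of_pullIncl Y t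
    obtain ⟨x', hx'⟩ := exists_incl_of_pullIncl Y t'
    have h₂ := (h₁ t).symm.trans ((congrArg _ htt).trans (h₁ t'))
    rw [← hx, ← hx'] at h₂
    have h₃ : x = x' := (squareLin_bijective h Y).1 (Comodule.incl_injective _ _
      ((incl_squareLin h.w Y x).trans (h₂.trans (incl_squareLin h.w Y x').symm)))
    exact Comodule.pullIncl_injective _ _ (hx.symm.trans ((congrArg _ h₃).trans hx'))
  · obtain ⟨y, hy⟩ := exists_incl_of_pullIncl ((pushK f).obj Y) s
    obtain ⟨x, rfl⟩ := (squareLin_bijective h Y).2 y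
    obtain ⟨t, ht⟩ := exists_pullIncl_of_incl Y x
    refine ⟨t, Comodule.pullIncl_injective _ _ ((h₁ t).trans ?_)⟩
    rw [ht]
    exact (incl_squareLin h.w Y x).symm.trans hy

variable {C : CocommCoalg k}

theorem evalK_squareIso {I J I' J' : Powers C} (p : J' ⟶ J) (f : J ⟶ I) (f' : J' ⟶ I')
    (q : I' ⟶ I) (w : f' ≫ q = p ≫ f) (V : VecC I.obj)
    (t : ((pullK p.hom).obj ((pullK f.hom).obj V)).carrier) :
    evalK q.hom V (evalK f'.hom _ ((((psK C).squareIso p f f' q w).hom.app V).lin t)) =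
      evalK f.hom V (evalK p.hom _ t) := by
  have w' : p.hom ≫ f.hom = f'.hom ≫ q.hom := congrArg (fun a => a.hom) w.symm
  have h₁ := PseudofunctorStructure.squareIso_hom_app (psK C) p f f' q w V
  refine (congrArg (fun g => evalK q.hom V (evalK f'.hom _ (Comodule.Hom.lin g t))) h₁).trans ?_
  refine (evalK_pullKComp f'.hom q.hom V _).trans ?_
  refine (evalK_eqToHom w' V _ _).trans ?_
  refine (evalK_pullKComp p.hom f.hom V _).symm.trans ?_
  have h₂ := (pullKComp p.hom f.hom).inv_hom_id_app V
  exact congrArg (fun y => evalK f.hom V (evalK p.hom _ y))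
    (LinearMap.congr_fun (congrArg Comodule.Hom.lin h₂) t)

/-- The Beck-Chevalley condition for a pullback square of coalgebras. -/
theorem isIso_mateEquiv_squareIso {I J I' J' : Powers C} (p : J' ⟶ J) (f : J ⟶ I) (f' : J' ⟶ I')
    (q : I' ⟶ I) (w : f' ≫ q = p ≫ f) (h : IsPullback f'.hom p.hom q.hom f.hom)
    {Aq : VecC I'.obj ⥤ VecC I.obj} {Ap : VecC J'.obj ⥤ VecC J.obj}
    (adjq : pullK q.hom ⊣ Aq) (adjp : pullK p.hom ⊣ Ap) :
    IsIso (mateEquiv adjq adjp (TwoSquare.mk (pullK f.hom) (pullK q.hom) (pullK p.hom)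
      (pullK f'.hom) ((psK C).squareIso p f f' q w).hom)).natTrans := by
  -- The question about `∀` becomes one about `f'_! p^* Y ⟶ q^* f_! Y`, where no right adjoint of a
  -- pullback functor appears.
  refine isIso_mateEquiv_of_isIso_map (adjK f.hom) (adjK f'.hom) adjp adjq _ fun Y => ?_
  refine isIso_of_evalK_eq_evalK h Y _ fun t => ?_
  refine (evalK_squareIso p f f' q w _ _).trans ?_
  refine (congrArg (evalK f.hom _) (evalK_map p.hom ((adjK f.hom).unit.app Y) t)).trans ?_
  exact Comodule.pullEval_pullUnit (coalgMap f.hom) Y _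

end BeckChevalley

/-! ### Finite products in the category of powers of `C`. -/

section PowersProducts

variable {k : Type u} [Field k] {C : CocommCoalg k}

/-- The first power is `C` itself and not `k ⊗ C`, so that case needs the terminal object
separately. -/
theorem nonempty_tensorPow_succ_iso (n : ℕ) :
    Nonempty (tensorPow C (n + 1) ≅ tensorPow C n ⨯ C) := by
  cases n with
  | zero => exact ⟨(Limits.prod.leftUnitor C).symm ≪≫ Limits.prod.mapIso
      (terminalIsTerminal.uniqueUpToIso CocommCoalg.isTerminalUnit) (Iso.refl C)⟩
  | succ n => exact ⟨(CocommCoalg.prodFanIsLimit (tensorPow C (n + 1)) C).conePointUniqueUpToIso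
      (limit.isLimit _)⟩

theorem nonempty_tensorPow_add_iso (n m : ℕ) :
    Nonempty (tensorPow C (n + m) ≅ tensorPow C n ⨯ tensorPow C m) := by
  induction m with
  | zero => exact ⟨(Limits.prod.rightUnitor _).symm ≪≫ Limits.prod.mapIso (Iso.refl _)
      (terminalIsTerminal.uniqueUpToIso CocommCoalg.isTerminalUnit)⟩
  | succ m ih =>
    obtain ⟨e⟩ := ih
    obtain ⟨e₁⟩ := nonempty_tensorPow_succ_iso (C := C) (n + m)
    obtain ⟨e₂⟩ := nonempty_tensorPow_succ_iso (C := C) m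
    exact ⟨e₁ ≪≫ Limits.prod.mapIso e (Iso.refl C) ≪≫ Limits.prod.associator _ _ _ ≪≫
      Limits.prod.mapIso (Iso.refl _) e₂.symm⟩

namespace Powers

/-- A binary fan in a full subcategory is a limit if its image is one. -/
def isLimitOfMap {𝒜 : Type*} [Category* 𝒜] {Q : ObjectProperty 𝒜} {X Y Z : Q.FullSubcategory}
    {a : Z ⟶ X} {b : Z ⟶ Y} (h : IsLimit (BinaryFan.mk a.hom b.hom)) : IsLimit (BinaryFan.mk a b) :=
  BinaryFan.isLimitMk
    (fun s => ObjectProperty.homMk (h.lift (BinaryFan.mk s.fst.hom s.snd.hom)))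
    (fun s => ObjectProperty.hom_ext _ (h.fac (BinaryFan.mk s.fst.hom s.snd.hom)
      ⟨WalkingPair.left⟩))
    (fun s => ObjectProperty.hom_ext _ (h.fac (BinaryFan.mk s.fst.hom s.snd.hom)
      ⟨WalkingPair.right⟩))
    (fun s _ h₁ h₂ => ObjectProperty.hom_ext _ (BinaryFan.IsLimit.hom_ext h
      ((congrArg (fun g => g.hom) h₁).trans (h.fac (BinaryFan.mk s.fst.hom s.snd.hom)
        ⟨WalkingPair.left⟩).symm)
      ((congrArg (fun g => g.hom) h₂).trans (h.fac (BinaryFan.mk s.fst.hom s.snd.hom)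
        ⟨WalkingPair.right⟩).symm)))

theorem exists_isLimit (X Y : Powers C) : ∃ (Z : Powers C) (a : Z ⟶ X) (b : Z ⟶ Y),
    Nonempty (IsLimit (BinaryFan.mk a.hom b.hom)) := by
  obtain ⟨X, n, rfl⟩ := X
  obtain ⟨Y, m, rfl⟩ := Y
  obtain ⟨e⟩ := nonempty_tensorPow_add_iso (C := C) n m
  refine ⟨⟨tensorPow C (n + m), n + m, rfl⟩, ObjectProperty.homMk (e.hom ≫ prod.fst),
    ObjectProperty.homMk (e.hom ≫ prod.snd), ⟨IsLimit.ofIsoLimit (prodIsProd _ _) ?_⟩⟩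
  exact BinaryFan.ext e.symm (by simp) (by simp)

instance : HasBinaryProducts (Powers C) :=
  have : ∀ {X Y : Powers C}, HasLimit (pair X Y) := fun {X Y} => by
    obtain ⟨Z, a, b, ⟨h⟩⟩ := exists_isLimit X Y
    exact ⟨⟨BinaryFan.mk a b, isLimitOfMap h⟩⟩
  hasBinaryProducts_of_hasLimit_pair _

variable (C) in
/-- The power `C^{⊗n}` as an object of `Powers C`. -/
def pow (n : ℕ) : Powers C := ⟨tensorPow C n, n, rfl⟩

variable (C) in
/-- `C^{⊗0} = k` is terminal. -/
def isTerminalPowZero : IsTerminal (pow C 0) :=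
  IsTerminal.ofUniqueHom (fun X => ObjectProperty.homMk (CocommCoalg.isTerminalUnit.from X.obj))
    (fun _ _ => ObjectProperty.hom_ext _ (CocommCoalg.isTerminalUnit.hom_ext _ _))

instance : HasTerminal (Powers C) := (isTerminalPowZero C).hasTerminal

instance : HasFiniteProducts (Powers C) := hasFiniteProducts_of_has_binary_and_terminal

/-- Products in `Powers C` are products of coalgebras. -/
theorem nonempty_isLimit_map {X Y Z : Powers C} {a : Z ⟶ X} {b : Z ⟶ Y}
    (h : IsLimit (BinaryFan.mk a b)) : Nonempty (IsLimit (BinaryFan.mk a.hom b.hom)) := by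
  obtain ⟨Z', a', b', ⟨h'⟩⟩ := exists_isLimit X Y
  let e : Z' ≅ Z := (isLimitOfMap h').conePointUniqueUpToIso h
  have h₁ : e.hom ≫ a = a' := (isLimitOfMap h').conePointUniqueUpToIso_hom_comp h
    ⟨WalkingPair.left⟩
  have h₂ : e.hom ≫ b = b' := (isLimitOfMap h').conePointUniqueUpToIso_hom_comp h
    ⟨WalkingPair.right⟩
  exact ⟨IsLimit.ofIsoLimit h' (BinaryFan.ext
    ((ObjectProperty.ι _).mapIso e)
    (congrArg (fun g => g.hom) h₁.symm) (congrArg (fun g => g.hom) h₂.symm))⟩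

theorem nonempty_isLimit_pow (n : ℕ) : ∃ c : Fan (fun _ : Fin n => Powers.gen C),
    c.pt = pow C n ∧ Nonempty (IsLimit c) := by
  induction n with
  | zero => exact ⟨Fan.mk (pow C 0) (fun i => i.elim0), rfl, ⟨Fan.IsLimit.mk _
      (fun s => (isTerminalPowZero C).from _) (fun _ i => i.elim0)
      (fun _ _ _ => (isTerminalPowZero C).hom_ext _ _)⟩⟩
  | succ n ih =>
    obtain ⟨c, hc, ⟨t⟩⟩ := ih
    obtain ⟨e⟩ := nonempty_tensorPow_succ_iso (C := C) n
    obtain ⟨pt, π⟩ := c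
    subst hc
    let a : pow C (n + 1) ⟶ Powers.gen C := ObjectProperty.homMk (e.hom ≫ prod.snd)
    let b : pow C (n + 1) ⟶ pow C n := ObjectProperty.homMk (e.hom ≫ prod.fst)
    -- `extendFanIsLimit` adds the new factor in front, whereas tensor powers add it at the end;
    -- hence the flip.
    have h : IsLimit (BinaryFan.mk a.hom b.hom) := IsLimit.ofIsoLimit
      (BinaryFan.isLimitFlip (prodIsProd (tensorPow C n) C))
      (BinaryFan.ext e.symm (Iso.inv_hom_id_assoc e _).symm (Iso.inv_hom_id_assoc e _).symm)
    exact ⟨_, rfl, ⟨extendFanIsLimit (fun _ => Powers.gen C) t (isLimitOfMap h)⟩⟩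

theorem generated (X : Powers C) : ∃ n : ℕ, Nonempty (X ≅ ∏ᶜ fun _ : Fin n => Powers.gen C) := by
  obtain ⟨X, n, rfl⟩ := X
  obtain ⟨c, hc, ⟨t⟩⟩ := nonempty_isLimit_pow (C := C) n
  exact ⟨n, ⟨eqToIso hc.symm ≪≫ t.conePointUniqueUpToIso (limit.isLimit _)⟩⟩

/-- The base change square of a product projection is a pullback. -/
theorem isPullback_of_isLimit {I J Z I' J' : Powers C} {q : I' ⟶ I} {r : I' ⟶ Z} {p : J' ⟶ J}
    {s : J' ⟶ Z} (h : IsLimit (BinaryFan.mk q r)) (h' : IsLimit (BinaryFan.mk p s)) (f : J ⟶ I)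
    (f' : J' ⟶ I') (w : f' ≫ q = p ≫ f) (w' : f' ≫ r = s) :
    IsPullback f'.hom p.hom q.hom f.hom := by
  obtain ⟨h⟩ := nonempty_isLimit_map h
  obtain ⟨h'⟩ := nonempty_isLimit_map h'
  have t := CocommCoalg.isTerminalUnit (k := k)
  -- Pullback pasting: the right square presents `I'` as a product over the terminal object, and the
  -- outer rectangle does the same for `J'`.
  refine IsPullback.of_right (h₁₂ := r.hom) (v₁₃ := t.from _) (h₂₂ := t.from _) ?_
    (congrArg (fun g => g.hom) w) (IsPullback.of_is_product' h t).flip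
  have h₁ : f'.hom ≫ r.hom = s.hom := congrArg (fun g => g.hom) w'
  rw [h₁, t.hom_ext (f.hom ≫ t.from _) (t.from _)]
  exact (IsPullback.of_is_product' h' t).flip

end Powers

end PowersProducts

/-! ### Assembly of the hyperdoctrine. -/

section Hyperdoctrine

/-- The product `X ⨯ Y`, as a product of `Y` and `X`. -/
def isLimitProdSwap {𝒜 : Type*} [Category* 𝒜] (X Y : 𝒜) [HasBinaryProduct X Y] :
    IsLimit (BinaryFan.mk (prod.snd : X ⨯ Y ⟶ Y) prod.fst) :=
  BinaryFan.isLimitFlip (c := BinaryFan.mk prod.fst prod.snd) (prodIsProd X Y)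

variable {k : Type u} [Field k] {C : CocommCoalg k}

theorem isCosemisimple_of_powers (hC : ∀ n, IsCosemisimple k (tensorPow C n).obj)
    (X : Powers C) : IsCosemisimple k X.obj.obj := by
  obtain ⟨X, n, rfl⟩ := X
  exact hC n

/-- Quantification along a family of product projections. -/
def quantifiers (hC : ∀ n, IsCosemisimple k (tensorPow C n).obj) (P : Powers C → Powers C)
    (Pmap : ∀ {J I : Powers C}, (J ⟶ I) → (P J ⟶ P I)) (π : ∀ I, P I ⟶ I)
    (w : ∀ {J I : Powers C} (f : J ⟶ I), Pmap f ≫ π I = π J ≫ f)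
    (h : ∀ {J I : Powers C} (f : J ⟶ I), IsPullback (Pmap f).hom (π J).hom (π I).hom f.hom) :
    Quantifiers (psK C) P Pmap π w :=
  have : ∀ I, (pullK (π I).hom).IsLeftAdjoint := fun I =>
    pullK_isLeftAdjoint (π I).hom (isCosemisimple_of_powers hC _) (isCosemisimple_of_powers hC _)
  { ex := fun I => pushK (π I).hom
    exAdj := fun I => adjK (π I).hom
    all := fun I => (pullK (π I).hom).rightAdjoint
    allAdj := fun I => Adjunction.ofIsLeftAdjoint (pullK (π I).hom)
    beckChevalley := fun {J I} f => isIso_mateEquiv_squareIso (π J) f (Pmap f) (π I) (w f) (h f)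
      (Adjunction.ofIsLeftAdjoint (pullK (π I).hom)) (Adjunction.ofIsLeftAdjoint _) }

variable [HasPullbacks (CocommCoalg k)]

/-- The functor `Bᵒᵖ ⥤ LNL` given by `D ↦ (U^D ⊣ R^D)`. -/
def lnlFunctor (hC : ∀ n, IsCosemisimple k (tensorPow C n).obj) : LNLFunctor (coalgDiagram C) where
  lnl I := lnlAdjunction I.obj (isCosemisimple_of_powers hC I)
  mor {J I} f := lnlMorphism f.hom (isCosemisimple_of_powers hC I) (isCosemisimple_of_powers hC J)
  psL := psL _
  psK := psK C
  mapId_monoidal I := pullKId_monoidal I.obj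
  mapComp_monoidal g f := pullKComp_monoidal g.hom f.hom
  mapId_U I X := isoKU_pullKId I.obj X
  mapComp_U g f X := isoKU_pullKComp f.hom g.hom X

/-- The linear hyperdoctrine of comodules over the powers of `C`. -/
def linearHyperdoctrine (hC : ∀ n, IsCosemisimple k (tensorPow C n).obj) :
    LinearHyperdoctrine (coalgDiagram C) (Powers.gen C) where
  toLNLFunctor := lnlFunctor hC
  generated := Powers.generated
  quantFst := quantifiers hC _ _ _ _ fun f => Powers.isPullback_of_isLimit
    (prodIsProd _ _) (prodIsProd _ _) f _ (prod.map_fst _ _) (by simp)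
  quantSnd := quantifiers hC _ _ _ _ fun f => Powers.isPullback_of_isLimit
    (isLimitProdSwap _ _) (isLimitProdSwap _ _) f _
    (prod.map_snd (𝟙 _) f) ((prod.map_fst (𝟙 _) f).trans (Category.comp_id _))

end Hyperdoctrine

end LNLHyp

end

theorem mainTheorem1 {k : Type u} [Field k] (C : CocommCoalg k) (hC : IsCosemisimple k C.obj)
    (hk : PerfectField k ∨ ∀ n : ℕ, IsCosemisimple k (tensorPow C n).obj) :
    ∃ _ : HasPullbacks (CocommCoalg k),
      Nonempty (LinearHyperdoctrine (coalgDiagram C) (Powers.gen C)) :=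
  ⟨CocommCoalg.hasPullbacks, ⟨linearHyperdoctrine (isCosemisimple_tensorPow C hC hk)⟩⟩
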